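/- Let $d\in\mathbb{N}$, $T>0$, $\Omega=(0,T)\times\mathbb{T}^d$ with $\mathbb{T}^d=\mathbb{R}^d/\mathbb{Z}^d$, and let $h,\kappa\in C^3(I)$, where $I=[0,\infty)$ or $I=(0,\infty)$. For $0<\alpha<1$ let $B_3^{\alpha,\infty}(\Omega)$ be the space of all $w\in L^3(\Omega)$ with $$\sup_{t>0}\,t^{-\alpha}\sup_{|\xi|\le t}\|w(\cdot+\xi)-w\|_{L^3(\Omega\cap(\Omega-\xi))}<\infty ,$$ where $\xi$ runs over space-time shifts. Let $\rho:\Omega\to\mathbb{R}$ and $u:\Omega\to\mathbb{R}^d$, with $\rho\ge 0$ a.e. if $I=[0,\infty)$, and $\rho\ge c$ a.e. for some constant $c>0$ if $I=(0,\infty)$. Assume that $$u\in (B_3^{\alpha,\infty}\cap L^\infty)(\Omega),\qquad \rho,\ \nabla\rho,\ \Delta\rho\in (B_3^{\beta,\infty}\cap L^\infty)(\Omega),$$ with $1>\alpha\ge\beta>0$ and $\min(2\alpha+\beta,\alpha+2\beta)>1$, where $\nabla$ and $\Delta$ act on the space variable in the sense of distributions, and that $(\rho,u)$ solves the isothermal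 Euler–Korteweg system $$\partial_t(\rho u)+\operatorname{div}(\rho u\otimes u)=-\rho\nabla\Big(h'(\rho)+\tfrac{\kappa'(\rho)}{2}|\nabla\rho|^2-\operatorname{div}(\kappa(\rho)\nabla\rho)\Big),\qquad \partial_t\rho+\operatorname{div}(\rho u)=0$$ in the sense of distributions on $\Omega$. (The product of $\rho$ with a gradient $\nabla\mu$, $\mu\in L^\infty$, is the distribution $\varphi\mapsto-\int_\Omega\mu\,\nabla(\rho\varphi)$.) Then the total energy is locally conserved: for every $\phi\in C_c^1(\Omega)$ $$\int_0^T\!\!\int_{\mathbb{T}^d}\Big(\tfrac12\rho|u|^2+h(\rho)+\tfrac12\kappa(\rho)|\nabla\rho|^2\Big)\partial_t\phi\,dx\,dt+\int_0^T\!\!\int_{\mathbb{T}^d}\Big(\rho u\big(\tfrac12|u|^2+h'(\rho)+\tfrac12\kappa'(\rho)|\nabla\rho|^2-\operatorname{div}(\kappa(\rho)\nabla\rho)\big)+\kappa(\rho)\nabla\rho\,\operatorname{div}(\rho u)\Big)\cdot\nabla\phi\,dx\,dt=0 .$$ Here $\kappa(\rho)\nabla\rho$ has a locally integrable weak space Jacobian,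 whose trace is $\operatorname{div}(\kappa(\rho)\nabla\rho)=\kappa'(\rho)|\nabla\rho|^2+\kappa(\rho)\Delta\rho$. As $\operatorname{div}(\rho u)$ is in general only a distribution, the term with $\kappa(\rho)\nabla\rho\,\operatorname{div}(\rho u)$ is read as the Lebesgue integral if $\operatorname{div}(\rho u)\in L^1_{loc}(\Omega)$; in general it is read, for $\phi\in C_c^2(\Omega)$, as $$-\int_0^T\!\!\int_{\mathbb{T}^d}\rho u\cdot\nabla\big(\kappa(\rho)\nabla\rho\cdot\nabla\phi\big)\,dx\,dt ,$$ and, for $\phi\in C_c^1(\Omega)$, as the limit of this expression along every sequence in $C_c^2(\Omega)$, with supports in a common compact set, that converges to $\phi$ uniformly together with its first derivatives (such sequences exist, and the limit exists and is the same for all of them). The choice $I=(0,\infty)$ admits $\kappa(\rho)=\varepsilon_0^2/(4\rho)$, the quantum hydrodynamics (QHD) system. -/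

import Mathlib

open MeasureTheory Filter Topology
open scoped ENNReal

noncomputable section

namespace EulerKorteweg

/-- Space-time `ℝ × 𝕋^d`, with `𝕋^d = (ℝ/ℤ)^d`; it carries the product of the Lebesgue measures. -/
abbrev SpaceTime (d : ℕ) : Type := ℝ × UnitAddTorus (Fin d)

/-- The vectors of `ℝ^d`, with the Euclidean norm. -/
abbrev Vec (d : ℕ) : Type := EuclideanSpace ℝ (Fin d)

/-- The domain `Ω = (0,T) × 𝕋^d`. -/
def domain (d : ℕ) (T : ℝ) : Set (SpaceTime d) := Set.Ioo 0 T ×ˢ Set.univ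

/-- Lebesgue measure on `Ω = (0,T) × 𝕋^d`. -/
def domainMeasure (d : ℕ) (T : ℝ) : Measure (SpaceTime d) := volume.restrict (domain d T)

/-- The covering map `ℝ × ℝ^d → ℝ × 𝕋^d`. -/
def cover {d : ℕ} (ξ : ℝ × Vec d) : SpaceTime d := (ξ.1, fun i => (ξ.2 i : UnitAddCircle))

/-! ### Derivatives of functions and test functions -/

/-- The classical time derivative `∂ₜ φ`. -/
def dt {d : ℕ} (φ : SpaceTime d → ℝ) (z : SpaceTime d) : ℝ :=
  deriv (fun s : ℝ => φ (s, z.2)) z.1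

/-- The classical space derivative `∂_{x_j} φ`. -/
def dx {d : ℕ} (j : Fin d) (φ : SpaceTime d → ℝ) (z : SpaceTime d) : ℝ :=
  deriv (fun s : ℝ => φ (z.1, z.2 + Pi.single j (s : UnitAddCircle))) 0

/-- `φ ∈ C_c^n((0,T) × 𝕋^d)`. -/
structure IsTest {d : ℕ} (T : ℝ) (n : ℕ∞) (φ : SpaceTime d → ℝ) : Prop where
  contDiff : ContDiff ℝ n (fun ξ : ℝ × Vec d => φ (cover ξ))
  hasCompactSupport : HasCompactSupport φ
  tsupport_subset : tsupport φ ⊆ domain d T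

/-- `∂_{x_j} f = g` in the sense of distributions on `(0,T) × 𝕋^d`, for `f, g ∈ L¹_loc`. -/
structure HasWeakDeriv {d : ℕ} (T : ℝ) (j : Fin d) (f g : SpaceTime d → ℝ) : Prop where
  locallyIntegrable_left : LocallyIntegrableOn f (domain d T)
  locallyIntegrable_right : LocallyIntegrableOn g (domain d T)
  integral_eq : ∀ φ : SpaceTime d → ℝ, IsTest T ⊤ φ →
    ∫ z, f z * dx j φ z ∂(domainMeasure d T) = -∫ z, g z * φ z ∂(domainMeasure d T)

/-- `div_x F = g` in the sense of distributions on `(0,T) × 𝕋^d`, for `F, g ∈ L¹_loc`. -/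
structure HasWeakDiv {d : ℕ} (T : ℝ) (F : SpaceTime d → Vec d) (g : SpaceTime d → ℝ) : Prop where
  locallyIntegrable_left : LocallyIntegrableOn F (domain d T)
  locallyIntegrable_right : LocallyIntegrableOn g (domain d T)
  integral_eq : ∀ φ : SpaceTime d → ℝ, IsTest T ⊤ φ →
    ∫ z, ∑ j, F z j * dx j φ z ∂(domainMeasure d T) = -∫ z, g z * φ z ∂(domainMeasure d T)

/-! ### The Besov space `B_p^{α,∞}((0,T) × 𝕋^d)` -/

/-- The Euclidean length `|ξ|` of a space-time shift. -/
def shiftLength {d : ℕ} (ξ : ℝ × Vec d) : ℝ := √(ξ.1 ^ 2 + ‖ξ.2‖ ^ 2)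

/-- `sup_{t>0} t^{-α} sup_{|ξ| ≤ t} ‖w(· + ξ) - w‖_{L^p(Ω ∩ (Ω - ξ))}`. -/
def besovSeminorm {d : ℕ} {E : Type*} [NormedAddCommGroup E] (T α : ℝ) (p : ℝ≥0∞)
    (w : SpaceTime d → E) : ℝ≥0∞ :=
  ⨆ (t : ℝ) (_ : 0 < t), ENNReal.ofReal (t ^ (-α)) *
    ⨆ (ξ : ℝ × Vec d) (_ : shiftLength ξ ≤ t),
      eLpNorm (fun z => w (z + cover ξ) - w z) p
        (volume.restrict (domain d T ∩ {z | z + cover ξ ∈ domain d T}))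

/-- `w ∈ B_p^{α,∞}((0,T) × 𝕋^d)`. -/
def MemBesov {d : ℕ} {E : Type*} [NormedAddCommGroup E] (T α : ℝ) (p : ℝ≥0∞)
    (w : SpaceTime d → E) : Prop :=
  MemLp w p (domainMeasure d T) ∧ besovSeminorm T α p w < ∞

/-- `w ∈ (B_3^{α,∞} ∩ L^∞)((0,T) × 𝕋^d)`. -/
def MemBesovLinfty {d : ℕ} {E : Type*} [NormedAddCommGroup E] (T α : ℝ)
    (w : SpaceTime d → E) : Prop :=
  MemBesov T α 3 w ∧ MemLp w ∞ (domainMeasure d T)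

/-! ### The Euler-Korteweg system

In what follows `I` is the interval on which `h` and `κ` are given, `q = ∇ρ` and `r = Δρ`.
The derivatives `h'`, `κ'` are taken within `I`, so that they are one-sided at an end point of `I`. -/

/-- The function `div(κ(ρ)∇ρ) = κ'(ρ)|∇ρ|² + κ(ρ)Δρ`. -/
def capillaryDiv {d : ℕ} (I : Set ℝ) (κ : ℝ → ℝ) (ρ : SpaceTime d → ℝ) (q : SpaceTime d → Vec d)
    (r : SpaceTime d → ℝ) (z : SpaceTime d) : ℝ :=
  derivWithin κ I (ρ z) * ‖q z‖ ^ 2 + κ (ρ z) * r z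

/-- The function `μ = h'(ρ) + κ'(ρ)/2 |∇ρ|² - div(κ(ρ)∇ρ)`. -/
def potential {d : ℕ} (I : Set ℝ) (h κ : ℝ → ℝ) (ρ : SpaceTime d → ℝ) (q : SpaceTime d → Vec d)
    (r : SpaceTime d → ℝ) (z : SpaceTime d) : ℝ :=
  derivWithin h I (ρ z) + derivWithin κ I (ρ z) / 2 * ‖q z‖ ^ 2 - capillaryDiv I κ ρ q r z

/-- `(ρ, u)` solves, in the sense of distributions on `(0,T) × 𝕋^d`,
`∂ₜρ + div(ρu) = 0` and `∂ₜ(ρu) + div(ρu ⊗ u) = -ρ∇μ`.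
The product of `ρ` and the distribution `∇μ` is the usual one, for `ρ` with a bounded weak gradient:
`⟨-ρ ∂ᵢμ, φ⟩ = ∫ μ ∂ᵢ(ρφ) = ∫ μ (φ ∂ᵢρ + ρ ∂ᵢφ)`. -/
structure IsDistribSolution {d : ℕ} (T : ℝ) (I : Set ℝ) (h κ : ℝ → ℝ) (ρ : SpaceTime d → ℝ)
    (u : SpaceTime d → Vec d) (q : SpaceTime d → Vec d) (r : SpaceTime d → ℝ) : Prop where
  continuity : ∀ φ : SpaceTime d → ℝ, IsTest T ⊤ φ →
    ∫ z, (ρ z * dt φ z + ∑ j, ρ z * u z j * dx j φ z) ∂(domainMeasure d T) = 0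
  momentum : ∀ i : Fin d, ∀ φ : SpaceTime d → ℝ, IsTest T ⊤ φ →
    ∫ z, (ρ z * u z i * dt φ z + ∑ j, ρ z * u z i * u z j * dx j φ z
      + potential I h κ ρ q r z * (φ z * q z i + ρ z * dx i φ z)) ∂(domainMeasure d T) = 0

/-! ### The local energy balance -/

/-- The total energy density `½ρ|u|² + h(ρ) + ½κ(ρ)|∇ρ|²`. -/
def energy {d : ℕ} (h κ : ℝ → ℝ) (ρ : SpaceTime d → ℝ) (u q : SpaceTime d → Vec d)
    (z : SpaceTime d) : ℝ :=
  1 / 2 * ρ z * ‖u z‖ ^ 2 + h (ρ z) + 1 / 2 * κ (ρ z) * ‖q z‖ ^ 2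

/-- The `i`-th component of `ρu(½|u|² + h'(ρ) + ½κ'(ρ)|∇ρ|² - div(κ(ρ)∇ρ))`, the part of the energy
flux that is a function. -/
def transportFlux {d : ℕ} (I : Set ℝ) (h κ : ℝ → ℝ) (ρ : SpaceTime d → ℝ)
    (u q : SpaceTime d → Vec d) (r : SpaceTime d → ℝ) (i : Fin d) (z : SpaceTime d) : ℝ :=
  ρ z * u z i * (1 / 2 * ‖u z‖ ^ 2 + derivWithin h I (ρ z)
    + 1 / 2 * derivWithin κ I (ρ z) * ‖q z‖ ^ 2 - capillaryDiv I κ ρ q r z)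

/-- The terms `∫∫ (½ρ|u|² + h(ρ) + ½κ(ρ)|∇ρ|²) ∂ₜφ
+ ∫∫ ρu(½|u|² + h'(ρ) + ½κ'(ρ)|∇ρ|² - div(κ(ρ)∇ρ)) · ∇φ` of the energy balance. -/
def regularTerms {d : ℕ} (T : ℝ) (I : Set ℝ) (h κ : ℝ → ℝ) (ρ : SpaceTime d → ℝ)
    (u q : SpaceTime d → Vec d) (r : SpaceTime d → ℝ) (φ : SpaceTime d → ℝ) : ℝ :=
  ∫ z, energy h κ ρ u q z * dt φ z ∂(domainMeasure d T)
    + ∫ z, ∑ i, transportFlux I h κ ρ u q r i z * dx i φ z ∂(domainMeasure d T)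

/-- The pairing of the distribution `κ(ρ)∇ρ div(ρu)` with `∇φ`, for `φ` of class `C²`. As `div(ρu)` is
in general only a distribution, the product with it is the usual one for factors `gᵢ = κ(ρ)∂ᵢρ`
with weak derivatives `M i j = ∂ⱼgᵢ`:
`∑ᵢ ⟨gᵢ div(ρu), ∂ᵢφ⟩ = -∑ᵢ ∫ ρu · ∇(gᵢ ∂ᵢφ) = -∑ᵢⱼ ∫ ρ uⱼ (∂ⱼgᵢ ∂ᵢφ + gᵢ ∂ⱼ∂ᵢφ)`. -/
def kortewegPairing {d : ℕ} (T : ℝ) (κ : ℝ → ℝ) (ρ : SpaceTime d → ℝ)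
    (u q : SpaceTime d → Vec d) (M : SpaceTime d → Matrix (Fin d) (Fin d) ℝ)
    (φ : SpaceTime d → ℝ) : ℝ :=
  -∫ z, ∑ i, ∑ j, ρ z * u z j * (M z i j * dx i φ z + κ (ρ z) * q z i * dx j (dx i φ) z)
    ∂(domainMeasure d T)

/-- The functions `ψ n ∈ C_c²` converge to `φ` in `C_c¹((0,T) × 𝕋^d)`: the supports stay in a fixed
compact set, and the functions and their first derivatives converge uniformly. -/
structure ApproxC1 {d : ℕ} (T : ℝ) (ψ : ℕ → SpaceTime d → ℝ) (φ : SpaceTime d → ℝ) : Prop where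
  isTest : ∀ n, IsTest T 2 (ψ n)
  support : ∃ K : Set (SpaceTime d), IsCompact K ∧ K ⊆ domain d T ∧ ∀ n, tsupport (ψ n) ⊆ K
  unif : TendstoUniformly ψ φ atTop
  unif_dt : TendstoUniformly (fun n => dt (ψ n)) (dt φ) atTop
  unif_dx : ∀ j, TendstoUniformly (fun n => dx j (ψ n)) (dx j φ) atTop

/-- `c` is the value at `φ ∈ C_c¹` of the continuous extension of `kortewegPairing` from `C_c²`. -/
def IsKortewegPairing {d : ℕ} (T : ℝ) (κ : ℝ → ℝ) (ρ : SpaceTime d → ℝ)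
    (u q : SpaceTime d → Vec d) (M : SpaceTime d → Matrix (Fin d) (Fin d) ℝ)
    (φ : SpaceTime d → ℝ) (c : ℝ) : Prop :=
  (∃ ψ : ℕ → SpaceTime d → ℝ, ApproxC1 T ψ φ) ∧
    ∀ ψ : ℕ → SpaceTime d → ℝ, ApproxC1 T ψ φ →
      Tendsto (fun n => kortewegPairing T κ ρ u q M (ψ n)) atTop (𝓝 c)

end EulerKorteweg

end

open EulerKorteweg

/-! The proof is a commutator argument in the manner of Constantin, E and Titi. Mollify everything
in space and time at scale ε: let P, U, Q, R be the mollified ρ, u, ∇ρ, Δρ, and m, B, Pi, S the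
mollified ρu, ρu⊗u, μρ, μ∇ρ. Since -ρ∇μ = -∇(μρ) + μ∇ρ, the system becomes ∂ₜP + div m = 0 and ∂ₜm +
div B + ∇Pi = S, away from the initial and final times. The velocity is mollified itself and never
recovered as m/P, so no division by the density occurs. The chain rule then gives an exact energy
balance for (P, U, Q, R) in which the only errors are the commutators a = m - PU, b = B - m⊗U, c =
Pi - mu·P, e = S - mu·Q, with mu the potential computed from the mollified fields
(`Fields.Smooth.balance`).

Tested with φ and integrated by parts, the errors fall into two groups
(`Fields.Smooth.integral_balance`). Terms without derivatives of the fields vanish by bounded L¹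
convergence. The others are a commutator times a derivative of U or of mu. A commutator is quadratic
in increments, and a derivative costs ε⁻¹ but leaves one increment. If w stands for (ρ, ∇ρ, Δρ),
then a is of type wu, b of type (u+w)u, c of type ww, while ∂U is of type u and ∇mu of type w. Every
product that occurs has at least one u-increment, so it is at most ε⁻¹(u³ + u²w + uw²) in mean
oscillations (`Solution.trilinearBound_hard`). Its integral is O(ε^(α+2β-1)), which tends to 0; a
term www would only give 3β. As β ≤ α, the minimum in the hypothesis is α+2β.

What remains is K(P) Q ∂ₜP = -K(P) Q div m paired with ∇φ (`Solution.tendsto_div`). For φ of class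
C² the divergence is integrated by parts, which needs the Jacobian of κ(ρ)∇ρ and hence the Hessian
of ρ. The latter is square integrable because ∫χ|D²P|² = ∫χ|ΔP|² on the torus for a weight χ of time
only, and Δρ is bounded (`DensityData.exists_hessian`). If div(ρu) is locally integrable, the
mollifier is moved to the other factor instead. For φ of class C¹ the pairing extends because, by
the balance just proved, it equals minus terms that involve only first derivatives of φ.

All this is done for bounded Borel representatives, extended by zero in time, and for C³ extensions
of h and κ to the line; `exists_solution` provides the reduction. -/

namespace EulerKorteweg

/-! ### Calculus on space-time through the covering map. -/

variable {d : ℕ}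

theorem cover_add (ξ ζ : ℝ × Vec d) : cover (ξ + ζ) = cover ξ + cover ζ := by
  refine Prod.ext rfl (funext fun i => ?_)
  simp [cover]

theorem cover_zero : cover (0 : ℝ × Vec d) = 0 := by
  refine Prod.ext rfl (funext fun i => ?_)
  simp [cover]

theorem cover_neg (ξ : ℝ × Vec d) : cover (-ξ) = -cover ξ := by
  refine Prod.ext rfl (funext fun i => ?_)
  simp [cover]

theorem cover_surjective : Function.Surjective (cover : ℝ × Vec d → SpaceTime d) := by
  rintro ⟨t, x⟩
  choose y hy using fun i => QuotientAddGroup.mk_surjective (x i)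
  exact ⟨(t, WithLp.toLp 2 y), Prod.ext rfl (funext hy)⟩

theorem continuous_cover : Continuous (cover : ℝ × Vec d → SpaceTime d) := by
  refine continuous_fst.prodMk (continuous_pi fun i => ?_)
  exact (AddCircle.continuous_mk' 1).comp (by fun_prop)

/-- Smoothness is defined after pulling back to ℝ × ℝ^d; the quotient property lets continuity
descend to space-time. -/
theorem isOpenQuotientMap_cover : IsOpenQuotientMap (cover : ℝ × Vec d → SpaceTime d) := by
  refine ⟨cover_surjective, continuous_cover, ?_⟩
  have h1 : IsOpenMap (fun x : Fin d → ℝ => fun i => (x i : UnitAddCircle)) :=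
    IsOpenMap.piMap (fun _ => QuotientAddGroup.isOpenMap_coe)
      (Filter.Eventually.of_forall fun _ => QuotientAddGroup.mk_surjective)
  have h2 : IsOpenMap (fun x : Vec d => fun i => (x i : UnitAddCircle)) :=
    h1.comp (PiLp.homeomorph 2 fun _ : Fin d => ℝ).isOpenMap
  exact IsOpenMap.id.prodMap h2

instance : (volume : Measure (SpaceTime d)).IsAddHaarMeasure :=
  Measure.prod.instIsAddHaarMeasure volume volume

instance : (volume : Measure (ℝ × Vec d)).IsAddHaarMeasure :=
  inferInstanceAs (Measure.IsAddHaarMeasure ((volume : Measure ℝ).prod (volume : Measure (Vec d))))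

instance {T : ℝ} : IsFiniteMeasure (domainMeasure d T) := by
  constructor
  rw [domainMeasure, Measure.restrict_apply_univ, domain, Measure.volume_eq_prod, Measure.prod_prod]
  exact ENNReal.mul_lt_top (by simp) (isCompact_univ.measure_lt_top)

/-- The derivative of a function on space-time in the direction `v`. -/
noncomputable def pd (v : ℝ × Vec d) (f : SpaceTime d → ℝ) (z : SpaceTime d) : ℝ :=
  deriv (fun s : ℝ => f (z + cover (s • v))) 0

/-- The unit vector in the direction of time. -/
noncomputable def et : ℝ × Vec d := (1, 0)

/-- The unit vectors in the directions of space. -/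
noncomputable def ex (j : Fin d) : ℝ × Vec d := (0, EuclideanSpace.single j 1)

theorem dt_eq_pd (f : SpaceTime d → ℝ) : dt f = pd et f := by
  ext z
  have h : (fun s : ℝ => f (z + cover (s • (et : ℝ × Vec d)))) = fun s => f (z.1 + s, z.2) := by
    ext s
    congr 1
    refine Prod.ext (by simp [cover, et]) (funext fun i => ?_)
    simp [cover, et]
  rw [pd, h, deriv_comp_const_add (f := fun s => f (s, z.2)), add_zero]
  rfl

theorem dx_eq_pd (j : Fin d) (f : SpaceTime d → ℝ) : dx j f = pd (ex j) f := by
  ext z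
  rw [pd, dx]
  congr 1
  ext s
  congr 1
  refine Prod.ext (by simp [cover, ex]) (funext fun i => ?_)
  rcases eq_or_ne i j with rfl | hij
  · simp [cover, ex]
  · simp [cover, ex, hij]

/-- A function on space-time is of class `C^n`. -/
def Sm (n : WithTop ℕ∞) (f : SpaceTime d → ℝ) : Prop :=
  ContDiff ℝ n (fun ξ : ℝ × Vec d => f (cover ξ))

theorem Sm.of_le {m n : WithTop ℕ∞} {f : SpaceTime d → ℝ} (hf : Sm n f) (h : m ≤ n) : Sm m f :=
  ContDiff.of_le hf h

theorem sm_const (n : WithTop ℕ∞) (c : ℝ) : Sm n (fun _ : SpaceTime d => c) := contDiff_const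

theorem Sm.add {n : WithTop ℕ∞} {f g : SpaceTime d → ℝ} (hf : Sm n f) (hg : Sm n g) :
    Sm n (fun z => f z + g z) := ContDiff.add hf hg

theorem Sm.sub {n : WithTop ℕ∞} {f g : SpaceTime d → ℝ} (hf : Sm n f) (hg : Sm n g) :
    Sm n (fun z => f z - g z) := ContDiff.sub hf hg

theorem Sm.mul {n : WithTop ℕ∞} {f g : SpaceTime d → ℝ} (hf : Sm n f) (hg : Sm n g) :
    Sm n (fun z => f z * g z) := ContDiff.mul hf hg

theorem Sm.pow {n : WithTop ℕ∞} {f : SpaceTime d → ℝ} (hf : Sm n f) (k : ℕ) :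
    Sm n (fun z => f z ^ k) := ContDiff.pow hf k

theorem Sm.sum {n : WithTop ℕ∞} {ι : Type*} {s : Finset ι} {f : ι → SpaceTime d → ℝ}
    (hf : ∀ i ∈ s, Sm n (f i)) : Sm n (fun z => ∑ i ∈ s, f i z) := ContDiff.sum hf

theorem Sm.comp {n : WithTop ℕ∞} {f : SpaceTime d → ℝ} {Φ : ℝ → ℝ} (hΦ : ContDiff ℝ n Φ)
    (hf : Sm n f) : Sm n (fun z => Φ (f z)) := ContDiff.comp hΦ hf

theorem sm_time {n : WithTop ℕ∞} {χ : ℝ → ℝ} (hχ : ContDiff ℝ n χ) :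
    Sm n (fun z : SpaceTime d => χ z.1) := hχ.comp contDiff_fst

theorem Sm.continuous {n : WithTop ℕ∞} {f : SpaceTime d → ℝ} (hf : Sm n f) : Continuous f :=
  isOpenQuotientMap_cover.isQuotientMap.continuous_iff.2 (ContDiff.continuous hf)

theorem Sm.hasDerivAt_line {f : SpaceTime d → ℝ} (hf : Sm 1 f) (v ξ : ℝ × Vec d) (s : ℝ) :
    HasDerivAt (fun s : ℝ => f (cover ξ + cover (s • v)))
      (fderiv ℝ (fun ξ : ℝ × Vec d => f (cover ξ)) (ξ + s • v) v) s := by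
  have h1 : HasDerivAt (fun s : ℝ => ξ + s • v) v s := by
    simpa using ((hasDerivAt_id s).smul_const v).const_add ξ
  have h2 := ((hf.differentiable one_ne_zero).differentiableAt (x := ξ + s • v)).hasFDerivAt.comp_hasDerivAt s h1
  simpa only [Function.comp_def, cover_add] using h2

theorem pd_cover {f : SpaceTime d → ℝ} (hf : Sm 1 f) (v ξ : ℝ × Vec d) :
    pd v f (cover ξ) = fderiv ℝ (fun ξ : ℝ × Vec d => f (cover ξ)) ξ v := by
  have h := (hf.hasDerivAt_line v ξ 0).deriv
  rwa [zero_smul, add_zero] at h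

theorem Sm.hasDerivAt {f : SpaceTime d → ℝ} (hf : Sm 1 f) (v : ℝ × Vec d) (z : SpaceTime d)
    (s : ℝ) : HasDerivAt (fun s : ℝ => f (z + cover (s • v))) (pd v f (z + cover (s • v))) s := by
  obtain ⟨ξ, rfl⟩ := cover_surjective z
  rw [← cover_add, pd_cover hf]
  exact hf.hasDerivAt_line v ξ s

theorem Sm.hasDerivAt_zero {f : SpaceTime d → ℝ} (hf : Sm 1 f) (v : ℝ × Vec d) (z : SpaceTime d) :
    HasDerivAt (fun s : ℝ => f (z + cover (s • v))) (pd v f z) 0 := by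
  simpa [cover_zero] using hf.hasDerivAt v z 0

theorem Sm.pd {n : WithTop ℕ∞} {f : SpaceTime d → ℝ} (hf : Sm (n + 1) f) (v : ℝ × Vec d) :
    Sm n (pd v f) := by
  have h1 : Sm 1 f := hf.of_le le_add_self
  have : (fun ξ : ℝ × Vec d => EulerKorteweg.pd v f (cover ξ)) =
      fun ξ => fderiv ℝ (fun ξ : ℝ × Vec d => f (cover ξ)) ξ v := by
    ext ξ; exact pd_cover h1 v ξ
  rw [Sm, this]
  exact (ContDiff.fderiv_right hf le_rfl).clm_apply contDiff_const

theorem Sm.continuous_pd {f : SpaceTime d → ℝ} (hf : Sm 1 f) (v : ℝ × Vec d) :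
    Continuous (EulerKorteweg.pd v f) :=
  (Sm.pd (n := 0) (by simpa using hf) v).continuous

theorem pd_add {f g : SpaceTime d → ℝ} (hf : Sm 1 f) (hg : Sm 1 g) (v : ℝ × Vec d)
    (z : SpaceTime d) : pd v (fun z => f z + g z) z = pd v f z + pd v g z :=
  ((hf.hasDerivAt_zero v z).add (hg.hasDerivAt_zero v z)).deriv

theorem pd_sub {f g : SpaceTime d → ℝ} (hf : Sm 1 f) (hg : Sm 1 g) (v : ℝ × Vec d)
    (z : SpaceTime d) : pd v (fun z => f z - g z) z = pd v f z - pd v g z :=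
  ((hf.hasDerivAt_zero v z).sub (hg.hasDerivAt_zero v z)).deriv

theorem pd_mul {f g : SpaceTime d → ℝ} (hf : Sm 1 f) (hg : Sm 1 g) (v : ℝ × Vec d)
    (z : SpaceTime d) : pd v (fun z => f z * g z) z = pd v f z * g z + f z * pd v g z := by
  have h := ((hf.hasDerivAt_zero v z).fun_mul (hg.hasDerivAt_zero v z)).deriv
  simp only [zero_smul, cover_zero, add_zero] at h
  exact h

theorem pd_const (c : ℝ) (v : ℝ × Vec d) (z : SpaceTime d) : pd v (fun _ => c) z = 0 := by
  simp [pd]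

theorem pd_const_mul {f : SpaceTime d → ℝ} (hf : Sm 1 f) (c : ℝ) (v : ℝ × Vec d)
    (z : SpaceTime d) : pd v (fun z => c * f z) z = c * pd v f z := by
  rw [pd_mul (sm_const 1 c) hf, pd_const]; ring

theorem pd_sum {ι : Type*} {s : Finset ι} {f : ι → SpaceTime d → ℝ} (hf : ∀ i ∈ s, Sm 1 (f i))
    (v : ℝ × Vec d) (z : SpaceTime d) :
    pd v (fun z => ∑ i ∈ s, f i z) z = ∑ i ∈ s, pd v (f i) z :=
  (HasDerivAt.fun_sum fun i hi => (hf i hi).hasDerivAt_zero v z).deriv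

theorem pd_comp {f : SpaceTime d → ℝ} {Φ : ℝ → ℝ} (hΦ : ContDiff ℝ 1 Φ) (hf : Sm 1 f)
    (v : ℝ × Vec d) (z : SpaceTime d) :
    pd v (fun z => Φ (f z)) z = deriv Φ (f z) * pd v f z := by
  have h1 : HasDerivAt Φ (deriv Φ (f z)) (f (z + cover ((0 : ℝ) • v))) := by
    simpa [cover_zero] using (hΦ.differentiable one_ne_zero (f z)).hasDerivAt
  exact (h1.comp (0 : ℝ) (hf.hasDerivAt_zero v z)).deriv

theorem pd_comm {f : SpaceTime d → ℝ} (hf : Sm 2 f) (v w : ℝ × Vec d) (z : SpaceTime d) :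
    pd v (pd w f) z = pd w (pd v f) z := by
  obtain ⟨ξ, rfl⟩ := cover_surjective z
  have h1 : Sm 1 f := hf.of_le (by norm_num)
  have h2 : Sm (1 + 1) f := by rw [one_add_one_eq_two]; exact hf
  have key : ∀ a b : ℝ × Vec d, pd a (pd b f) (cover ξ) =
      fderiv ℝ (fderiv ℝ (fun ξ : ℝ × Vec d => f (cover ξ))) ξ a b := by
    intro a b
    rw [pd_cover (h2.pd b)]
    have : (fun ξ : ℝ × Vec d => pd b f (cover ξ)) =
        fun ξ => fderiv ℝ (fun ξ : ℝ × Vec d => f (cover ξ)) ξ b := by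
      ext ξ; exact pd_cover h1 b ξ
    rw [this]
    have hd : DifferentiableAt ℝ (fderiv ℝ (fun ξ : ℝ × Vec d => f (cover ξ))) ξ :=
      (ContDiff.fderiv_right (m := 1) h2 le_rfl).differentiable one_ne_zero ξ
    rw [fderiv_clm_apply hd (differentiableAt_const b)]
    simp
  rw [key, key]
  exact (hf.contDiffAt.isSymmSndFDerivAt (by simp)) v w

theorem pd_congr {f g : SpaceTime d → ℝ} {U : Set (SpaceTime d)} (hU : IsOpen U)
    (h : ∀ z ∈ U, f z = g z) (v : ℝ × Vec d) {z : SpaceTime d} (hz : z ∈ U) :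
    pd v f z = pd v g z := by
  refine Filter.EventuallyEq.deriv_eq ?_
  have hc : Continuous fun s : ℝ => z + cover (s • v) :=
    continuous_const.add (continuous_cover.comp (by fun_prop))
  have : (fun s : ℝ => z + cover (s • v)) ⁻¹' U ∈ 𝓝 (0 : ℝ) :=
    hc.continuousAt.preimage_mem_nhds (hU.mem_nhds (by simpa [cover_zero] using hz))
  filter_upwards [this] with s hs using h _ hs

theorem pd_eq_zero_of_notMem_tsupport {f : SpaceTime d → ℝ} (v : ℝ × Vec d) {z : SpaceTime d}
    (hz : z ∉ tsupport f) : pd v f z = 0 := by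
  rw [pd_congr (g := fun _ => 0) (isClosed_tsupport f).isOpen_compl
    (fun w hw => image_eq_zero_of_notMem_tsupport hw) v hz, pd_const]

theorem hasCompactSupport_pd {f : SpaceTime d → ℝ} (hf : HasCompactSupport f) (v : ℝ × Vec d) :
    HasCompactSupport (pd v f) :=
  hf.of_isClosed_subset (isClosed_tsupport _) <| closure_minimal
    (fun _ hz => by_contra fun h => hz (pd_eq_zero_of_notMem_tsupport v h)) (isClosed_tsupport f)

/-- By translation invariance s ↦ ∫ f(z + sv) is constant; differentiation under the integral at s =
0 gives the claim. Integration by parts follows without charts on the torus. -/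
theorem integral_pd_eq_zero {f : SpaceTime d → ℝ} (hf : Sm 1 f) (hc : HasCompactSupport f)
    (v : ℝ × Vec d) : ∫ z, pd v f z = 0 := by
  have hcov : Continuous fun s : ℝ => (cover (s • v) : SpaceTime d) :=
    continuous_cover.comp (by fun_prop)
  have hpc := hf.continuous_pd v
  obtain ⟨C, hC⟩ := hpc.bounded_above_of_compact_support (hasCompactSupport_pd hc v)
  -- a compact set that contains the supports of all translates
  set K : Set (SpaceTime d) :=
    (fun p : SpaceTime d × ℝ => p.1 - cover (p.2 • v)) '' (tsupport f ×ˢ Set.Icc (-1) 1) with hK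
  have hKc : IsCompact K := (hc.isCompact.prod isCompact_Icc).image
    (continuous_fst.sub (hcov.comp continuous_snd))
  have key := hasDerivAt_integral_of_dominated_loc_of_deriv_le (μ := (volume : Measure (SpaceTime d)))
    (F := fun (s : ℝ) z => f (z + cover (s • v))) (F' := fun s z => pd v f (z + cover (s • v)))
    (x₀ := 0) (s := Set.Icc (-1) 1) (bound := K.indicator fun _ => C)
    (Icc_mem_nhds (by norm_num) (by norm_num))
    (Eventually.of_forall fun s =>
      (hf.continuous.comp (continuous_id.add continuous_const)).aestronglyMeasurable)
    (by simpa [cover_zero] using hf.continuous.integrable_of_hasCompactSupport hc)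
    (hpc.comp (continuous_id.add continuous_const)).aestronglyMeasurable
    (Eventually.of_forall fun z s hs => by
      by_cases hz : z ∈ K
      · rw [Set.indicator_of_mem hz]; exact hC _
      · rw [Set.indicator_of_notMem hz, pd_eq_zero_of_notMem_tsupport, norm_zero]
        exact fun h => hz ⟨(_, s), ⟨h, hs⟩, by simp⟩)
    ((integrableOn_const (hs := hKc.measure_lt_top.ne)).integrable_indicator hKc.measurableSet)
    (Eventually.of_forall fun z s _ => hf.hasDerivAt v z s)
  have h0 : (fun s : ℝ => ∫ z, f (z + cover (s • v))) = fun _ => ∫ z, f z := by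
    ext s; exact integral_add_right_eq_self f _
  have h1 := key.2
  rw [h0] at h1
  simpa [cover_zero] using h1.unique (hasDerivAt_const _ _)

theorem integral_pd_mul {f g : SpaceTime d → ℝ} (hf : Sm 1 f) (hg : Sm 1 g)
    (hc : HasCompactSupport g) (v : ℝ × Vec d) :
    ∫ z, pd v f z * g z = -∫ z, f z * pd v g z := by
  have h := integral_pd_eq_zero (hf.mul hg) hc.mul_left v
  simp_rw [pd_mul hf hg] at h
  rw [integral_add] at h
  · linarith
  · exact ((hf.continuous_pd v).mul hg.continuous).integrable_of_hasCompactSupport hc.mul_left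
  · exact (hf.continuous.mul (hg.continuous_pd v)).integrable_of_hasCompactSupport
      (hasCompactSupport_pd hc v).mul_left

end EulerKorteweg

/-! ### Bounded measurable functions and averages against a kernel. -/

namespace EulerKorteweg

variable {d : ℕ}

/-- Bounded measurable functions. -/
structure BM (f : SpaceTime d → ℝ) : Prop where
  measurable : Measurable f
  bdd : ∃ C, ∀ z, |f z| ≤ C

/-- The function vanishes for times outside `[a, b]`. -/
def TimeSupp (a b : ℝ) (f : SpaceTime d → ℝ) : Prop := ∀ z, z.1 ∉ Set.Icc a b → f z = 0

theorem BM.add {f g : SpaceTime d → ℝ} (hf : BM f) (hg : BM g) : BM (fun z => f z + g z) := by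
  obtain ⟨C, hC⟩ := hf.bdd
  obtain ⟨D, hD⟩ := hg.bdd
  exact ⟨hf.1.add hg.1, C + D, fun z => (abs_add_le _ _).trans (add_le_add (hC z) (hD z))⟩

theorem BM.mul {f g : SpaceTime d → ℝ} (hf : BM f) (hg : BM g) : BM (fun z => f z * g z) := by
  obtain ⟨C, hC⟩ := hf.bdd
  obtain ⟨D, hD⟩ := hg.bdd
  refine ⟨hf.1.mul hg.1, C * D, fun z => ?_⟩
  rw [abs_mul]
  exact mul_le_mul (hC z) (hD z) (abs_nonneg _) ((abs_nonneg _).trans (hC z))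

theorem BM.const (c : ℝ) : BM (fun _ : SpaceTime d => c) := ⟨measurable_const, |c|, fun _ => le_rfl⟩

theorem BM.neg {f : SpaceTime d → ℝ} (hf : BM f) : BM (fun z => -f z) := by
  obtain ⟨C, hC⟩ := hf.bdd
  exact ⟨hf.1.neg, C, fun z => by rw [abs_neg]; exact hC z⟩

theorem BM.sub {f g : SpaceTime d → ℝ} (hf : BM f) (hg : BM g) : BM (fun z => f z - g z) := by
  simpa only [sub_eq_add_neg] using hf.add hg.neg

theorem BM.sum {ι : Type*} {s : Finset ι} {f : ι → SpaceTime d → ℝ} (hf : ∀ i, BM (f i)) :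
    BM (fun z => ∑ i ∈ s, f i z) := by
  classical
  induction s using Finset.induction_on with
  | empty => simpa using BM.const 0
  | insert i s hi ih => simpa only [Finset.sum_insert hi] using (hf i).add ih

theorem BM.comp {f : SpaceTime d → ℝ} (hf : BM f) {Φ : ℝ → ℝ} (hΦ : Continuous Φ) :
    BM (fun z => Φ (f z)) := by
  obtain ⟨C, hC⟩ := hf.bdd
  obtain ⟨D, hD⟩ := (isCompact_Icc (a := -C) (b := C)).exists_bound_of_continuousOn hΦ.continuousOn
  exact ⟨hΦ.measurable.comp hf.1, D, fun z => hD _ (abs_le.1 (hC z))⟩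

theorem BM.abs {f : SpaceTime d → ℝ} (hf : BM f) : BM (fun z => |f z|) := hf.comp continuous_abs

theorem BM.of_continuous {f : SpaceTime d → ℝ} (hf : Continuous f) (hc : HasCompactSupport f) :
    BM f := by
  obtain ⟨C, hC⟩ := hf.bounded_above_of_compact_support hc
  exact ⟨hf.measurable, C, hC⟩

theorem BM.integrable {f : SpaceTime d → ℝ} (hf : BM f) {a b : ℝ} (hs : TimeSupp a b f) :
    Integrable f := by
  obtain ⟨C, hC⟩ := hf.bdd
  have hK : IsCompact (Set.Icc a b ×ˢ (Set.univ : Set (UnitAddTorus (Fin d)))) :=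
    isCompact_Icc.prod isCompact_univ
  have h1 : IntegrableOn f (Set.Icc a b ×ˢ (Set.univ : Set (UnitAddTorus (Fin d)))) :=
    Measure.integrableOn_of_bounded (M := C) hK.measure_lt_top.ne hf.1.aestronglyMeasurable
      (Eventually.of_forall hC)
  refine h1.integrable_of_forall_notMem_eq_zero fun z hz => hs z fun h => hz ⟨h, trivial⟩

theorem TimeSupp.mul_left {a b : ℝ} {f : SpaceTime d → ℝ} (g : SpaceTime d → ℝ)
    (hf : TimeSupp a b f) : TimeSupp a b (fun z => g z * f z) :=
  fun z hz => by simp [hf z hz]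

theorem TimeSupp.mul_right {a b : ℝ} {f : SpaceTime d → ℝ} (g : SpaceTime d → ℝ)
    (hf : TimeSupp a b f) : TimeSupp a b (fun z => f z * g z) :=
  fun z hz => by simp [hf z hz]

theorem TimeSupp.mono {a b a' b' : ℝ} {f : SpaceTime d → ℝ} (hf : TimeSupp a b f) (h1 : a' ≤ a)
    (h2 : b ≤ b') : TimeSupp a' b' f :=
  fun z hz => hf z fun h => hz ⟨h1.trans h.1, h.2.trans h2⟩

theorem TimeSupp.tsupport_subset {a b : ℝ} {f : SpaceTime d → ℝ} (hf : TimeSupp a b f) :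
    tsupport f ⊆ Set.Icc a b ×ˢ Set.univ :=
  closure_minimal (fun z hz => ⟨by_contra fun h => hz (hf z h), trivial⟩)
    (isClosed_Icc.prod isClosed_univ)

theorem TimeSupp.hasCompactSupport {a b : ℝ} {f : SpaceTime d → ℝ} (hf : TimeSupp a b f) :
    HasCompactSupport f :=
  (isCompact_Icc.prod isCompact_univ).of_isClosed_subset (isClosed_tsupport f) hf.tsupport_subset

theorem TimeSupp.pd {a b : ℝ} {f : SpaceTime d → ℝ} (hf : TimeSupp a b f) (v : ℝ × Vec d) :
    TimeSupp a b (pd v f) :=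
  fun _ hz => pd_eq_zero_of_notMem_tsupport v fun h => hz (hf.tsupport_subset h).1

/-- The average of `f` with respect to the kernel `k` at scale `ε`. -/
noncomputable def kav (k : ℝ × Vec d → ℝ) (ε : ℝ) (f : SpaceTime d → ℝ) (z : SpaceTime d) : ℝ :=
  ∫ ξ, k ξ * f (z - cover (ε • ξ))

/-- A continuous kernel supported in the unit ball. -/
structure IsKernel (k : ℝ × Vec d → ℝ) : Prop where
  continuous : Continuous k
  eq_zero : ∀ ξ, ξ ∉ Metric.closedBall 0 1 → k ξ = 0

theorem IsKernel.hasCompactSupport {k : ℝ × Vec d → ℝ} (hk : IsKernel k) : HasCompactSupport k :=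
  HasCompactSupport.intro (isCompact_closedBall 0 1) hk.eq_zero

theorem IsKernel.integrable {k : ℝ × Vec d → ℝ} (hk : IsKernel k) : Integrable k :=
  hk.continuous.integrable_of_hasCompactSupport hk.hasCompactSupport

theorem IsKernel.fderiv {k : ℝ × Vec d → ℝ} (hk : IsKernel k) (hs : ContDiff ℝ 1 k)
    (v : ℝ × Vec d) : IsKernel (fun ξ => fderiv ℝ k ξ v) := by
  refine ⟨(hs.continuous_fderiv one_ne_zero).clm_apply continuous_const, fun ξ hξ => ?_⟩
  have : k =ᶠ[𝓝 ξ] fun _ => 0 := by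
    filter_upwards [Metric.isClosed_closedBall.isOpen_compl.mem_nhds hξ] with ζ hζ
      using hk.eq_zero ζ hζ
  simp [this.fderiv_eq]

theorem measurable_shift (f : SpaceTime d → ℝ) (hf : Measurable f) (ε : ℝ) (z : SpaceTime d) :
    Measurable fun ξ : ℝ × Vec d => f (z - cover (ε • ξ)) :=
  hf.comp (measurable_const.sub (continuous_cover.comp (by fun_prop)).measurable)

theorem integrable_kernel_mul {k : ℝ × Vec d → ℝ} (hk : Integrable k) {f : SpaceTime d → ℝ}
    (hf : BM f) (ε : ℝ) (z : SpaceTime d) :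
    Integrable fun ξ => k ξ * f (z - cover (ε • ξ)) := by
  obtain ⟨C, hC⟩ := hf.bdd
  exact hk.mul_bdd (c := C) (measurable_shift f hf.1 ε z).aestronglyMeasurable
    (Eventually.of_forall fun ξ => hC _)

theorem BM.locallyIntegrable_cover {f : SpaceTime d → ℝ} (hf : BM f) :
    LocallyIntegrable (fun ξ : ℝ × Vec d => f (cover ξ)) := by
  obtain ⟨C, hC⟩ := hf.bdd
  refine (locallyIntegrable_const C).mono
    (hf.1.comp continuous_cover.measurable).aestronglyMeasurable (Eventually.of_forall fun ξ => ?_)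
  exact (hC _).trans (le_abs_self C)

/-- The substitution x = εξ turns the average into a Euclidean convolution of the lifted function,
to which the smoothness of convolutions applies. The lift is periodic in space, hence only locally
integrable, and the kernel has to carry the compact support. -/
theorem kav_cover (k : ℝ × Vec d → ℝ) {ε : ℝ} (hε : ε ≠ 0) (f : SpaceTime d → ℝ) (y : ℝ × Vec d) :
    kav k ε f (cover y) = convolution (fun ξ => f (cover ξ))
      (fun x => |(ε ^ Module.finrank ℝ (ℝ × Vec d))⁻¹| * k (ε⁻¹ • x))
      (ContinuousLinearMap.mul ℝ ℝ) volume y := by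
  have h1 := Measure.integral_comp_smul (volume : Measure (ℝ × Vec d))
    (fun x => k (ε⁻¹ • x) * f (cover (y - x))) ε
  simp only [inv_smul_smul₀ hε, smul_eq_mul] at h1
  have h2 := integral_sub_left_eq_self (fun t => f (cover t) *
    (|(ε ^ Module.finrank ℝ (ℝ × Vec d))⁻¹| * k (ε⁻¹ • (y - t)))) volume y
  simp only [sub_sub_cancel] at h2
  rw [← integral_const_mul] at h1
  simp only [convolution, ContinuousLinearMap.mul_apply', ← h2]
  calc ∫ ξ, k ξ * f (cover y - cover (ε • ξ)) = ∫ ξ, k ξ * f (cover (y - ε • ξ)) := by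
        simp only [sub_eq_add_neg, cover_add, cover_neg]
    _ = _ := h1
    _ = _ := by congr 1; ext x; ring

theorem sm_kav {k : ℝ × Vec d → ℝ} (hk : IsKernel k) {n : ℕ∞} (hs : ContDiff ℝ n k) {ε : ℝ}
    (hε : ε ≠ 0) {f : SpaceTime d → ℝ} (hf : BM f) : Sm n (kav k ε f) := by
  rw [Sm, funext (kav_cover k hε f)]
  refine HasCompactSupport.contDiff_convolution_right _ ?_ hf.locallyIntegrable_cover ?_
  · exact (hk.hasCompactSupport.comp_smul (inv_ne_zero hε)).mul_left
  · exact contDiff_const.mul (hs.comp (contDiff_const_smul ε⁻¹))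

theorem pd_kav {k : ℝ × Vec d → ℝ} (hk : IsKernel k) (hs : ContDiff ℝ 1 k) {ε : ℝ}
    (hε : ε ≠ 0) {f : SpaceTime d → ℝ} (hf : BM f) (v : ℝ × Vec d) (z : SpaceTime d) :
    pd v (kav k ε f) z = ε⁻¹ * kav (fun ξ => fderiv ℝ k ξ v) ε f z := by
  obtain ⟨y, rfl⟩ := cover_surjective z
  rw [pd_cover (sm_kav hk (n := 1) hs hε hf), kav_cover _ hε, funext (kav_cover k hε f)]
  set c := |(ε ^ Module.finrank ℝ (ℝ × Vec d))⁻¹|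
  have hcs : HasCompactSupport fun x => c * k (ε⁻¹ • x) :=
    (hk.hasCompactSupport.comp_smul (inv_ne_zero hε)).mul_left
  have hcd : ContDiff ℝ 1 fun x => c * k (ε⁻¹ • x) :=
    contDiff_const.mul (hs.comp (contDiff_const_smul ε⁻¹))
  rw [(hcs.hasFDerivAt_convolution_right _ hf.locallyIntegrable_cover hcd y).fderiv,
    convolution_precompR_apply _ hf.locallyIntegrable_cover (hcs.fderiv ℝ)
      (hcd.continuous_fderiv one_ne_zero)]
  have hfd : ∀ x, fderiv ℝ (fun x => c * k (ε⁻¹ • x)) x v =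
      ε⁻¹ * (c * fderiv ℝ k (ε⁻¹ • x) v) := by
    intro x
    have h1 : HasFDerivAt (fun x : ℝ × Vec d => ε⁻¹ • x)
        (ε⁻¹ • ContinuousLinearMap.id ℝ (ℝ × Vec d)) x := (hasFDerivAt_id x).const_smul ε⁻¹
    have h2 := ((hs.differentiable one_ne_zero (ε⁻¹ • x)).hasFDerivAt.comp x h1).const_mul c
    rw [Function.comp_def] at h2
    rw [h2.fderiv]
    simp
    ring
  simp only [convolution, hfd, ContinuousLinearMap.mul_apply', ← integral_const_mul]
  congr 1; ext x; ring

theorem TimeSupp.kav {a b : ℝ} {f : SpaceTime d → ℝ} (hf : TimeSupp a b f) {k : ℝ × Vec d → ℝ}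
    (hk : IsKernel k) {ε : ℝ} (hε : 0 ≤ ε) : TimeSupp (a - ε) (b + ε) (kav k ε f) := by
  intro z hz
  rw [EulerKorteweg.kav, ← integral_zero (ℝ × Vec d) ℝ (μ := volume)]
  congr 1
  ext ξ
  by_cases hξ : ξ ∈ Metric.closedBall (0 : ℝ × Vec d) 1
  · rw [hf, mul_zero]
    intro h
    refine hz ?_
    have h1 : |ξ.1| ≤ 1 := (norm_fst_le ξ).trans (by simpa using hξ)
    have h2 : |ε * ξ.1| ≤ ε := by
      rw [abs_mul, abs_of_nonneg hε]; exact mul_le_of_le_one_right hε h1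
    have h3 : (z - cover (ε • ξ)).1 = z.1 - ε * ξ.1 := rfl
    rw [h3] at h
    have := abs_le.1 h2
    constructor <;> linarith [h.1, h.2]
  · rw [hk.eq_zero ξ hξ, zero_mul]

/-- Fubini and a translation in z show that the adjoint of averaging is averaging with the reflected
kernel. -/
theorem integral_kav_mul {k : ℝ × Vec d → ℝ} (hk : Integrable k) (ε : ℝ) {f ψ : SpaceTime d → ℝ}
    (hf : BM f) (hψ : BM ψ) (hi : Integrable ψ) :
    ∫ z, kav k ε f z * ψ z = ∫ z, f z * kav (fun ξ => k (-ξ)) ε ψ z := by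
  obtain ⟨C, hC⟩ := hf.bdd
  have hshift : Measurable fun p : SpaceTime d × (ℝ × Vec d) => p.1 - cover (ε • p.2) :=
    measurable_fst.sub ((continuous_cover.comp (by fun_prop : Continuous
      fun ξ : ℝ × Vec d => ε • ξ)).measurable.comp measurable_snd)
  have hshift' : Measurable fun p : SpaceTime d × (ℝ × Vec d) => p.1 + cover (ε • p.2) :=
    measurable_fst.add ((continuous_cover.comp (by fun_prop : Continuous
      fun ξ : ℝ × Vec d => ε • ξ)).measurable.comp measurable_snd)
  have hm1 : Integrable (Function.uncurry fun (z : SpaceTime d) ξ =>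
      k ξ * f (z - cover (ε • ξ)) * ψ z) (volume.prod volume) := by
    have h1 : Integrable (fun p : SpaceTime d × (ℝ × Vec d) => ψ p.1 * k p.2)
        (volume.prod volume) := hi.mul_prod hk
    refine (h1.mul_bdd (c := C) (hf.1.comp hshift).aestronglyMeasurable
      (Eventually.of_forall fun p => hC _)).congr (Eventually.of_forall fun p => ?_)
    simp only [Function.uncurry, Function.comp_apply]
    ring
  have hm2 : Integrable (Function.uncurry fun (z : SpaceTime d) ξ =>
      f z * (k ξ * ψ (z + cover (ε • ξ)))) (volume.prod volume) := by
    have hmeas : AEStronglyMeasurable (fun p : SpaceTime d × (ℝ × Vec d) =>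
        k p.2 * ψ (p.1 + cover (ε • p.2))) (volume.prod volume) :=
      hk.1.comp_snd.mul (hψ.1.comp hshift').aestronglyMeasurable
    have h1 : Integrable (fun p : SpaceTime d × (ℝ × Vec d) => k p.2 * ψ (p.1 + cover (ε • p.2)))
        (volume.prod volume) := by
      refine (integrable_prod_iff' hmeas).2 ⟨Eventually.of_forall fun ξ =>
        (hi.comp_add_right (cover (ε • ξ))).const_mul (k ξ), ?_⟩
      simp only [norm_mul, integral_const_mul]
      have : ∀ ξ : ℝ × Vec d, ∫ z, ‖ψ (z + cover (ε • ξ))‖ = ∫ z, ‖ψ z‖ := fun ξ =>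
        integral_add_right_eq_self (fun z => ‖ψ z‖) _
      simp only [this]
      exact hk.norm.mul_const _
    exact h1.bdd_mul (c := C) hf.1.aestronglyMeasurable.comp_fst
      (Eventually.of_forall fun p => hC _)
  calc ∫ z, kav k ε f z * ψ z = ∫ z, ∫ ξ, k ξ * f (z - cover (ε • ξ)) * ψ z := by
        simp only [kav, integral_mul_const]
    _ = ∫ ξ, ∫ z, k ξ * f (z - cover (ε • ξ)) * ψ z := integral_integral_swap hm1
    _ = ∫ ξ, ∫ z, f z * (k ξ * ψ (z + cover (ε • ξ))) := by
        congr 1; ext ξ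
        have h := integral_sub_right_eq_self
          (fun z => f z * (k ξ * ψ (z + cover (ε • ξ)))) (cover (ε • ξ)) (μ := volume)
        simp only [sub_add_cancel] at h
        rw [← h]
        congr 1; ext z; ring
    _ = ∫ z, ∫ ξ, f z * (k ξ * ψ (z + cover (ε • ξ))) := (integral_integral_swap hm2).symm
    _ = _ := by
        congr 1; ext z
        rw [integral_const_mul, kav, ← integral_neg_eq_self]
        simp only [smul_neg, cover_neg, sub_eq_add_neg]

end EulerKorteweg

/-! ### The standard mollifier and bounded L¹ convergence. -/

namespace EulerKorteweg

variable {d : ℕ}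

/-- The bump function behind the standard mollifier. -/
noncomputable def bump (d : ℕ) : ContDiffBump (0 : ℝ × Vec d) :=
  ⟨1 / 2, 1, by norm_num, by norm_num⟩

/-- The standard mollifier. -/
noncomputable def eta (ξ : ℝ × Vec d) : ℝ := (bump d).normed volume ξ

/-- The directional derivatives of the standard mollifier. -/
noncomputable def deta (v ξ : ℝ × Vec d) : ℝ := fderiv ℝ eta ξ v

theorem contDiff_eta {n : ℕ∞} : ContDiff ℝ n (eta : ℝ × Vec d → ℝ) := (bump d).contDiff_normed

theorem eta_nonneg (ξ : ℝ × Vec d) : 0 ≤ eta ξ := (bump d).nonneg_normed ξ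

theorem integral_eta : ∫ ξ : ℝ × Vec d, eta ξ = 1 := (bump d).integral_normed

theorem eta_neg (ξ : ℝ × Vec d) : eta (-ξ) = eta ξ := (bump d).normed_neg ξ

theorem isKernel_eta : IsKernel (eta : ℝ × Vec d → ℝ) := by
  refine ⟨(contDiff_eta (n := 0)).continuous, fun ξ hξ => ?_⟩
  have : ξ ∉ tsupport ((bump d).normed volume) := by
    rw [(bump d).tsupport_normed_eq]; exact hξ
  exact image_eq_zero_of_notMem_tsupport this

theorem isKernel_deta (v : ℝ × Vec d) : IsKernel (deta v) :=
  isKernel_eta.fderiv (contDiff_eta (n := 1)) v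

theorem deta_neg (v ξ : ℝ × Vec d) : deta v (-ξ) = -deta v ξ := by
  have h1 : HasFDerivAt (fun ξ : ℝ × Vec d => -ξ) (-ContinuousLinearMap.id ℝ (ℝ × Vec d)) ξ :=
    (hasFDerivAt_id ξ).neg
  have h2 := ((contDiff_eta (d := d) (n := 1)).differentiable one_ne_zero (-ξ)).hasFDerivAt.comp ξ h1
  have h3 : (eta ∘ fun ξ : ℝ × Vec d => -ξ) = eta := funext eta_neg
  rw [h3] at h2
  rw [deta, deta, h2.fderiv]
  simp

/-- Mollification at scale `ε`. -/
noncomputable def mol (ε : ℝ) (f : SpaceTime d → ℝ) : SpaceTime d → ℝ := kav eta ε f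

theorem sm_mol {ε : ℝ} (hε : 0 < ε) {f : SpaceTime d → ℝ} (hf : BM f) {n : ℕ∞} :
    Sm n (mol ε f) := sm_kav isKernel_eta contDiff_eta hε.ne' hf

theorem pd_mol {ε : ℝ} (hε : 0 < ε) {f : SpaceTime d → ℝ} (hf : BM f) (v : ℝ × Vec d)
    (z : SpaceTime d) : pd v (mol ε f) z = ε⁻¹ * kav (deta v) ε f z :=
  pd_kav isKernel_eta (contDiff_eta (n := 1)) hε.ne' hf v z

theorem abs_mol_le (ε : ℝ) {f : SpaceTime d → ℝ} {C : ℝ} (hC : ∀ z, |f z| ≤ C) (z : SpaceTime d) :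
    |mol ε f z| ≤ C := by
  have h := norm_integral_le_of_norm_le (μ := (volume : Measure (ℝ × Vec d)))
    (f := fun ξ => eta ξ * f (z - cover (ε • ξ)))
    (isKernel_eta.integrable.mul_const C) (Eventually.of_forall fun ξ => by
      rw [norm_mul, Real.norm_eq_abs, Real.norm_eq_abs, abs_of_nonneg (eta_nonneg ξ)]
      exact mul_le_mul_of_nonneg_left (hC _) (eta_nonneg ξ))
  rwa [integral_mul_const, integral_eta, one_mul] at h

theorem BM.mol {ε : ℝ} (hε : 0 < ε) {f : SpaceTime d → ℝ} (hf : BM f) : BM (mol ε f) := by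
  obtain ⟨C, hC⟩ := hf.bdd
  exact ⟨(sm_mol hε hf (n := 0)).continuous.measurable, C, abs_mol_le ε hC⟩

theorem mol_const (ε c : ℝ) (z : SpaceTime d) : mol ε (fun _ => c) z = c := by
  simp [mol, kav, integral_mul_const, integral_eta]

theorem mol_sub (ε : ℝ) {f g : SpaceTime d → ℝ} (hf : BM f) (hg : BM g) (z : SpaceTime d) :
    mol ε (fun z => f z - g z) z = mol ε f z - mol ε g z := by
  simp only [mol, kav, mul_sub]
  exact integral_sub (integrable_kernel_mul isKernel_eta.integrable hf ε z)
    (integrable_kernel_mul isKernel_eta.integrable hg ε z)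

theorem TimeSupp.mol {a b : ℝ} {f : SpaceTime d → ℝ} (hf : TimeSupp a b f) {ε : ℝ} (hε : 0 ≤ ε) :
    TimeSupp (a - ε) (b + ε) (mol ε f) := hf.kav isKernel_eta hε

theorem integral_mol_mul (ε : ℝ) {f ψ : SpaceTime d → ℝ} (hf : BM f) (hψ : BM ψ)
    (hi : Integrable ψ) : ∫ z, mol ε f z * ψ z = ∫ z, f z * mol ε ψ z := by
  rw [mol, integral_kav_mul isKernel_eta.integrable ε hf hψ hi]
  simp only [eta_neg]
  rfl

/-- Neither f nor ψ is differentiable. The derivative sits on the kernel, and the oddness of the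
derivative of the even mollifier supplies the sign of an integration by parts. -/
theorem integral_mul_pd_mol {ε : ℝ} (hε : 0 < ε) {f ψ : SpaceTime d → ℝ} (hf : BM f) (hψ : BM ψ)
    (hi : Integrable ψ) (v : ℝ × Vec d) :
    ∫ z, f z * pd v (mol ε ψ) z = -∫ z, pd v (mol ε f) z * ψ z := by
  simp only [pd_mol hε hf, pd_mol hε hψ]
  have h := integral_kav_mul (isKernel_deta v).integrable ε hf hψ hi
  have h2 : ∀ z, kav (fun ξ => deta v (-ξ)) ε ψ z = -kav (deta v) ε ψ z := by
    intro z; simp [kav, deta_neg, integral_neg]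
  simp only [h2, mul_neg, integral_neg] at h
  calc ∫ z, f z * (ε⁻¹ * kav (deta v) ε ψ z) = ε⁻¹ * ∫ z, f z * kav (deta v) ε ψ z := by
        rw [← integral_const_mul]; congr 1; ext z; ring
    _ = -(ε⁻¹ * ∫ z, kav (deta v) ε f z * ψ z) := by rw [h]; ring
    _ = _ := by rw [← integral_const_mul]; congr 2; ext z; ring

/-- Move the mollifier from |f| to the constant 1, which it fixes. -/
theorem integral_abs_mol_le (ε : ℝ) {f : SpaceTime d → ℝ} (hε : 0 < ε) (hf : BM f) {a b : ℝ}
    (hs : TimeSupp a b f) : ∫ z, |mol ε f z| ≤ ∫ z, |f z| := by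
  have hsa : TimeSupp a b fun z => |f z| := fun z hz => by simp [hs z hz]
  have h1 := integral_mol_mul ε (BM.const 1) hf.abs (hf.abs.integrable hsa)
  simp only [mol_const, one_mul] at h1
  rw [h1]
  refine integral_mono (((hf.mol hε).integrable (hs.mol hε.le)).abs)
    ((hf.abs.mol hε).integrable (hsa.mol hε.le)) fun z => ?_
  refine (norm_integral_le_integral_norm
    (fun ξ => eta ξ * f (z - cover (ε • ξ)))).trans_eq ?_
  simp only [mol, kav, norm_mul, Real.norm_eq_abs, abs_of_nonneg (eta_nonneg _)]

instance : (volume : Measure (SpaceTime d)).Regular :=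
  Measure.Regular.of_sigmaCompactSpace_of_isLocallyFiniteMeasure _

/-- This is the continuity of the translation action of the group on L¹. -/
theorem tendsto_integral_translate {f : SpaceTime d → ℝ} (hf : Integrable f) :
    Tendsto (fun g : SpaceTime d => ∫ z, |f (g + z) - f z|) (𝓝 0) (𝓝 0) := by
  have hp : Fact ((1 : ℝ≥0∞) ≤ 1) := ⟨le_rfl⟩
  have hp' : Fact ((1 : ℝ≥0∞) ≠ ∞) := ⟨ENNReal.one_ne_top⟩
  have hm : MemLp f 1 volume := memLp_one_iff_integrable.2 hf
  have : ContinuousVAdd (SpaceTime d)ᵈᵃᵃ (Lp ℝ 1 (volume : Measure (SpaceTime d))) :=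
    Lp.instContinuousVAddDomAddAct
  have hc : Continuous fun g : SpaceTime d => DomAddAct.mk g +ᵥ hm.toLp f :=
    (continuous_id.vadd continuous_const).comp DomAddAct.continuous_mk
  have h1 : Tendsto (fun g : SpaceTime d => dist (DomAddAct.mk g +ᵥ hm.toLp f) (hm.toLp f))
      (𝓝 0) (𝓝 0) := by
    have h2 := (hc.dist (continuous_const (y := hm.toLp f))).tendsto 0
    simpa using h2
  refine h1.congr fun g => ?_
  rw [DomAddAct.mk_vadd_toLp, dist_eq_norm, ← MemLp.toLp_sub, Lp.norm_toLp,
    eLpNorm_one_eq_lintegral_enorm, integral_eq_lintegral_of_nonneg_ae]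
  · congr 1
    refine lintegral_congr fun z => ?_
    simp [← ofReal_norm]
  · exact Eventually.of_forall fun z => abs_nonneg _
  · exact ((hf.comp_add_left g).sub hf).abs.1

/-- The mollified function minus f is an average of increments of f, so Fubini bounds its L¹ norm by
the largest L¹ norm of an increment over shifts of size ε. -/
theorem tendsto_integral_mol_sub {f : SpaceTime d → ℝ} (hf : BM f) {a b : ℝ}
    (hs : TimeSupp a b f) {ε : ℕ → ℝ} (hε : ∀ n, 0 < ε n) (hε0 : Tendsto ε atTop (𝓝 0)) :
    Tendsto (fun n => ∫ z, |mol (ε n) f z - f z|) atTop (𝓝 0) := by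
  have hfi := hf.integrable hs
  have hω := tendsto_integral_translate hfi
  obtain ⟨C, hC⟩ := hf.bdd
  rw [Metric.tendsto_atTop]
  intro δ hδ
  have h1 : ∀ᶠ g : SpaceTime d in 𝓝 0, ∫ z, |f (g + z) - f z| < δ / 2 :=
    hω.eventually (gt_mem_nhds (half_pos hδ))
  have h2 : ∀ᶠ ξ : ℝ × Vec d in 𝓝 0, ∫ z, |f (cover ξ + z) - f z| < δ / 2 := by
    have := (continuous_cover (d := d)).tendsto 0
    rw [cover_zero] at this
    exact this.eventually h1
  obtain ⟨r, hr, hball⟩ := Metric.eventually_nhds_iff.1 h2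
  obtain ⟨n₀, hn₀⟩ := Metric.tendsto_atTop.1 hε0 r hr
  refine ⟨n₀, fun n hn => ?_⟩
  have hεn : ε n < r := by simpa [abs_of_pos (hε n)] using hn₀ n hn
  have hshift : Measurable fun p : SpaceTime d × (ℝ × Vec d) => p.1 - cover (ε n • p.2) :=
    measurable_fst.sub ((continuous_cover.comp (by fun_prop : Continuous
      fun ξ : ℝ × Vec d => ε n • ξ)).measurable.comp measurable_snd)
  have hF : Integrable (Function.uncurry fun (z : SpaceTime d) ξ =>
      eta ξ * |f (z - cover (ε n • ξ)) - f z|) (volume.prod volume) := by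
    -- For Fubini, the increments are dominated by 2C on the time strip widened by the mollification
    -- scale, outside which both values of f vanish.
    have hB : BM ((Set.Icc (a - ε n) (b + ε n) ×ˢ Set.univ).indicator
        fun _ : SpaceTime d => 2 * C) := by
      refine ⟨measurable_const.indicator (measurableSet_Icc.prod MeasurableSet.univ), |2 * C|,
        fun z => ?_⟩
      by_cases h : z ∈ Set.Icc (a - ε n) (b + ε n) ×ˢ (Set.univ : Set (UnitAddTorus (Fin d))) <;>
        simp only [h, Set.indicator_of_mem, Set.indicator_of_notMem, not_false_eq_true, le_refl,
          abs_zero, abs_nonneg]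
    have hBi := hB.integrable (a := a - ε n) (b := b + ε n)
      fun z hz => Set.indicator_of_notMem (fun h => hz h.1) _
    refine (hBi.mul_prod isKernel_eta.integrable).mono' ?_ (Eventually.of_forall fun p => ?_)
    · exact ((isKernel_eta.continuous.measurable.comp measurable_snd).mul
        ((hf.1.comp hshift).sub (hf.1.comp measurable_fst)).norm).aestronglyMeasurable
    · obtain ⟨z, ξ⟩ := p
      simp only [Function.uncurry]
      rw [norm_mul, Real.norm_eq_abs, Real.norm_eq_abs, abs_abs, abs_of_nonneg (eta_nonneg ξ),
        mul_comm]
      by_cases hξ : ξ ∈ Metric.closedBall (0 : ℝ × Vec d) 1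
      · refine mul_le_mul_of_nonneg_right ?_ (eta_nonneg ξ)
        by_cases hz : z.1 ∈ Set.Icc (a - ε n) (b + ε n)
        · rw [Set.indicator_of_mem (s := Set.Icc _ _ ×ˢ Set.univ) ⟨hz, trivial⟩]
          refine (abs_sub _ _).trans ?_
          linarith [hC (z - cover (ε n • ξ)), hC z]
        · rw [Set.indicator_of_notMem (fun h => hz h.1), hs z, hs (z - cover (ε n • ξ)), sub_zero,
            abs_zero]
          · intro h
            have h1 : |ξ.1| ≤ 1 := (norm_fst_le ξ).trans (by simpa using hξ)
            have h2 : |ε n * ξ.1| ≤ ε n := by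
              rw [abs_mul, abs_of_pos (hε n)]; exact mul_le_of_le_one_right (hε n).le h1
            have h3 : (z - cover (ε n • ξ)).1 = z.1 - ε n * ξ.1 := rfl
            rw [h3] at h
            have := abs_le.1 h2
            exact hz ⟨by linarith [h.1], by linarith [h.2]⟩
          · exact fun h => hz ⟨by linarith [h.1, hε n], by linarith [h.2, hε n]⟩
      · rw [isKernel_eta.eq_zero ξ hξ, mul_zero, mul_zero]
  rw [Real.dist_eq, sub_zero, abs_of_nonneg (integral_nonneg fun _ => abs_nonneg _)]
  calc ∫ z, |mol (ε n) f z - f z|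
      ≤ ∫ z, ∫ ξ, eta ξ * |f (z - cover (ε n • ξ)) - f z| := by
        refine integral_mono ?_ hF.integral_prod_left fun z => ?_
        · exact (((hf.mol (hε n)).integrable (hs.mol (hε n).le)).sub hfi).abs
        · have h3 : mol (ε n) f z - f z = ∫ ξ, eta ξ * (f (z - cover (ε n • ξ)) - f z) := by
            have h4 := mol_sub (ε n) hf (BM.const (f z)) z
            rw [mol_const] at h4
            rw [← h4]
            rfl
          simp only [h3]
          refine (norm_integral_le_integral_norm
            (fun ξ => eta ξ * (f (z - cover (ε n • ξ)) - f z))).trans_eq ?_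
          simp only [norm_mul, Real.norm_eq_abs, abs_of_nonneg (eta_nonneg _)]
    _ = ∫ ξ, ∫ z, eta ξ * |f (z - cover (ε n • ξ)) - f z| := integral_integral_swap hF
    _ ≤ ∫ ξ : ℝ × Vec d, eta ξ * (δ / 2) := by
        refine integral_mono hF.integral_prod_right (isKernel_eta.integrable.mul_const _)
          fun ξ => ?_
        simp only [integral_const_mul]
        by_cases hξ : ξ ∈ Metric.closedBall (0 : ℝ × Vec d) 1
        · refine mul_le_mul_of_nonneg_left ?_ (eta_nonneg ξ)
          have h5 : dist (-(ε n • ξ)) 0 < r := by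
            rw [dist_zero_right, norm_neg, norm_smul, Real.norm_eq_abs, abs_of_pos (hε n)]
            have : ‖ξ‖ ≤ 1 := by simpa using hξ
            exact (mul_le_of_le_one_right (hε n).le this).trans_lt hεn
          have h6 := (hball h5).le
          simpa only [cover_neg, neg_add_eq_sub] using h6
        · simp [isKernel_eta.eq_zero ξ hξ]
    _ = δ / 2 := by rw [integral_mul_const, integral_eta, one_mul]
    _ < δ := half_lt_self hδ

/-- Uniformly bounded convergence in `L¹((0,T) × 𝕋^d)`. -/
structure L1Conv (T : ℝ) (f : ℕ → SpaceTime d → ℝ) (g : SpaceTime d → ℝ) : Prop where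
  measurable : ∀ n, Measurable (f n)
  measurable_lim : Measurable g
  bdd : ∃ C, (∀ n z, |f n z| ≤ C) ∧ ∀ z, |g z| ≤ C
  tendsto : Tendsto (fun n => ∫ z, |f n z - g z| ∂(domainMeasure d T)) atTop (𝓝 0)

variable {T : ℝ}

theorem L1Conv.bm {f : ℕ → SpaceTime d → ℝ} {g : SpaceTime d → ℝ} (h : L1Conv T f g) (n : ℕ) :
    BM (f n) := ⟨h.measurable n, h.bdd.imp fun _ h => h.1 n⟩

theorem L1Conv.bm_lim {f : ℕ → SpaceTime d → ℝ} {g : SpaceTime d → ℝ} (h : L1Conv T f g) :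
    BM g := ⟨h.measurable_lim, h.bdd.imp fun _ h => h.2⟩

theorem BM.integrable_domain {f : SpaceTime d → ℝ} (hf : BM f) :
    Integrable f (domainMeasure d T) := by
  obtain ⟨C, hC⟩ := hf.bdd
  exact Integrable.of_bound hf.1.aestronglyMeasurable C (Eventually.of_forall hC)

theorem BM.l1Conv {f : SpaceTime d → ℝ} (hf : BM f) : L1Conv T (fun _ => f) f := by
  obtain ⟨C, hC⟩ := hf.bdd
  exact ⟨fun _ => hf.1, hf.1, ⟨C, fun _ => hC, hC⟩, by simp⟩

theorem L1Conv.of_le {f f' : ℕ → SpaceTime d → ℝ} {g g' : SpaceTime d → ℝ} (h : L1Conv T f g)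
    (hf' : ∀ n, Measurable (f' n)) (hg' : Measurable g')
    (hb : ∃ C, (∀ n z, |f' n z| ≤ C) ∧ ∀ z, |g' z| ≤ C) (C : ℝ)
    (hle : ∀ n z, |f' n z - g' z| ≤ C * |f n z - g z|) : L1Conv T f' g' := by
  refine ⟨hf', hg', hb, ?_⟩
  have h1 := h.tendsto.const_mul C
  rw [mul_zero] at h1
  refine squeeze_zero (fun n => integral_nonneg fun _ => abs_nonneg _) (fun n => ?_) h1
  rw [← integral_const_mul]
  have hbm : BM (f' n) := ⟨hf' n, hb.imp fun _ h => h.1 n⟩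
  have hbm' : BM g' := ⟨hg', hb.imp fun _ h => h.2⟩
  exact integral_mono (hbm.sub hbm').abs.integrable_domain
    (((h.bm n).sub h.bm_lim).abs.integrable_domain.const_mul C) (hle n)

theorem L1Conv.add {f f' : ℕ → SpaceTime d → ℝ} {g g' : SpaceTime d → ℝ} (h : L1Conv T f g)
    (h' : L1Conv T f' g') : L1Conv T (fun n z => f n z + f' n z) (fun z => g z + g' z) := by
  obtain ⟨C, hC, hC'⟩ := h.bdd
  obtain ⟨D, hD, hD'⟩ := h'.bdd
  refine ⟨fun n => (h.1 n).add (h'.1 n), h.2.add h'.2, ⟨C + D,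
    fun n z => (abs_add_le _ _).trans (add_le_add (hC n z) (hD n z)),
    fun z => (abs_add_le _ _).trans (add_le_add (hC' z) (hD' z))⟩, ?_⟩
  have h1 := h.tendsto.add h'.tendsto
  rw [add_zero] at h1
  refine squeeze_zero (fun n => integral_nonneg fun _ => abs_nonneg _) (fun n => ?_) h1
  have i1 := ((h.bm n).sub h.bm_lim).abs.integrable_domain (T := T)
  have i2 := ((h'.bm n).sub h'.bm_lim).abs.integrable_domain (T := T)
  rw [← integral_add i1 i2]
  refine integral_mono (((h.bm n).add (h'.bm n)).sub
    (h.bm_lim.add h'.bm_lim)).abs.integrable_domain (i1.add i2) fun z => ?_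
  rw [add_sub_add_comm]
  exact abs_add_le _ _

/-- The uniform bound that is part of `L1Conv` serves this purpose: in the telescoped difference of
products one factor is always bounded and the other small in L¹. -/
theorem L1Conv.mul {f f' : ℕ → SpaceTime d → ℝ} {g g' : SpaceTime d → ℝ} (h : L1Conv T f g)
    (h' : L1Conv T f' g') : L1Conv T (fun n z => f n z * f' n z) (fun z => g z * g' z) := by
  obtain ⟨C, hC, hC'⟩ := h.bdd
  obtain ⟨D, hD, hD'⟩ := h'.bdd
  have hC0 : ∀ z : SpaceTime d, 0 ≤ C := fun z => (abs_nonneg _).trans (hC' z)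
  refine ⟨fun n => (h.1 n).mul (h'.1 n), h.2.mul h'.2, ⟨C * D, fun n z => ?_, fun z => ?_⟩, ?_⟩
  · rw [abs_mul]; exact mul_le_mul (hC n z) (hD n z) (abs_nonneg _) (hC0 z)
  · rw [abs_mul]; exact mul_le_mul (hC' z) (hD' z) (abs_nonneg _) (hC0 z)
  have h1 := (h.tendsto.const_mul D).add (h'.tendsto.const_mul C)
  rw [mul_zero, mul_zero, add_zero] at h1
  refine squeeze_zero (fun n => integral_nonneg fun _ => abs_nonneg _) (fun n => ?_) h1
  have i1 := (((h.bm n).sub h.bm_lim).abs.integrable_domain (T := T)).const_mul D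
  have i2 := (((h'.bm n).sub h'.bm_lim).abs.integrable_domain (T := T)).const_mul C
  rw [← integral_const_mul, ← integral_const_mul, ← integral_add i1 i2]
  refine integral_mono (((h.bm n).mul (h'.bm n)).sub
    (h.bm_lim.mul h'.bm_lim)).abs.integrable_domain (i1.add i2) fun z => ?_
  have : f n z * f' n z - g z * g' z = (f n z - g z) * f' n z + g z * (f' n z - g' z) := by ring
  rw [this]
  refine (abs_add_le _ _).trans (add_le_add ?_ ?_)
  · rw [abs_mul, mul_comm]; exact mul_le_mul_of_nonneg_right (hD n z) (abs_nonneg _)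
  · rw [abs_mul]; exact mul_le_mul_of_nonneg_right (hC' z) (abs_nonneg _)

theorem L1Conv.const_mul {f : ℕ → SpaceTime d → ℝ} {g : SpaceTime d → ℝ} (h : L1Conv T f g)
    (c : ℝ) : L1Conv T (fun n z => c * f n z) (fun z => c * g z) :=
  (BM.const c).l1Conv.mul h

theorem L1Conv.sub {f f' : ℕ → SpaceTime d → ℝ} {g g' : SpaceTime d → ℝ} (h : L1Conv T f g)
    (h' : L1Conv T f' g') : L1Conv T (fun n z => f n z - f' n z) (fun z => g z - g' z) := by
  simpa only [neg_one_mul, ← sub_eq_add_neg] using h.add (h'.const_mul (-1))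

theorem L1Conv.sum {ι : Type*} {s : Finset ι} {f : ι → ℕ → SpaceTime d → ℝ}
    {g : ι → SpaceTime d → ℝ} (h : ∀ i, L1Conv T (f i) (g i)) :
    L1Conv T (fun n z => ∑ i ∈ s, f i n z) (fun z => ∑ i ∈ s, g i z) := by
  classical
  induction s using Finset.induction_on with
  | empty => simpa using (BM.const 0).l1Conv
  | insert i s hi ih => simpa only [Finset.sum_insert hi] using (h i).add ih

theorem exists_lipschitz_bound {Φ : ℝ → ℝ} (hΦ : ContDiff ℝ 1 Φ) (C : ℝ) :
    ∃ L, 0 ≤ L ∧ ∀ x y, |x| ≤ C → |y| ≤ C → |Φ x - Φ y| ≤ L * |x - y| := by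
  obtain ⟨L, hL⟩ := (isCompact_Icc (a := -C) (b := C)).exists_bound_of_continuousOn
    (hΦ.continuous_deriv le_rfl).continuousOn
  refine ⟨|L|, abs_nonneg L, fun x y hx hy => ?_⟩
  exact (convex_Icc (-C) C).norm_image_sub_le_of_norm_deriv_le
    (fun w _ => hΦ.differentiable one_ne_zero w) (fun w hw => (hL w hw).trans (le_abs_self L))
    (abs_le.1 hy) (abs_le.1 hx)

theorem L1Conv.comp {f : ℕ → SpaceTime d → ℝ} {g : SpaceTime d → ℝ} (h : L1Conv T f g)
    {Φ : ℝ → ℝ} (hΦ : ContDiff ℝ 1 Φ) : L1Conv T (fun n z => Φ (f n z)) (fun z => Φ (g z)) := by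
  obtain ⟨C, hC, hC'⟩ := h.bdd
  obtain ⟨D, hD⟩ := (isCompact_Icc (a := -C) (b := C)).exists_bound_of_continuousOn
    hΦ.continuous.continuousOn
  obtain ⟨L, -, hL⟩ := exists_lipschitz_bound hΦ C
  exact h.of_le (fun n => hΦ.continuous.measurable.comp (h.1 n))
    (hΦ.continuous.measurable.comp h.2)
    ⟨D, fun n z => hD _ (abs_le.1 (hC n z)), fun z => hD _ (abs_le.1 (hC' z))⟩ L
    fun n z => hL _ _ (hC n z) (hC' z)

theorem integral_domain_le {f : SpaceTime d → ℝ} (hf : Integrable f) (h0 : ∀ z, 0 ≤ f z) :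
    ∫ z, f z ∂(domainMeasure d T) ≤ ∫ z, f z :=
  setIntegral_le_integral hf (Eventually.of_forall h0)

theorem l1Conv_mol {f : SpaceTime d → ℝ} (hf : BM f) {a b : ℝ} (hs : TimeSupp a b f) {ε : ℕ → ℝ}
    (hε : ∀ n, 0 < ε n) (hε0 : Tendsto ε atTop (𝓝 0)) : L1Conv T (fun n => mol (ε n) f) f := by
  obtain ⟨C, hC⟩ := hf.bdd
  refine ⟨fun n => (hf.mol (hε n)).1, hf.1, ⟨C, fun n => abs_mol_le _ hC, hC⟩, ?_⟩
  refine squeeze_zero (fun n => integral_nonneg fun _ => abs_nonneg _) (fun n => ?_)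
    (tendsto_integral_mol_sub hf hs hε hε0)
  exact integral_domain_le (((hf.mol (hε n)).integrable (hs.mol (hε n).le)).sub
    (hf.integrable hs)).abs fun _ => abs_nonneg _

theorem integral_domain_eq {f : SpaceTime d → ℝ} (hs : TimeSupp 0 T f) :
    ∫ z, f z ∂(domainMeasure d T) = ∫ z, f z := by
  have h1 : domainMeasure d T = volume.restrict (Set.Icc 0 T ×ˢ Set.univ) := by
    refine Measure.restrict_congr_set ?_
    exact Measure.set_prod_ae_eq Ioo_ae_eq_Icc (ae_eq_refl _)
  rw [h1]
  exact setIntegral_eq_integral_of_forall_compl_eq_zero fun z hz => hs z fun h => hz ⟨h, trivial⟩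

/-- Split into the mollified difference f n - g, on which mollification is an L¹ contraction, and
the mollified limit. The supports in time allow integrals over the domain to be read as integrals
over all of space-time. -/
theorem L1Conv.mol {f : ℕ → SpaceTime d → ℝ} {g : SpaceTime d → ℝ} (h : L1Conv T f g)
    (hs : ∀ n, TimeSupp 0 T (f n)) (hg : TimeSupp 0 T g) {ε : ℕ → ℝ} (hε : ∀ n, 0 < ε n)
    (hε0 : Tendsto ε atTop (𝓝 0)) : L1Conv T (fun n => mol (ε n) (f n)) g := by
  have h1 : L1Conv T (fun n => EulerKorteweg.mol (ε n) (fun z => f n z - g z)) (fun _ => 0) := by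
    obtain ⟨C, hC, hC'⟩ := h.bdd
    have hCC : ∀ n z, |f n z - g z| ≤ C + C := fun n z =>
      (abs_sub _ _).trans (add_le_add (hC n z) (hC' z))
    refine ⟨fun n => (((h.bm n).sub h.bm_lim).mol (hε n)).1, measurable_const, ⟨C + C,
      fun n => abs_mol_le _ (hCC n), fun z => by
        rw [abs_zero]; exact (abs_nonneg _).trans (hCC 0 z)⟩, ?_⟩
    refine squeeze_zero (fun n => integral_nonneg fun _ => abs_nonneg _) (fun n => ?_) h.tendsto
    have hts : TimeSupp 0 T fun z => f n z - g z := fun z hz => by simp [hs n z hz, hg z hz]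
    have hta : TimeSupp 0 T fun z => |f n z - g z| := fun z hz => by simp [hs n z hz, hg z hz]
    rw [integral_domain_eq hta]
    simp only [sub_zero]
    have hb := ((h.bm n).sub h.bm_lim)
    exact (integral_domain_le (((hb.mol (hε n)).integrable (hts.mol (hε n).le)).abs)
      fun _ => abs_nonneg _).trans (integral_abs_mol_le _ (hε n) hb hts)
  have h2 := h1.add (l1Conv_mol h.bm_lim hg hε hε0)
  simp only [zero_add] at h2
  refine ⟨fun n => ((h.bm n).mol (hε n)).1, h.2, ?_, h2.tendsto.congr fun n => ?_⟩
  · obtain ⟨C, hC, hC'⟩ := h.bdd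
    exact ⟨C, fun n => abs_mol_le _ (hC n), hC'⟩
  · congr 1; ext z
    rw [mol_sub _ (h.bm n) h.bm_lim]; ring_nf

/-- As N is only integrable, L¹ convergence of the bounded factors is not enough by itself. Every
subsequence has a further one that converges almost everywhere, and then C|N| dominates. The Hessian
of ρ and a locally integrable div(ρu) enter through this lemma. -/
theorem L1Conv.tendsto_integral_mul {f : ℕ → SpaceTime d → ℝ} {g : SpaceTime d → ℝ}
    (h : L1Conv T f g) {N : SpaceTime d → ℝ} (hN : Integrable N (domainMeasure d T)) :
    Tendsto (fun n => ∫ z, N z * f n z ∂(domainMeasure d T)) atTop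
      (𝓝 (∫ z, N z * g z ∂(domainMeasure d T))) := by
  obtain ⟨C, hC, -⟩ := h.bdd
  refine Filter.tendsto_of_subseq_tendsto fun ns hns => ?_
  have h1 : Tendsto (fun n => eLpNorm (f (ns n) - g) 1 (domainMeasure d T)) atTop (𝓝 0) := by
    have h2 := ENNReal.tendsto_ofReal (h.tendsto.comp hns)
    rw [ENNReal.ofReal_zero] at h2
    refine h2.congr fun n => ?_
    rw [Function.comp_apply, eLpNorm_one_eq_lintegral_enorm,
      ofReal_integral_eq_lintegral_ofReal ((h.bm _).sub h.bm_lim).abs.integrable_domain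
        (Eventually.of_forall fun _ => abs_nonneg _)]
    refine lintegral_congr fun z => ?_
    simp [← ofReal_norm]
  obtain ⟨ms, -, hms⟩ := (tendstoInMeasure_of_tendsto_eLpNorm one_ne_zero
    (fun n => (h.measurable (ns n)).aestronglyMeasurable)
    h.measurable_lim.aestronglyMeasurable h1).exists_seq_tendsto_ae
  refine ⟨ms, tendsto_integral_of_dominated_convergence (fun z => ‖N z‖ * C)
    (fun n => hN.1.mul (h.measurable _).aestronglyMeasurable) (hN.norm.mul_const C)
    (fun n => Eventually.of_forall fun z => ?_) ?_⟩
  · rw [norm_mul]; exact mul_le_mul_of_nonneg_left (hC _ z) (norm_nonneg _)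
  · filter_upwards [hms] with z hz using hz.const_mul (N z)

theorem L1Conv.tendsto_integral {f : ℕ → SpaceTime d → ℝ} {g : SpaceTime d → ℝ}
    (h : L1Conv T f g) : Tendsto (fun n => ∫ z, f n z ∂(domainMeasure d T)) atTop
      (𝓝 (∫ z, g z ∂(domainMeasure d T))) := by
  simpa using h.tendsto_integral_mul (integrable_const (1 : ℝ))

end EulerKorteweg

/-! ### Weak identities under mollification. -/

namespace EulerKorteweg

variable {d : ℕ} {T : ℝ}

theorem exists_time_margin {K : Set (SpaceTime d)} (hK : IsCompact K) (h : K ⊆ domain d T) :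
    ∃ δ > 0, ∀ z ∈ K, z.1 ∈ Set.Icc δ (T - δ) := by
  rcases K.eq_empty_or_nonempty with rfl | hne
  · exact ⟨1, one_pos, by simp⟩
  obtain ⟨z₁, hz₁, h₁⟩ := hK.exists_isMinOn hne continuous_fst.continuousOn
  obtain ⟨z₂, hz₂, h₂⟩ := hK.exists_isMaxOn hne continuous_fst.continuousOn
  have h3 := (h hz₁).1
  have h4 := (h hz₂).1
  refine ⟨min z₁.1 (T - z₂.1), lt_min h3.1 (by linarith [h4.2]), fun z hz => ⟨?_, ?_⟩⟩
  · exact (min_le_left _ _).trans (h₁ hz)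
  · have := min_le_right z₁.1 (T - z₂.1)
    have h5 : z.1 ≤ z₂.1 := h₂ hz
    linarith

theorem IsTest.sm {n : ℕ∞} {φ : SpaceTime d → ℝ} (hφ : IsTest T n φ) : Sm n φ := hφ.contDiff

theorem IsTest.exists_timeSupp {n : ℕ∞} {φ : SpaceTime d → ℝ} (hφ : IsTest T n φ) :
    ∃ δ > 0, TimeSupp δ (T - δ) φ := by
  obtain ⟨δ, hδ, h⟩ := exists_time_margin hφ.hasCompactSupport hφ.tsupport_subset
  exact ⟨δ, hδ, fun z hz => by_contra fun h0 => hz (h z (subset_tsupport φ h0))⟩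

theorem IsTest.bm {n : ℕ∞} {φ : SpaceTime d → ℝ} (hφ : IsTest T n φ) : BM φ :=
  BM.of_continuous hφ.sm.continuous hφ.hasCompactSupport

theorem isTest_of_sm {n : ℕ∞} {φ : SpaceTime d → ℝ} (hφ : Sm n φ) {δ : ℝ} (hδ : 0 < δ)
    (hs : TimeSupp δ (T - δ) φ) : IsTest T n φ :=
  ⟨hφ, hs.hasCompactSupport, fun _ hz =>
    ⟨⟨hδ.trans_le (hs.tsupport_subset hz).1.1, by linarith [(hs.tsupport_subset hz).1.2]⟩, trivial⟩⟩

theorem isTest_mol {ψ : SpaceTime d → ℝ} (hψ : BM ψ) {δ ε : ℝ} (hε : 0 < ε) (hδ : ε < δ)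
    (hs : TimeSupp δ (T - δ) ψ) : IsTest T ⊤ (mol ε ψ) :=
  isTest_of_sm (sm_mol hε hψ) (sub_pos.2 hδ) ((hs.mol hε.le).mono le_rfl (by linarith))

theorem BM.pd_mol {ε : ℝ} (hε : 0 < ε) {f : SpaceTime d → ℝ} (hf : BM f) {a b : ℝ}
    (hs : TimeSupp a b f) (v : ℝ × Vec d) :
    BM (EulerKorteweg.pd v (EulerKorteweg.mol ε f)) :=
  BM.of_continuous ((sm_mol hε hf (n := 1)).continuous_pd v)
    ((hs.mol hε.le).pd v).hasCompactSupport

/-- The mollified ψ is a legitimate test function, and the mollifier is then moved onto the f k. A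
family of directions and functions covers gradients, divergences and space-time divergences at once.
No bound on g is required, so g may be an L² Hessian entry or a locally integrable divergence. -/
theorem integral_pd_mol_mul {ι : Type*} [Fintype ι] {v : ι → ℝ × Vec d} {f : ι → SpaceTime d → ℝ}
    (hf : ∀ k, BM (f k)) (hfs : ∀ k, TimeSupp 0 T (f k)) {g : SpaceTime d → ℝ}
    (hw : ∀ φ : SpaceTime d → ℝ, IsTest T ⊤ φ → ∫ z, ∑ k, f k z * pd (v k) φ z ∂(domainMeasure d T)
      = -∫ z, g z * φ z ∂(domainMeasure d T))
    {δ ε : ℝ} (hε : 0 < ε) (hδ : ε < δ) {ψ : SpaceTime d → ℝ} (hψ : BM ψ)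
    (hs : TimeSupp δ (T - δ) ψ) :
    ∫ z, (∑ k, pd (v k) (mol ε (f k)) z) * ψ z =
      ∫ z, g z * mol ε ψ z ∂(domainMeasure d T) := by
  have h1 := hw _ (isTest_mol hψ hε hδ hs)
  rw [integral_domain_eq (fun z hz => Finset.sum_eq_zero fun k _ => by simp [hfs k z hz]),
    integral_finsetSum _ fun k _ => ((hf k).mul (hψ.pd_mol hε hs (v k))).integrable
      ((hfs k).mul_right _)] at h1
  simp only [integral_mul_pd_mol hε (hf _) hψ (hψ.integrable hs), Finset.sum_neg_distrib,
    neg_inj] at h1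
  rw [← h1, ← integral_finsetSum _ fun k _ => (((hf k).pd_mol hε (hfs k) (v k)).mul hψ).integrable
    (hs.mul_left _)]
  simp only [Finset.sum_mul]

/-- A continuous time cutoff, positive exactly on `(a, b)`. -/
noncomputable def timeHat (a b : ℝ) (z : SpaceTime d) : ℝ := max 0 (min (z.1 - a) (b - z.1))

/-- The difference F of the two sides is continuous and orthogonal to every bounded ψ supported at
times in [δ, T - δ]. The choice ψ = F · `timeHat` gives ∫ F² `timeHat` = 0. -/
theorem sum_pd_mol_eq {ι : Type*} [Fintype ι] {v : ι → ℝ × Vec d} {f : ι → SpaceTime d → ℝ}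
    (hf : ∀ k, BM (f k)) (hfs : ∀ k, TimeSupp 0 T (f k)) {g : SpaceTime d → ℝ} (hg : BM g)
    (hgs : TimeSupp 0 T g)
    (hw : ∀ φ : SpaceTime d → ℝ, IsTest T ⊤ φ → ∫ z, ∑ k, f k z * pd (v k) φ z ∂(domainMeasure d T)
      = -∫ z, g z * φ z ∂(domainMeasure d T))
    {δ ε : ℝ} (hε : 0 < ε) (hδ : ε < δ) {z : SpaceTime d} (hz : z.1 ∈ Set.Ioo δ (T - δ)) :
    ∑ k, pd (v k) (mol ε (f k)) z = mol ε g z := by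
  set F : SpaceTime d → ℝ := fun z => ∑ k, pd (v k) (mol ε (f k)) z - mol ε g z with hF
  have hFc : Continuous F := (continuous_finsetSum _ fun k _ =>
    (sm_mol hε (hf k) (n := 1)).continuous_pd (v k)).sub (sm_mol hε hg (n := 0)).continuous
  have hχc : Continuous (timeHat (d := d) δ (T - δ)) := by unfold timeHat; fun_prop
  have hχs : TimeSupp δ (T - δ) (timeHat (d := d) δ (T - δ)) := by
    intro w hw
    refine max_eq_left ?_
    by_contra h
    have := lt_min_iff.1 (not_le.1 h)
    exact hw ⟨by linarith, by linarith⟩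
  have hψs : TimeSupp δ (T - δ) fun z => F z * timeHat δ (T - δ) z := hχs.mul_left _
  have hψ : BM fun z => F z * timeHat δ (T - δ) z :=
    BM.of_continuous (hFc.mul hχc) hψs.hasCompactSupport
  have h1 := integral_pd_mol_mul hf hfs hw hε hδ hψ hψs
  rw [integral_domain_eq (hgs.mul_right _), ← integral_mol_mul ε hg hψ (hψ.integrable hψs)] at h1
  have hB1 : BM fun z => ∑ k, pd (v k) (mol ε (f k)) z :=
    BM.sum fun k => (hf k).pd_mol hε (hfs k) (v k)
  have h2 : ∫ z, F z * (F z * timeHat δ (T - δ) z) = 0 := by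
    simp only [hF, sub_mul] at h1 ⊢
    rw [integral_sub]
    · exact sub_eq_zero.2 h1
    · have := (hB1.mul hψ).integrable (hψs.mul_left _)
      simpa only [hF, sub_mul] using this
    · have := ((hg.mol hε).mul hψ).integrable (hψs.mul_left _)
      simpa only [hF, sub_mul] using this
  by_contra hne
  have hne' : F z ≠ 0 := sub_ne_zero.2 hne
  have hχz : 0 < timeHat δ (T - δ) z :=
    lt_max_of_lt_right (lt_min (by linarith [hz.1]) (by linarith [hz.2]))
  refine (Continuous.integral_pos_of_hasCompactSupport_nonneg_nonzero (μ := volume)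
    (f := fun z => F z * (F z * timeHat δ (T - δ) z)) (x := z) (hFc.mul (hFc.mul hχc))
    hψs.hasCompactSupport.mul_left (fun w => ?_) ?_).ne' h2
  · change 0 ≤ F w * (F w * timeHat δ (T - δ) w)
    rw [← mul_assoc]
    exact mul_nonneg (mul_self_nonneg _) (le_max_left _ _)
  · exact mul_ne_zero hne' (mul_ne_zero hne' hχz.ne')

/-- Test with the mollified sign of F, cut off to a closed time strip; in the limit the integral of
|F| over the strip vanishes. Countably many strips exhaust the domain. -/
theorem ae_eq_zero_of_integral_mul_test {F : SpaceTime d → ℝ} (hF : Integrable F (domainMeasure d T))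
    (h : ∀ φ : SpaceTime d → ℝ, IsTest T ⊤ φ → ∫ z, F z * φ z ∂(domainMeasure d T) = 0) :
    F =ᵐ[domainMeasure d T] 0 := by
  obtain ⟨G, hGm, hFG⟩ := hF.1
  have hGm' := hGm.measurable
  have key : ∀ δ > 0, ∀ᵐ z ∂(domainMeasure d T), z.1 ∈ Set.Icc δ (T - δ) → F z = 0 := by
    intro δ hδ
    set S : Set (SpaceTime d) := Set.Icc δ (T - δ) ×ˢ Set.univ with hS
    have hSm : MeasurableSet S := measurableSet_Icc.prod MeasurableSet.univ
    set ψ : SpaceTime d → ℝ := S.indicator fun z => (SignType.sign (G z) : ℝ) with hψdef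
    have hsgn : Measurable fun z => ((SignType.sign (G z) : SignType) : ℝ) := by
      have : Measurable fun x : ℝ => ((SignType.sign x : SignType) : ℝ) := by
        have : (fun x : ℝ => ((SignType.sign x : SignType) : ℝ)) =
            fun x => if 0 < x then 1 else if x < 0 then -1 else 0 := by
          ext x
          rw [sign_apply]
          split_ifs <;> simp
        rw [this]
        exact Measurable.ite measurableSet_Ioi measurable_const
          (Measurable.ite measurableSet_Iio measurable_const measurable_const)
      exact this.comp hGm'
    have hψ : BM ψ := by
      refine ⟨hsgn.indicator hSm, 1, fun z => ?_⟩
      by_cases hz : z ∈ S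
      · rw [hψdef, Set.indicator_of_mem hz]
        cases SignType.sign (G z) <;> simp
      · rw [hψdef, Set.indicator_of_notMem hz]; simp
    have hs : TimeSupp δ (T - δ) ψ := fun z hz => Set.indicator_of_notMem (fun h => hz h.1) _
    have hε : ∀ n : ℕ, 0 < δ / (n + 2) := fun n => by positivity
    have hε0 : Tendsto (fun n : ℕ => δ / ((n : ℝ) + 2)) atTop (𝓝 0) :=
      tendsto_const_nhds.div_atTop (tendsto_natCast_atTop_atTop.atTop_add tendsto_const_nhds)
    have hlt : ∀ n : ℕ, δ / ((n : ℝ) + 2) < δ := fun n =>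
      div_lt_self hδ (by have : (0 : ℝ) ≤ n := Nat.cast_nonneg n
                         linarith)
    have h1 := (l1Conv_mol (T := T) hψ hs hε hε0).tendsto_integral_mul hF
    simp only [h _ (isTest_mol hψ (hε _) (hlt _) hs)] at h1
    have h2 : ∫ z, F z * ψ z ∂(domainMeasure d T) = 0 := tendsto_nhds_unique h1 tendsto_const_nhds
    have h3 : (fun z => F z * ψ z) =ᵐ[domainMeasure d T] fun z => S.indicator (fun z => |G z|) z := by
      filter_upwards [hFG] with z hz
      by_cases hzS : z ∈ S
      · rw [hψdef, Set.indicator_of_mem hzS, Set.indicator_of_mem hzS, hz, self_mul_sign]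
      · rw [hψdef, Set.indicator_of_notMem hzS, Set.indicator_of_notMem hzS, mul_zero]
    have hint : Integrable (fun z => F z * ψ z) (domainMeasure d T) := by
      obtain ⟨C, hC⟩ := hψ.bdd
      exact hF.mul_bdd (c := C) hψ.1.aestronglyMeasurable (Eventually.of_forall hC)
    rw [integral_congr_ae h3, integral_eq_zero_iff_of_nonneg
      (fun z => Set.indicator_nonneg (fun _ _ => abs_nonneg _) z) (hint.congr h3)] at h2
    filter_upwards [h2, hFG] with z hz hz2 hzt
    rw [Set.indicator_of_mem (show z ∈ S from ⟨hzt, trivial⟩)] at hz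
    rw [hz2]
    exact abs_eq_zero.1 hz
  have h4 : ∀ᵐ z ∂(domainMeasure d T), ∀ n : ℕ,
      z.1 ∈ Set.Icc (1 / ((n : ℝ) + 1)) (T - 1 / ((n : ℝ) + 1)) → F z = 0 :=
    ae_all_iff.2 fun n => key _ (by positivity)
  have h5 : ∀ᵐ z ∂(domainMeasure d T), z ∈ domain d T :=
    ae_restrict_mem (measurableSet_Ioo.prod MeasurableSet.univ)
  filter_upwards [h4, h5] with z hz hzd
  obtain ⟨n, hn⟩ := exists_nat_one_div_lt (lt_min hzd.1.1 (sub_pos.2 hzd.1.2))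
  exact hz n ⟨(hn.trans_le (min_le_left _ _)).le, by
    linarith [hn.trans_le (min_le_right z.1 (T - z.1))]⟩

end EulerKorteweg

/-! ### The Hessian of the density is square integrable. -/

namespace EulerKorteweg

variable {d : ℕ} {T : ℝ}

/-- A functional that is bounded in terms of `‖J s‖` is represented by a vector. -/
theorem exists_inner_eq_of_bound {S H : Type*} [AddCommGroup S] [Module ℝ S]
    [NormedAddCommGroup H] [InnerProductSpace ℝ H] [CompleteSpace H] (J : S →ₗ[ℝ] H)
    (L : S →ₗ[ℝ] ℝ) (C : ℝ) (hL : ∀ s, |L s| ≤ C * ‖J s‖) :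
    ∃ g : H, ∀ s, L s = inner ℝ g (J s) := by
  -- The range of `J` need not be dense in `H`: the functional is extended to the closure of the
  -- range, and the Riesz representation is taken there.
  set K : Submodule ℝ H := (LinearMap.range J).topologicalClosure
  have : CompleteSpace K := (Submodule.isClosed_topologicalClosure _).completeSpace_coe
  set e : S →ₗ[ℝ] K := J.codRestrict K
    fun s => Submodule.le_topologicalClosure _ (LinearMap.mem_range_self J s)
  have hd : DenseRange e := by
    intro x
    rw [closure_subtype]
    have hx : (x : H) ∈ closure (LinearMap.range J : Set H) := x.2
    convert hx using 2
    ext y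
    constructor
    · rintro ⟨_, ⟨s, rfl⟩, rfl⟩; exact ⟨s, rfl⟩
    · rintro ⟨s, rfl⟩; exact ⟨e s, ⟨s, rfl⟩, rfl⟩
  have hext := LinearMap.extendOfNorm_eq (f := L) (e := e) hd ⟨C, hL⟩
  refine ⟨(((InnerProductSpace.toDual ℝ K).symm (L.extendOfNorm e) : K) : H), fun s => ?_⟩
  rw [← hext s, ← InnerProductSpace.toDual_symm_apply (𝕜 := ℝ)]
  rfl

theorem inner_toLp_eq {μ : Measure (SpaceTime d)} {f g : SpaceTime d → ℝ} (hf : MemLp f 2 μ)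
    (hg : MemLp g 2 μ) : inner ℝ (hf.toLp f) (hg.toLp g) = ∫ z, f z * g z ∂μ := by
  rw [L2.inner_def]
  refine integral_congr_ae ?_
  filter_upwards [hf.coeFn_toLp, hg.coeFn_toLp] with z h1 h2
  rw [h1, h2]
  simp [mul_comm]

theorem BM.memLp {f : SpaceTime d → ℝ} (hf : BM f) (p : ℝ≥0∞) : MemLp f p (domainMeasure d T) := by
  obtain ⟨C, hC⟩ := hf.bdd
  exact MemLp.of_bound hf.1.aestronglyMeasurable C (Eventually.of_forall hC)

theorem abs_integral_mul_le {f g : SpaceTime d → ℝ} (hf : BM f) (hg : BM g) {C : ℝ} (hC : 0 ≤ C)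
    (h : ∫ z, f z * f z ∂(domainMeasure d T) ≤ C ^ 2) :
    |∫ z, f z * g z ∂(domainMeasure d T)| ≤ C * ‖(hg.memLp (T := T) 2).toLp g‖ := by
  rw [← inner_toLp_eq (hf.memLp 2) (hg.memLp 2)]
  refine (abs_real_inner_le_norm _ _).trans (mul_le_mul_of_nonneg_right ?_ (norm_nonneg _))
  refine abs_le_of_sq_le_sq' ?_ hC |>.2
  rwa [← real_inner_self_eq_norm_sq, inner_toLp_eq]

/-- A smooth time cutoff, equal to `1` on `[δ, T - δ]` and supported in `[3δ/4, T - 3δ/4]`. -/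
noncomputable def cutoff (T δ : ℝ) (t : ℝ) : ℝ :=
  Real.smoothTransition ((t - 3 * δ / 4) / (δ / 4)) *
    Real.smoothTransition ((T - 3 * δ / 4 - t) / (δ / 4))

theorem contDiff_cutoff (T δ : ℝ) {n : ℕ∞} : ContDiff ℝ n (cutoff T δ) := by
  unfold cutoff
  refine ContDiff.mul (Real.smoothTransition.contDiff.comp ?_)
    (Real.smoothTransition.contDiff.comp ?_) <;> fun_prop

theorem cutoff_nonneg (T δ t : ℝ) : 0 ≤ cutoff T δ t :=
  mul_nonneg (Real.smoothTransition.nonneg _) (Real.smoothTransition.nonneg _)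

theorem cutoff_le_one (T δ t : ℝ) : cutoff T δ t ≤ 1 :=
  mul_le_one₀ (Real.smoothTransition.le_one _) (Real.smoothTransition.nonneg _)
    (Real.smoothTransition.le_one _)

theorem cutoff_eq_one {T δ t : ℝ} (hδ : 0 < δ) (ht : t ∈ Set.Icc δ (T - δ)) : cutoff T δ t = 1 := by
  rw [cutoff, Real.smoothTransition.one_of_one_le, Real.smoothTransition.one_of_one_le, one_mul]
  · rw [le_div_iff₀ (by positivity)]; linarith [ht.2]
  · rw [le_div_iff₀ (by positivity)]; linarith [ht.1]

theorem timeSupp_cutoff {T δ : ℝ} (hδ : 0 < δ) :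
    TimeSupp (3 * δ / 4) (T - 3 * δ / 4) fun z : SpaceTime d => cutoff T δ z.1 := by
  intro z hz
  change cutoff T δ z.1 = 0
  rw [Set.mem_Icc, not_and_or, not_le, not_le] at hz
  rcases hz with hz | hz
  · rw [cutoff, Real.smoothTransition.zero_of_nonpos, zero_mul]
    exact div_nonpos_of_nonpos_of_nonneg (by linarith) (by positivity)
  · rw [cutoff, Real.smoothTransition.zero_of_nonpos (x := (T - 3 * δ / 4 - z.1) / (δ / 4)), mul_zero]
    exact div_nonpos_of_nonpos_of_nonneg (by linarith) (by positivity)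

theorem pd_ex_time (χ : ℝ → ℝ) (j : Fin d) (z : SpaceTime d) :
    pd (ex j) (fun z : SpaceTime d => χ z.1) z = 0 := by
  have : (fun s : ℝ => χ (z + cover (s • ex j)).1) = fun _ => χ z.1 := by
    ext s; simp [cover, ex]
  rw [pd, this, deriv_const]

/-- Both sides equal the integral of -χ f ∂ᵢ∂ⱼg. No derivative of the weight appears, because χ
depends on time only and the derivatives are spatial. -/
theorem integral_cutoff_pd_mul_pd {χ : ℝ → ℝ} (hχ : ContDiff ℝ 1 χ) {a b : ℝ}
    (hs : TimeSupp a b fun z : SpaceTime d => χ z.1) {f g : SpaceTime d → ℝ} (hf : Sm 2 f)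
    (hg : Sm 2 g) (i j : Fin d) :
    ∫ z, χ z.1 * (pd (ex j) f z * pd (ex i) g z) = ∫ z, χ z.1 * (pd (ex i) f z * pd (ex j) g z) := by
  have hf1 : Sm 1 f := hf.of_le (by norm_num)
  have hg2 : Sm (1 + 1) g := by rw [one_add_one_eq_two]; exact hg
  have hχs : Sm 1 fun z : SpaceTime d => χ z.1 := sm_time hχ
  have key : ∀ a b : Fin d, ∫ z, χ z.1 * (pd (ex a) f z * pd (ex b) g z) =
      -∫ z, χ z.1 * (f z * pd (ex a) (pd (ex b) g) z) := by
    intro a b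
    have h1 := integral_pd_mul (hf1.mul (hg2.pd (ex b))) hχs hs.hasCompactSupport (ex a)
    simp only [pd_mul hf1 (hg2.pd (ex b)), pd_ex_time, mul_zero, integral_zero, neg_zero] at h1
    rw [← add_eq_zero_iff_eq_neg, ← integral_add]
    · rw [← h1]; congr 1; ext z; ring
    · exact (hχs.continuous.mul ((hf1.continuous_pd _).mul
        (hg2.pd _).continuous)).integrable_of_hasCompactSupport hs.hasCompactSupport.mul_right
    · exact (hχs.continuous.mul (hf1.continuous.mul
        ((hg2.pd _).continuous_pd _))).integrable_of_hasCompactSupport hs.hasCompactSupport.mul_right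
  rw [key, key]
  simp only [pd_comm hg (ex j) (ex i)]

theorem isTest_iff {φ : SpaceTime d → ℝ} {n : ℕ∞} :
    IsTest T n φ ↔ Sm n φ ∧ ∃ δ > 0, TimeSupp δ (T - δ) φ :=
  ⟨fun h => ⟨h.sm, h.exists_timeSupp⟩, fun ⟨h, _, hδ, hs⟩ => isTest_of_sm h hδ hs⟩

/-- The space of smooth test functions. -/
def testSpace (d : ℕ) (T : ℝ) : Submodule ℝ (SpaceTime d → ℝ) where
  carrier := {φ | IsTest T ⊤ φ}
  add_mem' := by
    intro φ ψ hφ hψ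
    obtain ⟨h1, δ, hδ, h2⟩ := isTest_iff.1 hφ
    obtain ⟨h3, δ', hδ', h4⟩ := isTest_iff.1 hψ
    refine isTest_iff.2 ⟨h1.add h3, min δ δ', lt_min hδ hδ', fun z hz => ?_⟩
    have h5 := (h2.mono (min_le_left δ δ') (by linarith [min_le_left δ δ']) :
      TimeSupp (min δ δ') (T - min δ δ') φ) z hz
    have h6 := (h4.mono (min_le_right δ δ') (by linarith [min_le_right δ δ']) :
      TimeSupp (min δ δ') (T - min δ δ') ψ) z hz
    simp [h5, h6]
  zero_mem' := isTest_iff.2 ⟨sm_const _ 0, 1, one_pos, fun _ _ => rfl⟩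
  smul_mem' := by
    intro c φ hφ
    obtain ⟨h1, δ, hδ, h2⟩ := isTest_iff.1 hφ
    exact isTest_iff.2 ⟨(sm_const _ c).mul h1, δ, hδ, fun z hz => by simp [h2 z hz]⟩

theorem mem_testSpace {φ : SpaceTime d → ℝ} : φ ∈ testSpace d T ↔ IsTest T ⊤ φ := Iff.rfl

theorem exists_scales {δ : ℝ} (hδ : 0 < δ) :
    ∃ ε : ℕ → ℝ, (∀ n, 0 < ε n) ∧ (∀ n, ε n < δ) ∧ Tendsto ε atTop (𝓝 0) := by
  refine ⟨fun n => δ / (n + 2), fun n => by positivity, fun n => div_lt_self hδ ?_,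
    tendsto_const_nhds.div_atTop (tendsto_natCast_atTop_atTop.atTop_add tendsto_const_nhds)⟩
  have : (0 : ℝ) ≤ n := Nat.cast_nonneg n
  linarith

variable {ρ r : SpaceTime d → ℝ} {q : Fin d → SpaceTime d → ℝ}

/-- The hypotheses `q = ∇ρ` and `r = Δρ` for bounded functions, supported in `[0, T]`. -/
structure DensityData (T : ℝ) (ρ : SpaceTime d → ℝ) (q : Fin d → SpaceTime d → ℝ)
    (r : SpaceTime d → ℝ) : Prop where
  bm_ρ : BM ρ
  bm_q : ∀ j, BM (q j)
  bm_r : BM r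
  supp_ρ : TimeSupp 0 T ρ
  supp_q : ∀ j, TimeSupp 0 T (q j)
  supp_r : TimeSupp 0 T r
  grad : ∀ j, ∀ φ : SpaceTime d → ℝ, IsTest T ⊤ φ →
    ∫ z, ρ z * pd (ex j) φ z ∂(domainMeasure d T) = -∫ z, q j z * φ z ∂(domainMeasure d T)
  lap : ∀ φ : SpaceTime d → ℝ, IsTest T ⊤ φ →
    ∫ z, ∑ j, q j z * pd (ex j) φ z ∂(domainMeasure d T) = -∫ z, r z * φ z ∂(domainMeasure d T)

theorem DensityData.pd_mol_ρ (h : DensityData T ρ q r) {δ ε : ℝ} (hε : 0 < ε) (hδ : ε < δ)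
    {z : SpaceTime d} (hz : z.1 ∈ Set.Ioo δ (T - δ)) (j : Fin d) :
    pd (ex j) (mol ε ρ) z = mol ε (q j) z := by
  have := sum_pd_mol_eq (ι := Unit) (v := fun _ => ex j) (f := fun _ => ρ) (fun _ => h.bm_ρ)
    (fun _ => h.supp_ρ) (h.bm_q j) (h.supp_q j) (by simpa using h.grad j) hε hδ hz
  simpa using this

theorem DensityData.sum_pd_mol_q (h : DensityData T ρ q r) {δ ε : ℝ} (hε : 0 < ε) (hδ : ε < δ)
    {z : SpaceTime d} (hz : z.1 ∈ Set.Ioo δ (T - δ)) :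
    ∑ j, pd (ex j) (mol ε (q j)) z = mol ε r z :=
  sum_pd_mol_eq h.bm_q h.supp_q h.bm_r h.supp_r h.lap hε hδ hz

theorem isOpen_timeStrip (a b : ℝ) : IsOpen {z : SpaceTime d | z.1 ∈ Set.Ioo a b} :=
  isOpen_Ioo.preimage continuous_fst

theorem DensityData.pd_mol_q_symm (h : DensityData T ρ q r) {δ ε : ℝ} (hε : 0 < ε) (hδ : ε < δ)
    {z : SpaceTime d} (hz : z.1 ∈ Set.Ioo δ (T - δ)) (i j : Fin d) :
    pd (ex j) (mol ε (q i)) z = pd (ex i) (mol ε (q j)) z := by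
  have hU := isOpen_timeStrip (d := d) δ (T - δ)
  rw [← pd_congr hU (fun w hw => h.pd_mol_ρ hε hδ hw i) (ex j) hz,
    ← pd_congr hU (fun w hw => h.pd_mol_ρ hε hδ hw j) (ex i) hz]
  exact pd_comm (sm_mol hε h.bm_ρ (n := 2)) _ _ z

/-- Since ∂ⱼQᵢ = ∂ᵢQⱼ, the sum of the squares of all entries equals, after the exchange of
derivatives under the integral, ∫ χ (div Q)², and div Q is the mollified Δρ, bounded by C. The
resulting bound depends neither on ε nor on δ. -/
theorem DensityData.integral_hessian_sq_le (h : DensityData T ρ q r) {C : ℝ} (hC : ∀ z, |r z| ≤ C)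
    {δ ε : ℝ} (hε : 0 < ε) (hδ : ε < δ / 2) (i j : Fin d) :
    ∫ z, cutoff T δ z.1 * (pd (ex j) (mol ε (q i)) z) ^ 2 ≤
      C ^ 2 * (domainMeasure d T).real Set.univ := by
  have hδ0 : 0 < δ := by linarith
  set χ : SpaceTime d → ℝ := fun z => cutoff T δ z.1 with hχ
  have hχs : TimeSupp (3 * δ / 4) (T - 3 * δ / 4) χ := timeSupp_cutoff hδ0
  have hχ0 : TimeSupp 0 T χ := hχs.mono (by linarith) (by linarith)
  have hχc : Continuous χ := (sm_time (contDiff_cutoff T δ (n := 0))).continuous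
  have hχn : ∀ z, 0 ≤ χ z := fun z => cutoff_nonneg T δ z.1
  have hsm : ∀ i, Sm 2 (mol ε (q i)) := fun i => sm_mol hε (h.bm_q i) (n := 2)
  have hsm1 : ∀ i, Sm 1 (mol ε (q i)) := fun i => sm_mol hε (h.bm_q i) (n := 1)
  have hcont : ∀ i j, Continuous (pd (ex j) (mol ε (q i))) := fun i j => (hsm1 i).continuous_pd _
  -- Where the cutoff does not vanish, the time is farther than δ/2 > ε from both ends, so the
  -- mollified identities for ∇ρ and Δρ are available.
  have hstrip : ∀ z : SpaceTime d, χ z ≠ 0 → z.1 ∈ Set.Ioo (δ / 2) (T - δ / 2) := by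
    intro z hz
    have : z.1 ∈ Set.Icc (3 * δ / 4) (T - 3 * δ / 4) := by_contra fun h => hz (hχs z h)
    exact ⟨by linarith [this.1], by linarith [this.2]⟩
  have hint : ∀ {f : SpaceTime d → ℝ}, Continuous f → Integrable fun z => χ z * f z :=
    fun hf => (hχc.mul hf).integrable_of_hasCompactSupport hχs.hasCompactSupport.mul_right
  have hI : ∀ a b i j, Integrable fun z =>
      χ z * (pd (ex a) (mol ε (q i)) z * pd (ex b) (mol ε (q j)) z) :=
    fun a b i j => hint ((hcont i a).mul (hcont j b))
  calc ∫ z, χ z * (pd (ex j) (mol ε (q i)) z) ^ 2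
      ≤ ∫ z, ∑ i, ∑ j, χ z * (pd (ex j) (mol ε (q i)) z * pd (ex i) (mol ε (q j)) z) := by
        refine integral_mono (hint ((hcont i j).pow 2)) (integrable_finsetSum _ fun i _ =>
          integrable_finsetSum _ fun j _ => hI j i i j) fun z => ?_
        by_cases hz : χ z = 0
        · simp [hz]
        have hsq : ∀ i j, χ z * (pd (ex j) (mol ε (q i)) z * pd (ex i) (mol ε (q j)) z) =
            χ z * (pd (ex j) (mol ε (q i)) z) ^ 2 := fun i j => by
          rw [← h.pd_mol_q_symm hε hδ (hstrip z hz) i j, sq]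
        simp only [hsq]
        have hn : ∀ i j, 0 ≤ χ z * (pd (ex j) (mol ε (q i)) z) ^ 2 := fun i j =>
          mul_nonneg (hχn z) (sq_nonneg _)
        exact (Finset.single_le_sum (f := fun j => χ z * (pd (ex j) (mol ε (q i)) z) ^ 2)
          (fun j _ => hn i j) (Finset.mem_univ j)).trans
          (Finset.single_le_sum (f := fun i => ∑ j, χ z * (pd (ex j) (mol ε (q i)) z) ^ 2)
          (fun i _ => Finset.sum_nonneg fun j _ => hn i j) (Finset.mem_univ i))
    _ = ∑ i, ∑ j, ∫ z, χ z * (pd (ex j) (mol ε (q i)) z * pd (ex i) (mol ε (q j)) z) := by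
        rw [integral_finsetSum _ fun i _ => integrable_finsetSum _ fun j _ => hI j i i j]
        exact Finset.sum_congr rfl fun i _ => integral_finsetSum _ fun j _ => hI j i i j
    _ = ∑ i, ∑ j, ∫ z, χ z * (pd (ex i) (mol ε (q i)) z * pd (ex j) (mol ε (q j)) z) :=
        Finset.sum_congr rfl fun i _ => Finset.sum_congr rfl fun j _ =>
          integral_cutoff_pd_mul_pd (contDiff_cutoff T δ (n := 1)) hχs (hsm i) (hsm j) i j
    _ = ∫ z, ∑ i, ∑ j, χ z * (pd (ex i) (mol ε (q i)) z * pd (ex j) (mol ε (q j)) z) := by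
        rw [integral_finsetSum _ fun i _ => integrable_finsetSum _ fun j _ => hI i j i j]
        exact Finset.sum_congr rfl fun i _ => (integral_finsetSum _ fun j _ => hI i j i j).symm
    _ = ∫ z, χ z * (mol ε r z * mol ε r z) := by
        congr 1; ext z
        by_cases hz : χ z = 0
        · simp [hz]
        rw [← h.sum_pd_mol_q hε hδ (hstrip z hz), Finset.sum_mul_sum, Finset.mul_sum]
        simp only [Finset.mul_sum]
    _ = ∫ z, χ z * (mol ε r z * mol ε r z) ∂(domainMeasure d T) :=
        (integral_domain_eq (hχ0.mul_right _)).symm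
    _ ≤ ∫ z, C ^ 2 ∂(domainMeasure d T) := by
        have hb : BM fun z => χ z * (mol ε r z * mol ε r z) :=
          (BM.of_continuous hχc hχs.hasCompactSupport).mul ((h.bm_r.mol hε).mul (h.bm_r.mol hε))
        refine integral_mono hb.integrable_domain (integrable_const _) fun z => ?_
        have h1 : mol ε r z * mol ε r z ≤ C ^ 2 := by
          rw [← sq]; exact sq_le_sq' (abs_le.1 (abs_mol_le ε hC z)).1 (abs_le.1 (abs_mol_le ε hC z)).2
        exact (mul_le_of_le_one_left (mul_self_nonneg _) (cutoff_le_one T δ z.1)).trans h1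
    _ = _ := by simp [mul_comm]

/-- The uniform L² bound on ∂ⱼQᵢ makes φ ↦ -∫ qᵢ ∂ⱼφ bounded with respect to the L² norm of φ, and
the representing vector is the weak derivative. -/
theorem DensityData.exists_hessian (h : DensityData T ρ q r) (i j : Fin d) :
    ∃ N : SpaceTime d → ℝ, MemLp N 2 (domainMeasure d T) ∧ ∀ φ : SpaceTime d → ℝ, IsTest T ⊤ φ →
      ∫ z, q i z * pd (ex j) φ z ∂(domainMeasure d T) =
        -∫ z, N z * φ z ∂(domainMeasure d T) := by
  have hbm : ∀ φ : testSpace d T, BM φ.1 := fun φ => (mem_testSpace.1 φ.2).bm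
  have hsm : ∀ φ : testSpace d T, Sm 1 φ.1 := fun φ => (mem_testSpace.1 φ.2).sm.of_le (by simp)
  have hpd : ∀ φ : testSpace d T, BM (pd (ex j) φ.1) := fun φ =>
    BM.of_continuous ((hsm φ).continuous_pd _)
      (hasCompactSupport_pd (mem_testSpace.1 φ.2).hasCompactSupport _)
  set J : testSpace d T →ₗ[ℝ] Lp ℝ 2 (domainMeasure d T) :=
    { toFun := fun φ => ((hbm φ).memLp 2).toLp φ.1
      map_add' := fun φ ψ => rfl
      map_smul' := fun c φ => rfl }
  set L : testSpace d T →ₗ[ℝ] ℝ :=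
    { toFun := fun φ => -∫ z, q i z * pd (ex j) φ.1 z ∂(domainMeasure d T)
      map_add' := fun φ ψ => by
        rw [← neg_add, ← integral_add ((h.bm_q i).mul (hpd φ)).integrable_domain
          ((h.bm_q i).mul (hpd ψ)).integrable_domain]
        congr 2; ext z
        rw [← mul_add, ← pd_add (hsm φ) (hsm ψ)]
        rfl
      map_smul' := fun c φ => by
        rw [RingHom.id_apply, smul_eq_mul, mul_neg, ← integral_const_mul]
        congr 2; ext z
        have : pd (ex j) ((c • φ : testSpace d T) : SpaceTime d → ℝ) z = c * pd (ex j) φ.1 z :=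
          pd_const_mul (hsm φ) c _ z
        rw [this]; ring }
  obtain ⟨C, hC⟩ := h.bm_r.bdd
  -- This constant does not depend on the support of φ, so N is square integrable on the whole
  -- domain and not only locally.
  set D : ℝ := √(C ^ 2 * (domainMeasure d T).real Set.univ)
  have hL : ∀ φ, |L φ| ≤ D * ‖J φ‖ := by
    intro φ
    obtain ⟨δ, hδ, hs⟩ := (mem_testSpace.1 φ.2).exists_timeSupp
    obtain ⟨ε, hε, hεδ, hε0⟩ := exists_scales (half_pos hδ)
    have h1 := ((l1Conv_mol (T := T) (h.bm_q i) (h.supp_q i) hε hε0).mul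
      (hpd φ).l1Conv).tendsto_integral.neg.abs
    refine le_of_tendsto h1 (Eventually.of_forall fun n => ?_)
    have hsm' := sm_mol (hε n) (h.bm_q i) (n := 1)
    have hs0 : TimeSupp 0 T φ.1 := hs.mono hδ.le (by linarith)
    have hχs : TimeSupp (3 * δ / 4) (T - 3 * δ / 4) fun z : SpaceTime d => cutoff T δ z.1 :=
      timeSupp_cutoff hδ
    have hχb : BM fun z : SpaceTime d => cutoff T δ z.1 :=
      BM.of_continuous (sm_time (contDiff_cutoff T δ (n := 0))).continuous hχs.hasCompactSupport
    have hA : BM fun z => cutoff T δ z.1 * pd (ex j) (mol (ε n) (q i)) z :=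
      hχb.mul ((h.bm_q i).pd_mol (hε n) (h.supp_q i) _)
    have h2 : -∫ z, mol (ε n) (q i) z * pd (ex j) φ.1 z ∂(domainMeasure d T) =
        ∫ z, (cutoff T δ z.1 * pd (ex j) (mol (ε n) (q i)) z) * φ.1 z ∂(domainMeasure d T) := by
      rw [integral_domain_eq ((hs0.pd _).mul_left _), integral_domain_eq (hs0.mul_left _),
        ← integral_pd_mul hsm' (hsm φ) hs.hasCompactSupport]
      congr 1; ext z
      by_cases hz : z.1 ∈ Set.Icc δ (T - δ)
      · rw [cutoff_eq_one hδ hz, one_mul]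
      · rw [hs z hz, mul_zero, mul_zero]
    rw [h2]
    refine abs_integral_mul_le hA (hbm φ) (Real.sqrt_nonneg _) ?_
    rw [Real.sq_sqrt (mul_nonneg (sq_nonneg _) measureReal_nonneg)]
    refine le_trans ?_ (h.integral_hessian_sq_le hC (hε n) (hεδ n) i j)
    have hχ0 : TimeSupp 0 T fun z : SpaceTime d => cutoff T δ z.1 :=
      hχs.mono (by linarith) (by linarith)
    rw [← integral_domain_eq (hχ0.mul_right _)]
    have hB := (h.bm_q i).pd_mol (hε n) (h.supp_q i) (ex j)
    refine integral_mono (hA.mul hA).integrable_domain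
      (hχb.mul (hB.comp (continuous_pow 2))).integrable_domain fun z => ?_
    simp only
    have h3 := cutoff_nonneg T δ z.1
    have h4 := cutoff_le_one T δ z.1
    have h5 : cutoff T δ z.1 * cutoff T δ z.1 ≤ cutoff T δ z.1 := mul_le_of_le_one_left h3 h4
    calc _ = (cutoff T δ z.1 * cutoff T δ z.1) * (pd (ex j) (mol (ε n) (q i)) z) ^ 2 := by ring
      _ ≤ _ := mul_le_mul_of_nonneg_right h5 (sq_nonneg _)
  obtain ⟨N, hN⟩ := exists_inner_eq_of_bound J L D hL
  refine ⟨N, Lp.memLp N, fun φ hφ => ?_⟩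
  have h1 := hN ⟨φ, hφ⟩
  have h2 : inner ℝ N (J ⟨φ, hφ⟩) = ∫ z, N z * φ z ∂(domainMeasure d T) := by
    rw [← inner_toLp_eq (Lp.memLp N) (hφ.bm.memLp 2), Lp.toLp_coeFn]
    rfl
  rw [h2] at h1
  rw [← h1]
  exact (neg_neg _).symm

end EulerKorteweg

/-! ### Mean oscillations and pointwise commutator estimates. -/

namespace EulerKorteweg

set_option linter.unusedSectionVars false

variable {d : ℕ} {T : ℝ}

/-- The closed unit ball of shifts. -/
abbrev unitBall (d : ℕ) : Set (ℝ × Vec d) := Metric.closedBall 0 1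

instance : IsFiniteMeasure ((volume : Measure (ℝ × Vec d)).restrict (unitBall d)) :=
  ⟨by rw [Measure.restrict_apply_univ]; exact (isCompact_closedBall _ _).measure_lt_top⟩

section Hoelder

variable {Ω : Type*} [MeasurableSpace Ω] {ν : Measure Ω} [IsFiniteMeasure ν] {x y : Ω → ℝ}

theorem integral_le_cube_root {C : ℝ} (hx : Measurable x) (hx0 : ∀ ω, 0 ≤ x ω)
    (hxC : ∀ ω, x ω ≤ C) :
    ∫ ω, x ω ∂ν ≤ (ν.real Set.univ) ^ (2 / 3 : ℝ) * (∫ ω, x ω ^ 3 ∂ν) ^ (1 / 3 : ℝ) := by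
  have hpq : (3 : ℝ).HolderConjugate (3 / 2) := by constructor <;> norm_num
  have h := integral_mul_le_Lp_mul_Lq_of_nonneg hpq (μ := ν) (f := x) (g := fun _ => 1)
    (Eventually.of_forall hx0) (Eventually.of_forall fun _ => zero_le_one)
    (MemLp.of_bound hx.aestronglyMeasurable C (Eventually.of_forall fun ω => by
      rw [Real.norm_of_nonneg (hx0 ω)]; exact hxC ω)) (memLp_const _)
  simp only [mul_one, Real.one_rpow, integral_const, smul_eq_mul] at h
  have h5 : ∫ ω, x ω ^ (3 : ℝ) ∂ν = ∫ ω, x ω ^ 3 ∂ν := by norm_cast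
  have h6 : (1 / (3 / 2) : ℝ) = 2 / 3 := by norm_num
  rwa [h5, h6, mul_comm] at h

/-- Hölder with exponents 3 and 3/2, then the L^(3/2) norm of y is raised to its L³ norm on the
finite measure space. -/
theorem integral_mul_le_cube_root {C : ℝ} (hx : Measurable x) (hx0 : ∀ ω, 0 ≤ x ω)
    (hxC : ∀ ω, x ω ≤ C) (hy : Measurable y) (hy0 : ∀ ω, 0 ≤ y ω) (hyC : ∀ ω, y ω ≤ C) :
    ∫ ω, x ω * y ω ∂ν ≤ (ν.real Set.univ) ^ (1 / 3 : ℝ) *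
      ((∫ ω, x ω ^ 3 ∂ν) ^ (1 / 3 : ℝ) * (∫ ω, y ω ^ 3 ∂ν) ^ (1 / 3 : ℝ)) := by
  have hpq : (3 : ℝ).HolderConjugate (3 / 2) := by constructor <;> norm_num
  have h := integral_mul_le_Lp_mul_Lq_of_nonneg hpq (μ := ν) (f := x) (g := y)
    (Eventually.of_forall hx0) (Eventually.of_forall hy0)
    (MemLp.of_bound hx.aestronglyMeasurable C (Eventually.of_forall fun ω => by
      rw [Real.norm_of_nonneg (hx0 ω)]; exact hxC ω))
    (MemLp.of_bound hy.aestronglyMeasurable C (Eventually.of_forall fun ω => by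
      rw [Real.norm_of_nonneg (hy0 ω)]; exact hyC ω))
  have h2 := integral_mul_le_Lp_mul_Lq_of_nonneg Real.HolderConjugate.two_two (μ := ν)
    (f := fun ω => y ω ^ (3 / 2 : ℝ)) (g := fun _ => 1)
    (Eventually.of_forall fun ω => Real.rpow_nonneg (hy0 ω) _)
    (Eventually.of_forall fun _ => zero_le_one)
    (MemLp.of_bound (hy.pow_const _).aestronglyMeasurable (C ^ (3 / 2 : ℝ))
      (Eventually.of_forall fun ω => by
        rw [Real.norm_of_nonneg (Real.rpow_nonneg (hy0 ω) _)]
        exact Real.rpow_le_rpow (hy0 ω) (hyC ω) (by norm_num))) (memLp_const _)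
  simp only [mul_one, Real.one_rpow, integral_const, smul_eq_mul] at h2
  have h3 : ∀ ω, (y ω ^ (3 / 2 : ℝ)) ^ (2 : ℝ) = y ω ^ 3 := fun ω => by
    rw [← Real.rpow_mul (hy0 ω), ← Real.rpow_natCast]; norm_num
  simp only [h3] at h2
  have hY : 0 ≤ ∫ ω, y ω ^ 3 ∂ν := integral_nonneg fun ω => pow_nonneg (hy0 ω) 3
  have hX : 0 ≤ ∫ ω, x ω ^ 3 ∂ν := integral_nonneg fun ω => pow_nonneg (hx0 ω) 3
  have h4 : (∫ ω, y ω ^ (3 / 2 : ℝ) ∂ν) ^ (1 / (3 / 2) : ℝ) ≤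
      (∫ ω, y ω ^ 3 ∂ν) ^ (1 / 3 : ℝ) * (ν.real Set.univ) ^ (1 / 3 : ℝ) := by
    refine (Real.rpow_le_rpow (integral_nonneg fun ω => Real.rpow_nonneg (hy0 ω) _) h2
      (by norm_num)).trans_eq ?_
    rw [Real.mul_rpow (Real.rpow_nonneg hY _) (Real.rpow_nonneg measureReal_nonneg _),
      ← Real.rpow_mul hY, ← Real.rpow_mul measureReal_nonneg]
    norm_num
  have h5 : ∫ ω, x ω ^ (3 : ℝ) ∂ν = ∫ ω, x ω ^ 3 ∂ν := by norm_cast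
  rw [h5] at h
  calc _ ≤ _ := h
    _ ≤ (∫ ω, x ω ^ 3 ∂ν) ^ (1 / 3 : ℝ) *
        ((∫ ω, y ω ^ 3 ∂ν) ^ (1 / 3 : ℝ) * (ν.real Set.univ) ^ (1 / 3 : ℝ)) :=
      mul_le_mul_of_nonneg_left h4 (Real.rpow_nonneg hX _)
    _ = _ := by ring

end Hoelder

variable {F₁ F₂ : Type*} [NormedAddCommGroup F₁] [MeasurableSpace F₁] [BorelSpace F₁]
  [SecondCountableTopology F₁] [NormedAddCommGroup F₂] [MeasurableSpace F₂] [BorelSpace F₂]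
  [SecondCountableTopology F₂]

/-- The `L³`-mean oscillation of `w` at scale `ε`. -/
noncomputable def osc {F : Type*} [NormedAddCommGroup F] (w : SpaceTime d → F) (ε : ℝ)
    (z : SpaceTime d) : ℝ :=
  (∫ ξ in unitBall d, ‖w (z - cover (ε • ξ)) - w z‖ ^ 3) ^ (1 / 3 : ℝ)

theorem osc_nonneg {F : Type*} [NormedAddCommGroup F] (w : SpaceTime d → F) (ε : ℝ)
    (z : SpaceTime d) : 0 ≤ osc w ε z :=
  Real.rpow_nonneg (integral_nonneg fun _ => by positivity) _

theorem osc_pow {F : Type*} [NormedAddCommGroup F] (w : SpaceTime d → F) (ε : ℝ)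
    (z : SpaceTime d) : osc w ε z ^ 3 =
      ∫ ξ in unitBall d, ‖w (z - cover (ε • ξ)) - w z‖ ^ 3 := by
  rw [osc, ← Real.rpow_natCast, ← Real.rpow_mul (integral_nonneg fun _ => by positivity)]
  norm_num

/-- Bounded measurable maps into normed groups. -/
structure BMV {F : Type*} [NormedAddCommGroup F] [MeasurableSpace F] (w : SpaceTime d → F) :
    Prop where
  measurable : Measurable w
  bdd : ∃ C, ∀ z, ‖w z‖ ≤ C

theorem BMV.measurable_modulus {w : SpaceTime d → F₁} (hw : BMV w) (ε : ℝ) (z : SpaceTime d) :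
    Measurable fun ξ : ℝ × Vec d => ‖w (z - cover (ε • ξ)) - w z‖ :=
  ((hw.1.comp (measurable_const.sub (continuous_cover.comp (by fun_prop)).measurable)).sub
    measurable_const).norm

theorem BMV.exists_modulus_le {w : SpaceTime d → F₁} (hw : BMV w) :
    ∃ C, ∀ z z', ‖w z' - w z‖ ≤ C := by
  obtain ⟨C, hC⟩ := hw.bdd
  exact ⟨C + C, fun z z' => (norm_sub_le _ _).trans (add_le_add (hC z') (hC z))⟩

/-- The increments of `f` are dominated by those of `u` and `w`. -/
structure Dom (u : SpaceTime d → F₁) (w : SpaceTime d → F₂) (a b : ℝ) (f : SpaceTime d → ℝ) :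
    Prop where
  bmv_u : BMV u
  bmv_w : BMV w
  bm : BM f
  left_nonneg : 0 ≤ a
  right_nonneg : 0 ≤ b
  le : ∀ z z', |f z' - f z| ≤ a * ‖u z' - u z‖ + b * ‖w z' - w z‖

/-- The weighted mean oscillation. -/
noncomputable def osc₂ (u : SpaceTime d → F₁) (w : SpaceTime d → F₂) (a b ε : ℝ)
    (z : SpaceTime d) : ℝ := a * osc u ε z + b * osc w ε z

variable {u : SpaceTime d → F₁} {w : SpaceTime d → F₂} {f g : SpaceTime d → ℝ} {a b a' b' : ℝ}

theorem Dom.osc₂_nonneg (hf : Dom u w a b f) (ε : ℝ) (z : SpaceTime d) : 0 ≤ osc₂ u w a b ε z :=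
  add_nonneg (mul_nonneg hf.left_nonneg (osc_nonneg _ _ _))
    (mul_nonneg hf.right_nonneg (osc_nonneg _ _ _))

theorem Dom.mul (hf : Dom u w a b f) (hg : Dom u w a' b' g) {C : ℝ} (hC : ∀ z, |f z| ≤ C)
    (hC' : ∀ z, |g z| ≤ C) :
    Dom u w (C * (a + a')) (C * (b + b')) (fun z => f z * g z) := by
  have hC0 : 0 ≤ C := (abs_nonneg _).trans (hC 0)
  refine ⟨hf.1, hf.2, hf.bm.mul hg.bm, mul_nonneg hC0 (add_nonneg hf.4 hg.4),
    mul_nonneg hC0 (add_nonneg hf.5 hg.5), fun z z' => ?_⟩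
  have h1 : f z' * g z' - f z * g z = (f z' - f z) * g z' + f z * (g z' - g z) := by ring
  rw [h1]
  refine (abs_add_le _ _).trans ?_
  rw [abs_mul, abs_mul]
  have h2 := mul_le_mul (hf.le z z') (hC' z') (abs_nonneg _) ((abs_nonneg _).trans (hf.le z z'))
  have h3 := mul_le_mul (hC z) (hg.le z z') (abs_nonneg _) hC0
  linarith

theorem Dom.exists_comp (hf : Dom u w a b f) {Φ : ℝ → ℝ} (hΦ : ContDiff ℝ 1 Φ) :
    ∃ L, 0 ≤ L ∧ Dom u w (L * a) (L * b) (fun z => Φ (f z)) := by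
  obtain ⟨C, hC⟩ := hf.bm.bdd
  obtain ⟨L, hL0, hL⟩ := exists_lipschitz_bound hΦ C
  refine ⟨L, hL0, hf.1, hf.2, hf.bm.comp hΦ.continuous, mul_nonneg hL0 hf.4,
    mul_nonneg hL0 hf.5, fun z z' => (hL _ _ (hC z') (hC z)).trans ?_⟩
  have := mul_le_mul_of_nonneg_left (hf.le z z') hL0
  linarith

/-- The kernel is bounded and lives on the unit ball, so Hölder trades the mean of the increments
for their L³ mean, the quantity that Besov regularity controls. -/
theorem Dom.abs_integral_le (k : ℝ × Vec d → ℝ) {M : ℝ} (hk : IsKernel k) (hM : ∀ ξ, |k ξ| ≤ M)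
    (hf : Dom u w a b f) (ε : ℝ) (z : SpaceTime d) :
    |∫ ξ, k ξ * (f (z - cover (ε • ξ)) - f z)| ≤
      M * (volume.real (unitBall d)) ^ (2 / 3 : ℝ) * osc₂ u w a b ε z := by
  have hM0 : 0 ≤ M := (abs_nonneg _).trans (hM 0)
  obtain ⟨Cu, hCu⟩ := hf.bmv_u.exists_modulus_le
  obtain ⟨Cw, hCw⟩ := hf.bmv_w.exists_modulus_le
  have mu := hf.bmv_u.measurable_modulus ε z
  have mw := hf.bmv_w.measurable_modulus ε z
  have iu : Integrable (fun ξ : ℝ × Vec d => ‖u (z - cover (ε • ξ)) - u z‖)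
      (volume.restrict (unitBall d)) :=
    Integrable.of_bound mu.aestronglyMeasurable Cu (Eventually.of_forall fun ξ => by
      rw [norm_norm]; exact hCu _ _)
  have iw : Integrable (fun ξ : ℝ × Vec d => ‖w (z - cover (ε • ξ)) - w z‖)
      (volume.restrict (unitBall d)) :=
    Integrable.of_bound mw.aestronglyMeasurable Cw (Eventually.of_forall fun ξ => by
      rw [norm_norm]; exact hCw _ _)
  have hset : ∫ ξ, k ξ * (f (z - cover (ε • ξ)) - f z) =
      ∫ ξ in unitBall d, k ξ * (f (z - cover (ε • ξ)) - f z) :=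
    (setIntegral_eq_integral_of_forall_compl_eq_zero fun ξ hξ => by
      rw [hk.eq_zero ξ hξ, zero_mul]).symm
  rw [hset]
  have hbound : ∀ ξ, ‖k ξ * (f (z - cover (ε • ξ)) - f z)‖ ≤
      M * (a * ‖u (z - cover (ε • ξ)) - u z‖ + b * ‖w (z - cover (ε • ξ)) - w z‖) := fun ξ => by
    rw [norm_mul]
    exact mul_le_mul (hM ξ) (hf.le _ _) (norm_nonneg _) hM0
  refine (norm_integral_le_of_norm_le (((iu.const_mul a).add (iw.const_mul b)).const_mul M)
    (Eventually.of_forall hbound)).trans ?_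
  simp only [Pi.add_apply]
  rw [integral_const_mul, integral_add (iu.const_mul a) (iw.const_mul b), integral_const_mul,
    integral_const_mul, mul_assoc]
  refine mul_le_mul_of_nonneg_left ?_ hM0
  have h1 := integral_le_cube_root (ν := volume.restrict (unitBall d)) mu
    (fun _ => norm_nonneg _) (fun ξ => hCu _ _)
  have h2 := integral_le_cube_root (ν := volume.restrict (unitBall d)) mw
    (fun _ => norm_nonneg _) (fun ξ => hCw _ _)
  rw [measureReal_restrict_apply_univ] at h1 h2
  have h3 := add_le_add (mul_le_mul_of_nonneg_left h1 hf.4) (mul_le_mul_of_nonneg_left h2 hf.5)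
  refine h3.trans_eq ?_
  simp only [osc₂, osc]
  ring

theorem Dom.abs_integral_mul_le (k : ℝ × Vec d → ℝ) {M : ℝ} (hk : IsKernel k)
    (hM : ∀ ξ, |k ξ| ≤ M) (hf : Dom u w a b f) (hg : Dom u w a' b' g) (ε : ℝ) (z : SpaceTime d) :
    ∫ ξ, |k ξ * ((f (z - cover (ε • ξ)) - f z) * (g (z - cover (ε • ξ)) - g z))| ≤
      M * (volume.real (unitBall d)) ^ (1 / 3 : ℝ) * (osc₂ u w a b ε z * osc₂ u w a' b' ε z) := by
  have hM0 : 0 ≤ M := (abs_nonneg _).trans (hM 0)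
  obtain ⟨Cu, hCu⟩ := hf.bmv_u.exists_modulus_le
  obtain ⟨Cw, hCw⟩ := hf.bmv_w.exists_modulus_le
  set x : ℝ × Vec d → ℝ := fun ξ => ‖u (z - cover (ε • ξ)) - u z‖ with hx
  set y : ℝ × Vec d → ℝ := fun ξ => ‖w (z - cover (ε • ξ)) - w z‖ with hy
  have mu : Measurable x := hf.bmv_u.measurable_modulus ε z
  have mw : Measurable y := hf.bmv_w.measurable_modulus ε z
  have hx0 : ∀ ξ, 0 ≤ x ξ := fun ξ => norm_nonneg _
  have hy0 : ∀ ξ, 0 ≤ y ξ := fun ξ => norm_nonneg _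
  have hxC : ∀ ξ, x ξ ≤ max Cu Cw := fun ξ => (hCu _ _).trans (le_max_left _ _)
  have hyC : ∀ ξ, y ξ ≤ max Cu Cw := fun ξ => (hCw _ _).trans (le_max_right _ _)
  have hi : ∀ {p q : ℝ × Vec d → ℝ}, Measurable p → Measurable q → (∀ ξ, 0 ≤ p ξ) →
      (∀ ξ, 0 ≤ q ξ) → (∀ ξ, p ξ ≤ max Cu Cw) → (∀ ξ, q ξ ≤ max Cu Cw) →
      Integrable (fun ξ => p ξ * q ξ) (volume.restrict (unitBall d)) := by
    intro p q hp hq hp0 hq0 hpC hqC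
    refine Integrable.of_bound (hp.mul hq).aestronglyMeasurable (max Cu Cw * max Cu Cw)
      (Eventually.of_forall fun ξ => ?_)
    rw [Real.norm_of_nonneg (mul_nonneg (hp0 ξ) (hq0 ξ))]
    exact mul_le_mul (hpC ξ) (hqC ξ) (hq0 ξ) ((hp0 ξ).trans (hpC ξ))
  have ixx := hi mu mu hx0 hx0 hxC hxC
  have ixy := hi mu mw hx0 hy0 hxC hyC
  have iyy := hi mw mw hy0 hy0 hyC hyC
  have hset : ∫ ξ, |k ξ * ((f (z - cover (ε • ξ)) - f z) * (g (z - cover (ε • ξ)) - g z))| =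
      ∫ ξ in unitBall d,
        |k ξ * ((f (z - cover (ε • ξ)) - f z) * (g (z - cover (ε • ξ)) - g z))| :=
    (setIntegral_eq_integral_of_forall_compl_eq_zero fun ξ hξ => by
      rw [hk.eq_zero ξ hξ, zero_mul, abs_zero]).symm
  rw [hset]
  set G : ℝ × Vec d → ℝ := fun ξ => M * (a * a' * (x ξ * x ξ) + (a * b' + b * a') * (x ξ * y ξ) +
    b * b' * (y ξ * y ξ)) with hG
  have hGi : Integrable G (volume.restrict (unitBall d)) :=
    (((ixx.const_mul _).add (ixy.const_mul _)).add (iyy.const_mul _)).const_mul M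
  have hbound : ∀ ξ, |k ξ * ((f (z - cover (ε • ξ)) - f z) * (g (z - cover (ε • ξ)) - g z))| ≤
      G ξ := fun ξ => by
    rw [abs_mul, abs_mul]
    have h1 := mul_le_mul (hf.le z (z - cover (ε • ξ))) (hg.le z (z - cover (ε • ξ)))
      (abs_nonneg _) ((abs_nonneg _).trans (hf.le z (z - cover (ε • ξ))))
    refine (mul_le_mul (hM ξ) h1 (by positivity) hM0).trans_eq ?_
    simp only [hG, hx, hy]
    ring
  refine (integral_mono_of_nonneg (Eventually.of_forall fun ξ => abs_nonneg _) hGi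
    (Eventually.of_forall hbound)).trans ?_
  have e1 : ∫ ξ in unitBall d, G ξ = M * (a * a' * (∫ ξ in unitBall d, x ξ * x ξ) +
      (a * b' + b * a') * (∫ ξ in unitBall d, x ξ * y ξ) +
      b * b' * (∫ ξ in unitBall d, y ξ * y ξ)) := by
    have i1 : Integrable (fun ξ => a * a' * (x ξ * x ξ) + (a * b' + b * a') * (x ξ * y ξ))
      (volume.restrict (unitBall d)) := (ixx.const_mul _).add (ixy.const_mul _)
    rw [hG, integral_const_mul, integral_add i1 (iyy.const_mul _), integral_add (ixx.const_mul _) (ixy.const_mul _), integral_const_mul,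
      integral_const_mul, integral_const_mul]
  rw [e1, mul_assoc M]
  refine mul_le_mul_of_nonneg_left ?_ hM0
  have h1 := integral_mul_le_cube_root (ν := volume.restrict (unitBall d)) mu hx0 hxC mu hx0 hxC
  have h2 := integral_mul_le_cube_root (ν := volume.restrict (unitBall d)) mu hx0 hxC mw hy0 hyC
  have h3 := integral_mul_le_cube_root (ν := volume.restrict (unitBall d)) mw hy0 hyC mw hy0 hyC
  rw [measureReal_restrict_apply_univ] at h1 h2 h3
  have ha := hf.left_nonneg
  have hb := hf.right_nonneg
  have ha' := hg.left_nonneg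
  have hb' := hg.right_nonneg
  have h4 := add_le_add (add_le_add (mul_le_mul_of_nonneg_left h1 (mul_nonneg ha ha'))
    (mul_le_mul_of_nonneg_left h2 (by positivity : 0 ≤ a * b' + b * a')))
    (mul_le_mul_of_nonneg_left h3 (mul_nonneg hb hb'))
  refine h4.trans_eq ?_
  simp only [osc₂, osc, hx, hy]
  ring

/-- A bound for the mollifier. -/
theorem exists_eta_le (d : ℕ) : ∃ M, ∀ ξ : ℝ × Vec d, |eta ξ| ≤ M :=
  isKernel_eta.continuous.bounded_above_of_compact_support isKernel_eta.hasCompactSupport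

theorem mol_sub_eq (ε : ℝ) (hf : BM f) (z : SpaceTime d) :
    mol ε f z - f z = ∫ ξ, eta ξ * (f (z - cover (ε • ξ)) - f z) := by
  have h := mol_sub ε hf (BM.const (f z)) z
  rw [mol_const] at h
  rw [← h]
  rfl

theorem exists_abs_mol_sub_le (d : ℕ) : ∃ K, 0 ≤ K ∧
    ∀ (u : SpaceTime d → F₁) (w : SpaceTime d → F₂) (f : SpaceTime d → ℝ) (a b : ℝ),
      Dom u w a b f → ∀ ε z, |mol ε f z - f z| ≤ K * osc₂ u w a b ε z := by
  obtain ⟨M, hM⟩ := exists_eta_le d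
  have hM0 : 0 ≤ M := (abs_nonneg _).trans (hM 0)
  refine ⟨M * (volume.real (unitBall d)) ^ (2 / 3 : ℝ), by positivity,
    fun u w f a b hf ε z => ?_⟩
  rw [mol_sub_eq ε hf.bm]
  exact hf.abs_integral_le eta isKernel_eta hM ε z

/-- Differentiate the mollified constant 1. The vanishing mean permits f(z) to be subtracted inside
the derivative of a mollification, so that only increments of f remain. -/
theorem kav_deta_const (v : ℝ × Vec d) : ∫ ξ, deta v ξ = 0 := by
  have h1 := pd_mol one_pos (BM.const (d := d) 1) v 0
  have h2 : mol 1 (fun _ : SpaceTime d => (1 : ℝ)) = fun _ => 1 := funext (mol_const 1 1)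
  rw [h2, pd_const] at h1
  simpa [kav] using h1.symm

/-- A derivative costs one factor ε⁻¹ but gains one oscillation, by the vanishing mean of its
kernel. -/
theorem exists_abs_pd_mol_le (v : ℝ × Vec d) : ∃ K, 0 ≤ K ∧
    ∀ (u : SpaceTime d → F₁) (w : SpaceTime d → F₂) (f : SpaceTime d → ℝ) (a b : ℝ),
      Dom u w a b f → ∀ ε > 0, ∀ z, |pd v (mol ε f) z| ≤ ε⁻¹ * (K * osc₂ u w a b ε z) := by
  obtain ⟨M, hM⟩ := (isKernel_deta v).continuous.bounded_above_of_compact_support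
    (isKernel_deta v).hasCompactSupport
  have hM0 : 0 ≤ M := (norm_nonneg _).trans (hM 0)
  refine ⟨M * (volume.real (unitBall d)) ^ (2 / 3 : ℝ), by positivity,
    fun u w f a b hf ε hε z => ?_⟩
  have h1 : kav (deta v) ε f z = ∫ ξ, deta v ξ * (f (z - cover (ε • ξ)) - f z) := by
    simp only [mul_sub]
    rw [integral_sub (integrable_kernel_mul (isKernel_deta v).integrable hf.bm ε z)
      ((isKernel_deta v).integrable.mul_const _), integral_mul_const, kav_deta_const, zero_mul,
      sub_zero]
    rfl
  rw [pd_mol hε hf.bm, abs_mul, abs_of_pos (inv_pos.2 hε), h1]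
  exact mul_le_mul_of_nonneg_left (hf.abs_integral_le _ (isKernel_deta v) hM ε z)
    (inv_pos.2 hε).le

/-- The commutator equals the mollifier average of the product of the two increments, minus the
product of the two mollification errors. Both are quadratic in the oscillations. -/
theorem exists_abs_mol_mul_sub_le (d : ℕ) : ∃ K, 0 ≤ K ∧
    ∀ (u : SpaceTime d → F₁) (w : SpaceTime d → F₂) (f g : SpaceTime d → ℝ) (a b a' b' : ℝ),
      Dom u w a b f → Dom u w a' b' g → ∀ ε z,
      |mol ε (fun z => f z * g z) z - mol ε f z * mol ε g z| ≤
        K * (osc₂ u w a b ε z * osc₂ u w a' b' ε z) := by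
  obtain ⟨M, hM⟩ := exists_eta_le d
  have hM0 : 0 ≤ M := (abs_nonneg _).trans (hM 0)
  obtain ⟨K, hK0, hK⟩ := exists_abs_mol_sub_le (F₁ := F₁) (F₂ := F₂) d
  refine ⟨M * (volume.real (unitBall d)) ^ (1 / 3 : ℝ) + K * K, by positivity,
    fun u w f g a b a' b' hf hg ε z => ?_⟩
  have h1 : mol ε (fun z => f z * g z) z - mol ε f z * mol ε g z =
      (∫ ξ, eta ξ * ((f (z - cover (ε • ξ)) - f z) * (g (z - cover (ε • ξ)) - g z))) -
        (mol ε f z - f z) * (mol ε g z - g z) := by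
    have e : ∀ ξ : ℝ × Vec d,
        eta ξ * ((f (z - cover (ε • ξ)) - f z) * (g (z - cover (ε • ξ)) - g z)) =
        eta ξ * (f (z - cover (ε • ξ)) * g (z - cover (ε • ξ))) - g z * (eta ξ * f (z - cover (ε • ξ)))
          - (f z * (eta ξ * g (z - cover (ε • ξ))) - f z * g z * eta ξ) := fun ξ => by ring
    have i1 := integrable_kernel_mul isKernel_eta.integrable (hf.bm.mul hg.bm) ε z
    have i2 := (integrable_kernel_mul isKernel_eta.integrable hf.bm ε z).const_mul (g z)
    have i3 := (integrable_kernel_mul isKernel_eta.integrable hg.bm ε z).const_mul (f z)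
    have i4 := (isKernel_eta (d := d)).integrable.const_mul (f z * g z)
    have i12 : Integrable fun ξ : ℝ × Vec d => eta ξ * (f (z - cover (ε • ξ)) *
      g (z - cover (ε • ξ))) - g z * (eta ξ * f (z - cover (ε • ξ))) := i1.sub i2
    have i34 : Integrable fun ξ : ℝ × Vec d => f z * (eta ξ * g (z - cover (ε • ξ))) -
      f z * g z * eta ξ := i3.sub i4
    simp only [e]
    rw [integral_sub i12 i34, integral_sub i1 i2, integral_sub i3 i4,
      integral_const_mul, integral_const_mul, integral_const_mul, integral_eta]
    simp only [mol, kav]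
    ring
  rw [h1, add_mul]
  refine (abs_sub _ _).trans (add_le_add ?_ ?_)
  · exact (norm_integral_le_integral_norm
      (fun ξ => eta ξ * ((f (z - cover (ε • ξ)) - f z) * (g (z - cover (ε • ξ)) - g z)))).trans
      (hf.abs_integral_mul_le eta isKernel_eta hM hg ε z)
  · rw [abs_mul]
    refine (mul_le_mul (hK _ _ _ _ _ hf ε z) (hK _ _ _ _ _ hg ε z) (abs_nonneg _)
      (mul_nonneg hK0 (hf.osc₂_nonneg ε z))).trans_eq ?_
    ring

theorem exists_taylor_bound {Φ : ℝ → ℝ} (hΦ : ContDiff ℝ 2 Φ) (C : ℝ) :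
    ∃ L, 0 ≤ L ∧ ∀ x y, |x| ≤ C → |y| ≤ C → |Φ x - Φ y - deriv Φ y * (x - y)| ≤ L * |x - y| ^ 2 := by
  have h1 : ContDiff ℝ 1 (deriv Φ) := by
    have : ContDiff ℝ (1 + 1) Φ := by rwa [one_add_one_eq_two]
    exact (contDiff_succ_iff_deriv.1 this).2.2
  obtain ⟨L, hL0, hL⟩ := exists_lipschitz_bound h1 C
  refine ⟨L, hL0, fun x y hx hy => ?_⟩
  have hd : ∀ t ∈ Set.uIcc y x, HasDerivWithinAt (fun t => Φ t - deriv Φ y * t)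
      (deriv Φ t - deriv Φ y) (Set.uIcc y x) t := fun t _ => by
    have h2 := ((hΦ.differentiable (by norm_num) t).hasDerivAt.fun_sub
      ((hasDerivAt_id' t).const_mul (deriv Φ y))).hasDerivWithinAt (s := Set.uIcc y x)
    rwa [mul_one] at h2
  have hb : ∀ t ∈ Set.uIcc y x, ‖deriv Φ t - deriv Φ y‖ ≤ L * |x - y| := fun t ht => by
    have h3 : |t| ≤ C := by
      have := Set.uIcc_subset_Icc (a₂ := -C) (b₂ := C) (abs_le.1 hy) (abs_le.1 hx) ht
      exact abs_le.2 this
    refine (hL t y h3 hy).trans (mul_le_mul_of_nonneg_left ?_ hL0)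
    exact Set.abs_sub_left_of_mem_uIcc ht
  have h4 := (convex_uIcc y x).norm_image_sub_le_of_norm_hasDerivWithin_le hd hb
    Set.left_mem_uIcc Set.right_mem_uIcc
  calc _ = ‖Φ x - deriv Φ y * x - (Φ y - deriv Φ y * y)‖ := by
        rw [Real.norm_eq_abs]; congr 1; ring
    _ ≤ _ := h4
    _ = _ := by rw [Real.norm_eq_abs]; ring

/-- Expand Φ to first order at f(z), both inside the average and at the mollified value. The linear
terms cancel, and the two Taylor remainders are quadratic. -/
theorem Dom.exists_abs_mol_comp_sub_le (hf : Dom u w a b f) {Φ : ℝ → ℝ} (hΦ : ContDiff ℝ 2 Φ) :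
    ∃ K, 0 ≤ K ∧ ∀ ε z, |mol ε (fun z => Φ (f z)) z - Φ (mol ε f z)| ≤
      K * (osc₂ u w a b ε z * osc₂ u w a b ε z) := by
  obtain ⟨M, hM⟩ := exists_eta_le d
  have hM0 : 0 ≤ M := (abs_nonneg _).trans (hM 0)
  obtain ⟨K, hK0, hK⟩ := exists_abs_mol_sub_le (F₁ := F₁) (F₂ := F₂) d
  obtain ⟨C, hC⟩ := hf.bm.bdd
  obtain ⟨L, hL0, hL⟩ := exists_taylor_bound hΦ C
  refine ⟨L * (M * (volume.real (unitBall d)) ^ (1 / 3 : ℝ)) + L * (K * K), by positivity,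
    fun ε z => ?_⟩
  have hΦf : BM fun z => Φ (f z) := hf.bm.comp hΦ.continuous
  set R : ℝ × Vec d → ℝ := fun ξ => Φ (f (z - cover (ε • ξ))) - Φ (f z) -
    deriv Φ (f z) * (f (z - cover (ε • ξ)) - f z) with hR
  have i1 : Integrable fun ξ : ℝ × Vec d => eta ξ * (Φ (f (z - cover (ε • ξ))) - Φ (f z)) :=
    integrable_kernel_mul isKernel_eta.integrable (hΦf.sub (BM.const (Φ (f z)))) ε z
  have i2 : Integrable fun ξ : ℝ × Vec d => eta ξ * (f (z - cover (ε • ξ)) - f z) :=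
    integrable_kernel_mul isKernel_eta.integrable (hf.bm.sub (BM.const (f z))) ε z
  have i3 : Integrable fun ξ : ℝ × Vec d =>
      |eta ξ * ((f (z - cover (ε • ξ)) - f z) * (f (z - cover (ε • ξ)) - f z))| :=
    (integrable_kernel_mul isKernel_eta.integrable ((hf.bm.sub (BM.const (f z))).mul
      (hf.bm.sub (BM.const (f z)))) ε z).abs
  have h1 : mol ε (fun z => Φ (f z)) z - Φ (mol ε f z) = (∫ ξ, eta ξ * R ξ) -
      (Φ (mol ε f z) - Φ (f z) - deriv Φ (f z) * (mol ε f z - f z)) := by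
    have e : ∀ ξ, eta ξ * R ξ = eta ξ * (Φ (f (z - cover (ε • ξ))) - Φ (f z)) -
        deriv Φ (f z) * (eta ξ * (f (z - cover (ε • ξ)) - f z)) := fun ξ => by
      simp only [hR]; ring
    simp only [e]
    rw [integral_sub i1 (i2.const_mul _), integral_const_mul, ← mol_sub_eq ε hf.bm,
      ← mol_sub_eq ε hΦf]
    ring
  rw [h1, add_mul]
  refine (abs_sub _ _).trans (add_le_add ?_ ?_)
  · have h2 : ‖∫ ξ, eta ξ * R ξ‖ ≤ ∫ ξ : ℝ × Vec d,
        L * |eta ξ * ((f (z - cover (ε • ξ)) - f z) * (f (z - cover (ε • ξ)) - f z))| := by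
      refine norm_integral_le_of_norm_le (i3.const_mul L) (Eventually.of_forall fun ξ => ?_)
      rw [norm_mul, Real.norm_eq_abs, Real.norm_eq_abs, abs_mul, abs_mul, ← sq]
      have := mul_le_mul_of_nonneg_left (hL (f (z - cover (ε • ξ))) (f z) (hC _) (hC _))
        (abs_nonneg (eta ξ))
      refine this.trans_eq ?_
      ring
    rw [integral_const_mul] at h2
    refine h2.trans ?_
    rw [mul_assoc L]
    exact mul_le_mul_of_nonneg_left (hf.abs_integral_mul_le eta isKernel_eta hM hf ε z) hL0
  · refine (hL _ _ (abs_mol_le ε hC z) (hC z)).trans ?_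
    rw [mul_assoc L]
    refine mul_le_mul_of_nonneg_left ?_ hL0
    rw [sq]
    refine (mul_le_mul (hK _ _ _ _ _ hf ε z) (hK _ _ _ _ _ hf ε z) (abs_nonneg _)
      (mul_nonneg hK0 (hf.osc₂_nonneg ε z))).trans_eq ?_
    ring

end EulerKorteweg

/-! ### From Besov regularity to the vanishing of trilinear errors. -/

namespace EulerKorteweg

set_option linter.unusedSectionVars false

variable {d : ℕ} {T : ℝ}
variable {F₁ F₂ : Type*} [NormedAddCommGroup F₁] [MeasurableSpace F₁] [BorelSpace F₁]
  [SecondCountableTopology F₁] [NormedAddCommGroup F₂] [MeasurableSpace F₂] [BorelSpace F₂]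
  [SecondCountableTopology F₂]

/-- The closed time strip `[δ, T - δ] × 𝕋^d`. -/
abbrev strip (d : ℕ) (T δ : ℝ) : Set (SpaceTime d) := Set.Icc δ (T - δ) ×ˢ Set.univ

instance {δ : ℝ} : IsFiniteMeasure ((volume : Measure (SpaceTime d)).restrict (strip d T δ)) :=
  ⟨by rw [Measure.restrict_apply_univ]; exact (isCompact_Icc.prod isCompact_univ).measure_lt_top⟩

/-- The mean oscillation of `w` is of order `ε^α` in `L³`, away from the initial and final times. -/
def OscBound (T α : ℝ) {F : Type*} [NormedAddCommGroup F] (w : SpaceTime d → F) : Prop :=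
  ∃ C, 0 ≤ C ∧ ∀ δ ε, 0 < ε → ε < δ → ∫ z in strip d T δ, osc w ε z ^ 3 ≤ C * ε ^ (3 * α)

theorem BMV.integrable_modulus {w : SpaceTime d → F₁} (hw : BMV w) (ε δ : ℝ) :
    Integrable (Function.uncurry fun (z : SpaceTime d) (ξ : ℝ × Vec d) =>
      ‖w (z - cover (ε • ξ)) - w z‖ ^ 3)
      ((volume.restrict (strip d T δ)).prod (volume.restrict (unitBall d))) := by
  obtain ⟨C, hC⟩ := hw.exists_modulus_le
  have hshift : Measurable fun p : SpaceTime d × (ℝ × Vec d) => p.1 - cover (ε • p.2) :=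
    measurable_fst.sub ((continuous_cover.comp (by fun_prop : Continuous
      fun ξ : ℝ × Vec d => ε • ξ)).measurable.comp measurable_snd)
  refine Integrable.of_bound (C := C ^ 3) ?_ (Eventually.of_forall fun p => ?_)
  · exact ((((hw.1.comp hshift).sub (hw.1.comp measurable_fst)).norm).pow_const 3).aestronglyMeasurable
  · simp only [Function.uncurry]
    rw [norm_pow, norm_norm]
    exact pow_le_pow_left₀ (norm_nonneg _) (hC _ _) 3

theorem BMV.integrable_modulus_pow {w : SpaceTime d → F₁} (hw : BMV w) (ε : ℝ)
    (z : SpaceTime d) : Integrable (fun ξ : ℝ × Vec d => ‖w (z - cover (ε • ξ)) - w z‖ ^ 3)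
      (volume.restrict (unitBall d)) := by
  obtain ⟨C, hC⟩ := hw.exists_modulus_le
  refine Integrable.of_bound (C := C ^ 3)
    ((hw.measurable_modulus ε z).pow_const 3).aestronglyMeasurable
    (Eventually.of_forall fun ξ => ?_)
  rw [norm_pow, norm_norm]
  exact pow_le_pow_left₀ (norm_nonneg _) (hC _ _) 3

theorem BMV.integrable_osc_pow {w : SpaceTime d → F₁} (hw : BMV w) (ε δ : ℝ) :
    Integrable (fun z => osc w ε z ^ 3) (volume.restrict (strip d T δ)) := by
  simp only [osc_pow]
  exact (hw.integrable_modulus ε δ).integral_prod_left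

theorem shift_mem_domain {δ ε : ℝ} (hε : 0 < ε) (hδ : ε < δ) {ξ : ℝ × Vec d}
    (hξ : ξ ∈ unitBall d) {z : SpaceTime d} (hz : z ∈ strip d T δ) :
    z ∈ domain d T ∩ {z | z + cover (-(ε • ξ)) ∈ domain d T} := by
  have h1 : |ξ.1| ≤ 1 := (norm_fst_le ξ).trans (by simpa using hξ)
  have h2 : |ε * ξ.1| ≤ ε := by
    rw [abs_mul, abs_of_pos hε]; exact mul_le_of_le_one_right hε.le h1
  have h3 : (z + cover (-(ε • ξ))).1 = z.1 + -(ε * ξ.1) := rfl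
  have h4 := abs_le.1 h2
  have h5 := hz.1
  refine ⟨⟨⟨by linarith [h5.1], by linarith [h5.2]⟩, trivial⟩, ⟨⟨?_, ?_⟩, trivial⟩⟩
  · rw [h3]; linarith [h5.1]
  · rw [h3]; linarith [h5.2]

theorem MemBesov.exists_integral_modulus_le {α : ℝ} {w : SpaceTime d → F₁} (hw : BMV w)
    (hB : MemBesov T α 3 w) :
    ∃ A, 0 ≤ A ∧ ∀ δ ε, 0 < ε → ε < δ → ∀ ξ ∈ unitBall d,
      ∫ z in strip d T δ, ‖w (z - cover (ε • ξ)) - w z‖ ^ 3 ≤ A * ε ^ (3 * α) := by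
  set S := besovSeminorm T α 3 w with hS
  have hSt : S ≠ ∞ := hB.2.ne
  refine ⟨(2 ^ α * S.toReal) ^ 3, by positivity, fun δ ε hε hδ ξ hξ => ?_⟩
  -- The unit ball belongs to the maximum norm of the product, so the Euclidean length of εξ can
  -- reach √2·ε; the factor 2 leaves room.
  have hlen : shiftLength (-(ε • ξ)) ≤ 2 * ε := by
    have hn : ‖ξ‖ ≤ 1 := by simpa using hξ
    have h1 : |ξ.1| ≤ 1 := (norm_fst_le ξ).trans hn
    have h2 : ‖ξ.2‖ ≤ 1 := (norm_snd_le ξ).trans hn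
    rw [shiftLength, Real.sqrt_le_left (by positivity)]
    simp only [Prod.fst_neg, Prod.smul_fst, smul_eq_mul, Prod.snd_neg, Prod.smul_snd, norm_neg,
      norm_smul, Real.norm_eq_abs, abs_of_pos hε]
    have h3 : ξ.1 ^ 2 ≤ 1 := by rw [← sq_abs]; exact pow_le_one₀ (abs_nonneg _) h1
    have h4 : ‖ξ.2‖ ^ 2 ≤ 1 := pow_le_one₀ (norm_nonneg _) h2
    nlinarith [sq_nonneg ε]
  have h2ε : 0 < 2 * ε := by positivity
  have hsup : ENNReal.ofReal ((2 * ε) ^ (-α)) * eLpNorm (fun z => w (z + cover (-(ε • ξ))) - w z) 3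
      (volume.restrict (domain d T ∩ {z | z + cover (-(ε • ξ)) ∈ domain d T})) ≤ S := by
    rw [hS, besovSeminorm]
    refine le_trans (mul_le_mul_right ?_ _)
      (le_iSup₂ (f := fun (t : ℝ) (_ : 0 < t) => ENNReal.ofReal (t ^ (-α)) *
        ⨆ (ξ : ℝ × Vec d) (_ : shiftLength ξ ≤ t),
          eLpNorm (fun z => w (z + cover ξ) - w z) 3
            (volume.restrict (domain d T ∩ {z | z + cover ξ ∈ domain d T}))) (2 * ε) h2ε)
    exact le_iSup₂ (f := fun (ξ : ℝ × Vec d) (_ : shiftLength ξ ≤ 2 * ε) =>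
      eLpNorm (fun z => w (z + cover ξ) - w z) 3
        (volume.restrict (domain d T ∩ {z | z + cover ξ ∈ domain d T}))) _ hlen
  have hle : eLpNorm (fun z => w (z - cover (ε • ξ)) - w z) 3 (volume.restrict (strip d T δ)) ≤
      ENNReal.ofReal ((2 * ε) ^ α * S.toReal) := by
    have e1 : (fun z => w (z - cover (ε • ξ)) - w z) = fun z => w (z + cover (-(ε • ξ))) - w z := by
      ext z; rw [cover_neg, ← sub_eq_add_neg]
    rw [e1]
    refine (eLpNorm_mono_measure _ (Measure.restrict_mono_set _
      fun z hz => shift_mem_domain hε hδ hξ hz)).trans ?_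
    rw [ENNReal.ofReal_mul (by positivity), ENNReal.ofReal_toReal hSt]
    refine le_trans ?_ (mul_le_mul_right hsup _)
    rw [← mul_assoc, ← ENNReal.ofReal_mul (by positivity), ← Real.rpow_add h2ε]
    simp
  have hmeas : Measurable fun z => w (z - cover (ε • ξ)) - w z :=
    (hw.1.comp (measurable_id.sub measurable_const)).sub hw.1
  have h3 := eLpNorm_nnreal_pow_eq_lintegral (μ := volume.restrict (strip d T δ))
    (f := fun z => w (z - cover (ε • ξ)) - w z) (p := 3) (by norm_num)
  have hA0 : 0 ≤ (2 * ε) ^ α * S.toReal := by positivity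
  rw [integral_eq_lintegral_of_nonneg_ae (Eventually.of_forall fun z => by positivity)
    (hmeas.norm.pow_const 3).aestronglyMeasurable]
  have h4 : ∫⁻ z in strip d T δ, ENNReal.ofReal (‖w (z - cover (ε • ξ)) - w z‖ ^ 3) =
      eLpNorm (fun z => w (z - cover (ε • ξ)) - w z) 3 (volume.restrict (strip d T δ)) ^ 3 := by
    have h5 : ((3 : NNReal) : ℝ≥0∞) = 3 := by norm_num
    rw [h5] at h3
    have h6 : ((3 : NNReal) : ℝ) = ((3 : ℕ) : ℝ) := by norm_num
    simp only [h6, ENNReal.rpow_natCast] at h3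
    rw [h3]
    refine lintegral_congr fun z => ?_
    rw [ENNReal.ofReal_pow (norm_nonneg _), ofReal_norm]
  rw [h4]
  refine ENNReal.toReal_le_of_le_ofReal (by positivity) ((pow_le_pow_left₀ zero_le hle 3).trans_eq ?_)
  rw [← ENNReal.ofReal_pow hA0]
  congr 1
  rw [Real.mul_rpow (by norm_num) hε.le, mul_comm 3 α, Real.rpow_mul hε.le]
  have h7 : (ε ^ α) ^ (3 : ℝ) = (ε ^ α) ^ 3 := by norm_cast
  rw [h7]
  ring

/-- After Fubini, each fixed shift εξ is bounded by the Besov seminorm. The strip keeps z and its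
shift inside the domain. -/
theorem MemBesov.oscBound {α : ℝ} {w : SpaceTime d → F₁} (hw : BMV w)
    (hB : MemBesov T α 3 w) : OscBound T α w := by
  obtain ⟨A, hA0, hA⟩ := hB.exists_integral_modulus_le hw
  refine ⟨A * volume.real (unitBall d), by positivity, fun δ ε hε hδ => ?_⟩
  simp only [osc_pow]
  rw [integral_integral_swap (hw.integrable_modulus ε δ)]
  have h1 : ∫ ξ in unitBall d, ∫ z in strip d T δ, ‖w (z - cover (ε • ξ)) - w z‖ ^ 3 ≤
      ∫ _ξ in unitBall d, A * ε ^ (3 * α) :=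
    setIntegral_mono_on (hw.integrable_modulus ε δ).integral_prod_right (integrable_const _)
      Metric.isClosed_closedBall.measurableSet fun ξ hξ => hA δ ε hε hδ ξ hξ
  refine h1.trans_eq ?_
  rw [integral_const, measureReal_restrict_apply_univ, smul_eq_mul]
  ring

theorem BMV.prodMk {u : SpaceTime d → F₁} {w : SpaceTime d → F₂} (hu : BMV u) (hw : BMV w) :
    BMV fun z => (u z, w z) := by
  obtain ⟨C, hC⟩ := hu.bdd
  obtain ⟨D, hD⟩ := hw.bdd
  exact ⟨hu.1.prodMk hw.1, max C D, fun z => max_le_max (hC z) (hD z)⟩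

theorem OscBound.prodMk {α : ℝ} {u : SpaceTime d → F₁} {w : SpaceTime d → F₂} (hu : BMV u)
    (hw : BMV w) (h : OscBound T α u) (h' : OscBound T α w) :
    OscBound T α fun z => (u z, w z) := by
  obtain ⟨C, hC0, hC⟩ := h
  obtain ⟨D, hD0, hD⟩ := h'
  refine ⟨C + D, add_nonneg hC0 hD0, fun δ ε hε hδ => ?_⟩
  rw [add_mul]
  refine le_trans ?_ (add_le_add (hC δ ε hε hδ) (hD δ ε hε hδ))
  have i1 := hu.integrable_osc_pow (T := T) ε δ
  have i2 := hw.integrable_osc_pow (T := T) ε δ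
  rw [← integral_add i1 i2]
  refine integral_mono ((hu.prodMk hw).integrable_osc_pow ε δ) (i1.add i2) fun z => ?_
  simp only [osc_pow]
  have j1 := hu.integrable_modulus_pow ε z
  have j2 := hw.integrable_modulus_pow ε z
  rw [← integral_add j1 j2]
  refine integral_mono_of_nonneg (Eventually.of_forall fun ξ => by positivity) (j1.add j2)
    (Eventually.of_forall fun ξ => ?_)
  simp only [Prod.mk_sub_mk, Prod.norm_mk]
  rcases max_cases ‖u (z - cover (ε • ξ)) - u z‖ ‖w (z - cover (ε • ξ)) - w z‖ with h | h <;>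
    rw [h.1]
  · exact le_add_of_nonneg_right (by positivity)
  · exact le_add_of_nonneg_left (by positivity)

theorem mul_mul_le_add_cubes {x y : ℝ} (hx : 0 ≤ x) (hy : 0 ≤ y) :
    x ^ 3 + x ^ 2 * y + x * y ^ 2 ≤ 3 * (x ^ 3 + y ^ 3) := by
  nlinarith [mul_nonneg (add_nonneg hx hy) (sq_nonneg (x - y)), pow_nonneg hx 3, pow_nonneg hy 3]

/-- Rescale to A = ε^(-α)P and B = ε^(-β)Q. As ε ≤ 1 and β ≤ α, the monomials P³, P²Q, PQ² all carry
at least the power ε^(α+2β). A monomial Q³ would carry only ε^(3β) and has to be absent. -/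
theorem trilinear_le {α β ε P Q : ℝ} (hβα : β ≤ α) (hε : 0 < ε) (hε1 : ε ≤ 1) (hP : 0 ≤ P)
    (hQ : 0 ≤ Q) : ε⁻¹ * (P ^ 3 + P ^ 2 * Q + P * Q ^ 2) ≤
      3 * ε ^ (α + 2 * β - 1) * (ε ^ (-(3 * α)) * P ^ 3 + ε ^ (-(3 * β)) * Q ^ 3) := by
  set A := ε ^ (-α) * P
  set B := ε ^ (-β) * Q
  have hA : 0 ≤ A := by positivity
  have hB : 0 ≤ B := by positivity
  have hεα : 0 < ε ^ α := Real.rpow_pos_of_pos hε α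
  have hεβ : 0 < ε ^ β := Real.rpow_pos_of_pos hε β
  have hle : ε ^ α ≤ ε ^ β := Real.rpow_le_rpow_of_exponent_ge hε hε1 hβα
  have hPA : P = ε ^ α * A := by
    rw [← mul_assoc, ← Real.rpow_add hε]; simp
  have hQB : Q = ε ^ β * B := by
    rw [← mul_assoc, ← Real.rpow_add hε]; simp
  have hcube : ∀ s : ℝ, ε ^ (-(3 * s)) = (ε ^ (-s)) ^ 3 := fun s => by
    rw [← Real.rpow_natCast, ← Real.rpow_mul hε.le]; congr 1; push_cast; ring
  have hexp : ε ^ (α + 2 * β - 1) = ε ^ α * (ε ^ β) ^ 2 * ε⁻¹ := by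
    rw [Real.rpow_sub hε, Real.rpow_add hε, Real.rpow_one, mul_comm 2 β, Real.rpow_mul hε.le,
      Real.rpow_two, div_eq_mul_inv]
  have h1 : P ^ 3 + P ^ 2 * Q + P * Q ^ 2 ≤
      ε ^ α * (ε ^ β) ^ 2 * (A ^ 3 + A ^ 2 * B + A * B ^ 2) := by
    have e1 : (ε ^ α) ^ 3 ≤ ε ^ α * (ε ^ β) ^ 2 := by
      rw [pow_succ' (ε ^ α) 2]; exact mul_le_mul_of_nonneg_left (pow_le_pow_left₀ hεα.le hle 2) hεα.le
    have e2 : (ε ^ α) ^ 2 * ε ^ β ≤ ε ^ α * (ε ^ β) ^ 2 := by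
      rw [sq, sq, mul_assoc]
      exact mul_le_mul_of_nonneg_left (mul_le_mul_of_nonneg_right hle hεβ.le) hεα.le
    have f1 := mul_le_mul_of_nonneg_right e1 (by positivity : 0 ≤ A ^ 3)
    have f2 := mul_le_mul_of_nonneg_right e2 (by positivity : 0 ≤ A ^ 2 * B)
    have g1 : P ^ 3 = (ε ^ α) ^ 3 * A ^ 3 := by rw [hPA]; ring
    have g2 : P ^ 2 * Q = (ε ^ α) ^ 2 * ε ^ β * (A ^ 2 * B) := by rw [hPA, hQB]; ring
    have g3 : P * Q ^ 2 = ε ^ α * (ε ^ β) ^ 2 * (A * B ^ 2) := by rw [hPA, hQB]; ring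
    rw [g1, g2, g3]
    linarith
  have h2 : ε ^ (-(3 * α)) * P ^ 3 + ε ^ (-(3 * β)) * Q ^ 3 = A ^ 3 + B ^ 3 := by
    rw [hcube, hcube]; simp only [A, B]; ring
  rw [h2, hexp]
  calc _ ≤ ε⁻¹ * (ε ^ α * (ε ^ β) ^ 2 * (A ^ 3 + A ^ 2 * B + A * B ^ 2)) :=
        mul_le_mul_of_nonneg_left h1 (by positivity)
    _ ≤ ε⁻¹ * (ε ^ α * (ε ^ β) ^ 2 * (3 * (A ^ 3 + B ^ 3))) :=
        mul_le_mul_of_nonneg_left (mul_le_mul_of_nonneg_left (mul_mul_le_add_cubes hA hB)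
          (by positivity)) (by positivity)
    _ = _ := by ring

theorem tendsto_integral_of_trilinear_bound {α β : ℝ} (hβα : β ≤ α) (hαβ : 1 < α + 2 * β)
    {u : SpaceTime d → F₁} {w : SpaceTime d → F₂} (hu : BMV u) (hw : BMV w) (hub : OscBound T α u)
    (hwb : OscBound T β w) {δ : ℝ} {ε : ℕ → ℝ} (hε : ∀ n, 0 < ε n)
    (hεδ : ∀ n, ε n < min δ 1) (hε0 : Tendsto ε atTop (𝓝 0)) {E : ℕ → SpaceTime d → ℝ}
    (hE : ∀ n, TimeSupp δ (T - δ) (E n)) {K : ℝ} (hK : 0 ≤ K) (hle : ∀ n z, |E n z| ≤ K * ((ε n)⁻¹ *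
      (osc u (ε n) z ^ 3 + osc u (ε n) z ^ 2 * osc w (ε n) z + osc u (ε n) z * osc w (ε n) z ^ 2))) :
    Tendsto (fun n => ∫ z, E n z) atTop (𝓝 0) := by
  obtain ⟨C, hC0, hC⟩ := hub
  obtain ⟨D, hD0, hD⟩ := hwb
  -- Here the hypothesis α + 2β > 1 is spent: the exponent α + 2β - 1 is positive.
  have hlim : Tendsto (fun n => K * (3 * ε n ^ (α + 2 * β - 1)) * (C + D)) atTop (𝓝 0) := by
    have h1 : Tendsto (fun n => ε n ^ (α + 2 * β - 1)) atTop (𝓝 0) := by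
      have := hε0.rpow_const (p := α + 2 * β - 1) (Or.inr (by linarith))
      rwa [Real.zero_rpow (by linarith)] at this
    simpa using ((h1.const_mul 3).const_mul K).mul_const (C + D)
  refine squeeze_zero_norm (fun n => ?_) hlim
  have hεn := hε n
  have hεδ' : ε n < δ := (hεδ n).trans_le (min_le_left _ _)
  have hε1 : ε n ≤ 1 := (hεδ n).le.trans (min_le_right _ _)
  have hset : ∫ z, E n z = ∫ z in strip d T δ, E n z :=
    (setIntegral_eq_integral_of_forall_compl_eq_zero fun z hz =>
      hE n z fun h => hz (show z ∈ strip d T δ from ⟨h, trivial⟩)).symm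
  rw [hset]
  have i1 := (hu.integrable_osc_pow (T := T) (ε n) δ).const_mul (ε n ^ (-(3 * α)))
  have i2 := (hw.integrable_osc_pow (T := T) (ε n) δ).const_mul (ε n ^ (-(3 * β)))
  refine (norm_integral_le_of_norm_le ((i1.add i2).const_mul (K * (3 * ε n ^ (α + 2 * β - 1))))
    (Eventually.of_forall fun z => ?_)).trans ?_
  · refine (hle n z).trans ?_
    rw [mul_assoc K]
    exact mul_le_mul_of_nonneg_left (trilinear_le hβα hεn hε1 (osc_nonneg _ _ _)
      (osc_nonneg _ _ _)) hK
  · simp only [Pi.add_apply]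
    rw [integral_const_mul, integral_add i1 i2, integral_const_mul, integral_const_mul]
    have hcancel : ∀ s : ℝ, ε n ^ (-(3 * s)) * ε n ^ (3 * s) = 1 := fun s => by
      rw [← Real.rpow_add hεn]; simp
    have b1 := mul_le_mul_of_nonneg_left (hC δ (ε n) hεn hεδ')
      (Real.rpow_nonneg hεn.le (-(3 * α)))
    have b2 := mul_le_mul_of_nonneg_left (hD δ (ε n) hεn hεδ')
      (Real.rpow_nonneg hεn.le (-(3 * β)))
    have c1 : ε n ^ (-(3 * α)) * (C * ε n ^ (3 * α)) = C := by
      rw [mul_left_comm, hcancel, mul_one]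
    have c2 : ε n ^ (-(3 * β)) * (D * ε n ^ (3 * β)) = D := by
      rw [mul_left_comm, hcancel, mul_one]
    rw [c1] at b1
    rw [c2] at b2
    exact mul_le_mul_of_nonneg_left (add_le_add b1 b2) (by positivity)

end EulerKorteweg

/-! ### The energy balance of the regularized fields. -/

namespace EulerKorteweg

variable {d : ℕ} {T : ℝ}

/-- The regularized fields: the density `P`, the velocity `U`, the density gradient `Q`, the
Laplacian `R`, the momentum `m`, the momentum flux `B`, and the pressure-like terms `Pi`, `S`. -/
structure Fields (d : ℕ) where
  P : SpaceTime d → ℝ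
  U : Fin d → SpaceTime d → ℝ
  Q : Fin d → SpaceTime d → ℝ
  R : SpaceTime d → ℝ
  m : Fin d → SpaceTime d → ℝ
  B : Fin d → Fin d → SpaceTime d → ℝ
  Pi : SpaceTime d → ℝ
  S : Fin d → SpaceTime d → ℝ

namespace Fields

variable (F : Fields d) (H K : ℝ → ℝ)

/-- The potential computed from the regularized fields. -/
noncomputable def mu (z : SpaceTime d) : ℝ :=
  deriv H (F.P z) - 1 / 2 * deriv K (F.P z) * ∑ i, F.Q i z ^ 2 - K (F.P z) * F.R z

/-- The energy density of the regularized fields. -/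
noncomputable def en (z : SpaceTime d) : ℝ :=
  1 / 2 * F.P z * ∑ i, F.U i z ^ 2 + H (F.P z) + 1 / 2 * K (F.P z) * ∑ i, F.Q i z ^ 2

/-- The part of the energy flux without time derivative. -/
noncomputable def fl (j : Fin d) (z : SpaceTime d) : ℝ :=
  (1 / 2 * ∑ i, F.U i z ^ 2 + F.mu H K z) * F.m j z

/-- The interstitial working. -/
noncomputable def work (j : Fin d) (z : SpaceTime d) : ℝ := K (F.P z) * F.Q j z * pd et F.P z

/-- The commutator of the momentum. -/
noncomputable def a (i : Fin d) (z : SpaceTime d) : ℝ := F.m i z - F.P z * F.U i z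

/-- The commutator of the momentum flux. -/
noncomputable def b (i j : Fin d) (z : SpaceTime d) : ℝ := F.B i j z - F.m j z * F.U i z

/-- The commutator of `μρ`. -/
noncomputable def c (z : SpaceTime d) : ℝ := F.Pi z - F.mu H K z * F.P z

/-- The commutator of `μ∇ρ`. -/
noncomputable def e (i : Fin d) (z : SpaceTime d) : ℝ := F.S i z - F.mu H K z * F.Q i z

/-- All fields are of class `C³`. -/
structure Smooth : Prop where
  P : Sm 3 F.P
  U : ∀ i, Sm 3 (F.U i)
  Q : ∀ i, Sm 3 (F.Q i)
  R : Sm 3 F.R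
  m : ∀ i, Sm 3 (F.m i)
  B : ∀ i j, Sm 3 (F.B i j)
  Pi : Sm 3 F.Pi

variable {F H K}

theorem contDiff_deriv_of_three {Φ : ℝ → ℝ} (hΦ : ContDiff ℝ 3 Φ) : ContDiff ℝ 2 (deriv Φ) := by
  have : ContDiff ℝ (2 + 1) Φ := by norm_num; exact hΦ
  exact (contDiff_succ_iff_deriv.1 this).2.2

theorem Smooth.sm_mu (hF : F.Smooth) (hH : ContDiff ℝ 3 H) (hK : ContDiff ℝ 3 K) :
    Sm 1 (F.mu H K) := by
  have h1 := (contDiff_deriv_of_three hH).of_le (m := 1) (by norm_num)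
  have h2 := (contDiff_deriv_of_three hK).of_le (m := 1) (by norm_num)
  have hP : Sm 1 F.P := hF.P.of_le (by norm_num)
  have hQ : ∀ i, Sm 1 (F.Q i) := fun i => (hF.Q i).of_le (by norm_num)
  exact ((Sm.comp h1 hP).sub (((sm_const 1 (1 / 2)).mul (Sm.comp h2 hP)).mul
    (Sm.sum fun i _ => (hQ i).pow 2))).sub
    ((Sm.comp (hK.of_le (by norm_num)) hP).mul (hF.R.of_le (by norm_num)))

theorem pd_sum_sq {V : Fin d → SpaceTime d → ℝ} (hV : ∀ i, Sm 1 (V i)) (v : ℝ × Vec d)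
    (z : SpaceTime d) : pd v (fun z => ∑ i, V i z ^ 2) z = 2 * ∑ i, V i z * pd v (V i) z := by
  rw [pd_sum fun i _ => (hV i).pow 2, Finset.mul_sum]
  refine Finset.sum_congr rfl fun i _ => ?_
  simp only [sq]
  rw [pd_mul (hV i) (hV i)]
  ring

/-- The pointwise energy balance of the regularized fields. -/
theorem Smooth.balance (hF : F.Smooth) (hH : ContDiff ℝ 3 H) (hK : ContDiff ℝ 3 K)
    {z : SpaceTime d} (hgrad : ∀ j, pd (ex j) F.P z = F.Q j z)
    (hmix : ∀ j, pd (ex j) (pd et F.P) z = pd et (F.Q j) z)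
    (hlap : ∑ j, pd (ex j) (F.Q j) z = F.R z)
    (hcont : pd et F.P z + ∑ j, pd (ex j) (F.m j) z = 0)
    (hmom : ∀ i, pd et (F.m i) z + ∑ j, pd (ex j) (F.B i j) z + pd (ex i) F.Pi z = F.S i z) :
    pd et (F.en H K) z + ∑ j, (pd (ex j) (F.fl H K j) z - pd (ex j) (F.work K j) z) +
      ∑ i, F.U i z * (pd et (F.a i) z + ∑ j, pd (ex j) (F.b i j) z + pd (ex i) (F.c H K) z -
        F.e H K i z) - ∑ i, F.a i z * pd (ex i) (F.mu H K) z = 0 := by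
  have hP : Sm 1 F.P := hF.P.of_le (by norm_num)
  have hU : ∀ i, Sm 1 (F.U i) := fun i => (hF.U i).of_le (by norm_num)
  have hQ : ∀ i, Sm 1 (F.Q i) := fun i => (hF.Q i).of_le (by norm_num)
  have hm : ∀ i, Sm 1 (F.m i) := fun i => (hF.m i).of_le (by norm_num)
  have hB : ∀ i j, Sm 1 (F.B i j) := fun i j => (hF.B i j).of_le (by norm_num)
  have hPi : Sm 1 F.Pi := hF.Pi.of_le (by norm_num)
  have hmu := hF.sm_mu hH hK
  have hH1 : ContDiff ℝ 1 H := hH.of_le (by norm_num)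
  have hK1 : ContDiff ℝ 1 K := hK.of_le (by norm_num)
  have hHP := Sm.comp hH1 hP
  have hKP := Sm.comp hK1 hP
  have hUU : Sm 1 fun z => ∑ i, F.U i z ^ 2 := Sm.sum fun i _ => (hU i).pow 2
  have hQQ : Sm 1 fun z => ∑ i, F.Q i z ^ 2 := Sm.sum fun i _ => (hQ i).pow 2
  have hPt : Sm 1 (pd et F.P) := (hF.P.of_le (by norm_num : (1 + 1 : WithTop ℕ∞) ≤ 3)).pd et
  have d1 : pd et (F.en H K) z = 1 / 2 * pd et F.P z * ∑ i, F.U i z ^ 2 +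
      F.P z * ∑ i, F.U i z * pd et (F.U i) z + deriv H (F.P z) * pd et F.P z +
      1 / 2 * (deriv K (F.P z) * pd et F.P z) * ∑ i, F.Q i z ^ 2 +
      K (F.P z) * ∑ i, F.Q i z * pd et (F.Q i) z := by
    have s1 := ((sm_const 1 (1 / 2 : ℝ)).mul hP).mul hUU
    have s2 := ((sm_const 1 (1 / 2 : ℝ)).mul hKP).mul hQQ
    unfold en
    rw [pd_add (s1.add hHP) s2, pd_add s1 hHP, pd_mul ((sm_const 1 (1 / 2 : ℝ)).mul hP) hUU,
      pd_mul ((sm_const 1 (1 / 2 : ℝ)).mul hKP) hQQ, pd_const_mul hP, pd_const_mul hKP,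
      pd_comp hH1 hP, pd_comp hK1 hP, pd_sum_sq hU, pd_sum_sq hQ]
    ring
  -- By `hmix`, the divergence of the work contains K(P) Q·∂ₜQ, which cancels the same term in the
  -- time derivative of the energy.
  have d2 : ∀ j, pd (ex j) (F.fl H K j) z - pd (ex j) (F.work K j) z =
      (∑ i, F.U i z * pd (ex j) (F.U i) z) * F.m j z + pd (ex j) (F.mu H K) z * F.m j z +
      (1 / 2 * (∑ i, F.U i z ^ 2) + F.mu H K z) * pd (ex j) (F.m j) z -
      (deriv K (F.P z) * pd et F.P z) * F.Q j z ^ 2 -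
      (K (F.P z) * pd et F.P z) * pd (ex j) (F.Q j) z -
      K (F.P z) * (F.Q j z * pd et (F.Q j) z) := by
    intro j
    have s1 := (sm_const 1 (1 / 2 : ℝ)).mul hUU
    unfold fl work
    rw [pd_mul (s1.add hmu) (hm j), pd_add s1 hmu, pd_const_mul hUU, pd_sum_sq hU,
      pd_mul (hKP.mul (hQ j)) hPt, pd_mul hKP (hQ j), pd_comp hK1 hP, hgrad, hmix]
    ring
  -- In the momentum equation multiplied by U, the terms with |U|² cancel by mass conservation, and
  -- Pi, B and S drop out by `hmom`. Only transport terms and P U·∇mu are left.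
  have d3 : ∀ i, F.U i z * (pd et (F.a i) z + ∑ j, pd (ex j) (F.b i j) z +
      pd (ex i) (F.c H K) z - F.e H K i z) =
      -(F.P z * (F.U i z * pd et (F.U i) z)) -
        (∑ j, F.U i z * pd (ex j) (F.U i) z * F.m j z) -
        F.P z * (F.U i z * pd (ex i) (F.mu H K) z) := by
    intro i
    have e1 : pd et (F.a i) z = pd et (F.m i) z - (pd et F.P z * F.U i z +
        F.P z * pd et (F.U i) z) := by
      unfold a
      rw [pd_sub (hm i) (hP.mul (hU i)), pd_mul hP (hU i)]
    have e2 : ∑ j, pd (ex j) (F.b i j) z = ∑ j, pd (ex j) (F.B i j) z -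
        (∑ j, pd (ex j) (F.m j) z) * F.U i z - ∑ j, F.m j z * pd (ex j) (F.U i) z := by
      rw [Finset.sum_mul, ← Finset.sum_sub_distrib, ← Finset.sum_sub_distrib]
      refine Finset.sum_congr rfl fun j _ => ?_
      unfold b
      rw [pd_sub (hB i j) ((hm j).mul (hU i)), pd_mul (hm j) (hU i)]
      ring
    have e3 : pd (ex i) (F.c H K) z = pd (ex i) F.Pi z -
        (pd (ex i) (F.mu H K) z * F.P z + F.mu H K z * F.Q i z) := by
      unfold c
      rw [pd_sub hPi (hmu.mul hP), pd_mul hmu hP, hgrad]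
    have e4 : ∑ j, pd (ex j) (F.m j) z = -pd et F.P z := by linarith
    have e5 : ∑ j, F.U i z * pd (ex j) (F.U i) z * F.m j z =
        F.U i z * ∑ j, F.m j z * pd (ex j) (F.U i) z := by
      rw [Finset.mul_sum]
      exact Finset.sum_congr rfl fun j _ => by ring
    rw [e1, e2, e3, e4, e5, e, ← hmom i]
    ring
  have d4 : ∀ i, F.a i z * pd (ex i) (F.mu H K) z = pd (ex i) (F.mu H K) z * F.m i z -
      F.P z * (F.U i z * pd (ex i) (F.mu H K) z) := fun i => by
    unfold a; ring
  have e4 : ∑ j, pd (ex j) (F.m j) z = -pd et F.P z := by linarith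
  have e6 : ∑ j, (∑ i, F.U i z * pd (ex j) (F.U i) z) * F.m j z =
      ∑ i, ∑ j, F.U i z * pd (ex j) (F.U i) z * F.m j z := by
    simp only [Finset.sum_mul]
    exact Finset.sum_comm
  simp only [d1, d2, d3, d4, Finset.sum_add_distrib, Finset.sum_sub_distrib,
    Finset.sum_neg_distrib, ← Finset.mul_sum, hlap, e4, e6]
  -- The remaining factor of ∂ₜP is H' - ½K'|Q|² - K R, that is mu. It cancels the contribution mu
  -- div m = -mu ∂ₜP of the flux; this fixes the form of `mu`.
  have hmu' : F.mu H K z = deriv H (F.P z) - 1 / 2 * deriv K (F.P z) * ∑ i, F.Q i z ^ 2 -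
    K (F.P z) * F.R z := rfl
  rw [hmu']
  ring

/-- The part of the error that carries derivatives of the regularized fields. -/
noncomputable def hard (F : Fields d) (H K : ℝ → ℝ) (φ : SpaceTime d → ℝ) (z : SpaceTime d) : ℝ :=
  ∑ i, φ z * (F.a i z * pd et (F.U i) z + ∑ j, F.b i j z * pd (ex j) (F.U i) z +
    F.c H K z * pd (ex i) (F.U i) z + F.a i z * pd (ex i) (F.mu H K) z)

/-- The part of the error without derivatives of the regularized fields. -/
noncomputable def soft (F : Fields d) (H K : ℝ → ℝ) (φ : SpaceTime d → ℝ) (z : SpaceTime d) : ℝ :=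
  ∑ i, F.U i z * (F.a i z * pd et φ z + ∑ j, F.b i j z * pd (ex j) φ z +
    F.c H K z * pd (ex i) φ z + F.e H K i z * φ z)

theorem integral_mul_pd {f g : SpaceTime d → ℝ} (hf : Sm 1 f) (hg : Sm 1 g)
    (hc : HasCompactSupport g) (v : ℝ × Vec d) :
    ∫ z, f z * pd v g z = -∫ z, pd v f z * g z := by
  rw [integral_pd_mul hf hg hc, neg_neg]

/-- The commutators a, b, c are small but their derivatives are not, so every derivative is moved to
U φ. Those falling on U form `hard`, together with a·∇mu, and those falling on φ form `soft`. Since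
`S` is never differentiated, its continuity suffices. -/
theorem Smooth.integral_balance (hF : F.Smooth) (hS : ∀ i, Continuous (F.S i))
    (hH : ContDiff ℝ 3 H) (hK : ContDiff ℝ 3 K)
    {φ : SpaceTime d → ℝ} (hφ : Sm 1 φ) (hc : HasCompactSupport φ)
    (hbal : ∀ z, φ z ≠ 0 → pd et (F.en H K) z +
      ∑ j, (pd (ex j) (F.fl H K j) z - pd (ex j) (F.work K j) z) +
      ∑ i, F.U i z * (pd et (F.a i) z + ∑ j, pd (ex j) (F.b i j) z + pd (ex i) (F.c H K) z -
        F.e H K i z) - ∑ i, F.a i z * pd (ex i) (F.mu H K) z = 0) :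
    (∫ z, F.en H K z * pd et φ z) + (∫ z, ∑ j, F.fl H K j z * pd (ex j) φ z) -
      (∫ z, ∑ j, F.work K j z * pd (ex j) φ z) + (∫ z, F.hard H K φ z) +
      (∫ z, F.soft H K φ z) = 0 := by
  have hP : Sm 1 F.P := hF.P.of_le (by norm_num)
  have hU : ∀ i, Sm 1 (F.U i) := fun i => (hF.U i).of_le (by norm_num)
  have hQ : ∀ i, Sm 1 (F.Q i) := fun i => (hF.Q i).of_le (by norm_num)
  have hm : ∀ i, Sm 1 (F.m i) := fun i => (hF.m i).of_le (by norm_num)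
  have hB : ∀ i j, Sm 1 (F.B i j) := fun i j => (hF.B i j).of_le (by norm_num)
  have hPi : Sm 1 F.Pi := hF.Pi.of_le (by norm_num)
  have hmu := hF.sm_mu hH hK
  have hKP := Sm.comp (hK.of_le (by norm_num) : ContDiff ℝ 1 K) hP
  have hHP := Sm.comp (hH.of_le (by norm_num) : ContDiff ℝ 1 H) hP
  have hUU : Sm 1 fun z => ∑ i, F.U i z ^ 2 := Sm.sum fun i _ => (hU i).pow 2
  have hQQ : Sm 1 fun z => ∑ i, F.Q i z ^ 2 := Sm.sum fun i _ => (hQ i).pow 2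
  have hPt : Sm 1 (pd et F.P) := (hF.P.of_le (by norm_num : (1 + 1 : WithTop ℕ∞) ≤ 3)).pd et
  have sen : Sm 1 (F.en H K) := ((((sm_const 1 (1 / 2)).mul hP).mul hUU).add hHP).add
    (((sm_const 1 (1 / 2)).mul hKP).mul hQQ)
  have sfl : ∀ j, Sm 1 (F.fl H K j) := fun j =>
    (((sm_const 1 (1 / 2)).mul hUU).add hmu).mul (hm j)
  have swk : ∀ j, Sm 1 (F.work K j) := fun j => (hKP.mul (hQ j)).mul hPt
  have sa : ∀ i, Sm 1 (F.a i) := fun i => (hm i).sub (hP.mul (hU i))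
  have sb : ∀ i j, Sm 1 (F.b i j) := fun i j => (hB i j).sub ((hm j).mul (hU i))
  have sc : Sm 1 (F.c H K) := hPi.sub (hmu.mul hP)
  have se : ∀ i, Continuous (F.e H K i) := fun i => (hS i).sub (hmu.mul (hQ i)).continuous
  have hUφ : ∀ i, Sm 1 fun z => F.U i z * φ z := fun i => (hU i).mul hφ
  have hUφc : ∀ i, HasCompactSupport fun z => F.U i z * φ z := fun i => hc.mul_left
  -- integrability of continuous functions against `φ` and its derivatives
  have I0 : ∀ {f : SpaceTime d → ℝ}, Continuous f → Integrable fun z => f z * φ z := fun hf =>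
    (hf.mul hφ.continuous).integrable_of_hasCompactSupport hc.mul_left
  have I1 : ∀ {f : SpaceTime d → ℝ} (v : ℝ × Vec d), Continuous f →
      Integrable fun z => f z * pd v φ z := fun v hf =>
    (hf.mul (hφ.continuous_pd v)).integrable_of_hasCompactSupport
      (hasCompactSupport_pd hc v).mul_left
  have I2 : ∀ {f : SpaceTime d → ℝ} (v : ℝ × Vec d) (i : Fin d), Continuous f →
      Integrable fun z => f z * pd v (fun z => F.U i z * φ z) z := fun v i hf =>
    (hf.mul ((hUφ i).continuous_pd v)).integrable_of_hasCompactSupport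
      (hasCompactSupport_pd (hUφc i) v).mul_left
  have e1 := integral_mul_pd sen hφ hc et
  have e2 : ∫ z, ∑ j, F.fl H K j z * pd (ex j) φ z =
      -∫ z, (∑ j, pd (ex j) (F.fl H K j) z) * φ z := by
    rw [integral_finsetSum _ fun j _ => I1 _ (sfl j).continuous]
    simp only [Finset.sum_mul]
    rw [integral_finsetSum _ fun j _ => I0 ((sfl j).continuous_pd _), ← Finset.sum_neg_distrib]
    exact Finset.sum_congr rfl fun j _ => integral_mul_pd (sfl j) hφ hc _
  have e3 : ∫ z, ∑ j, F.work K j z * pd (ex j) φ z =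
      -∫ z, (∑ j, pd (ex j) (F.work K j) z) * φ z := by
    rw [integral_finsetSum _ fun j _ => I1 _ (swk j).continuous]
    simp only [Finset.sum_mul]
    rw [integral_finsetSum _ fun j _ => I0 ((swk j).continuous_pd _), ← Finset.sum_neg_distrib]
    exact Finset.sum_congr rfl fun j _ => integral_mul_pd (swk j) hφ hc _
  -- the errors, integrated by parts
  have ci : ∀ i, Continuous fun z => F.a i z * pd et (fun z => F.U i z * φ z) z +
      ∑ j, F.b i j z * pd (ex j) (fun z => F.U i z * φ z) z +
      F.c H K z * pd (ex i) (fun z => F.U i z * φ z) z := fun i =>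
    (((sa i).continuous.mul ((hUφ i).continuous_pd et)).add (continuous_finsetSum _ fun j _ =>
      (sb i j).continuous.mul ((hUφ i).continuous_pd _))).add
      (sc.continuous.mul ((hUφ i).continuous_pd _))
  have Ib : ∀ i, Integrable fun z => ∑ j, F.b i j z * pd (ex j) (fun z => F.U i z * φ z) z :=
    fun i => integrable_finsetSum _ fun j _ => I2 _ i (sb i j).continuous
  have Iab : ∀ i, Integrable fun z => F.a i z * pd et (fun z => F.U i z * φ z) z +
      ∑ j, F.b i j z * pd (ex j) (fun z => F.U i z * φ z) z := fun i =>
    (I2 _ i (sa i).continuous).add (Ib i)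
  have Ic : ∀ i, Integrable fun z => F.c H K z * pd (ex i) (fun z => F.U i z * φ z) z :=
    fun i => I2 _ i sc.continuous
  have cdiv : ∀ i, Continuous fun z => F.U i z * (pd et (F.a i) z + ∑ j, pd (ex j) (F.b i j) z +
      pd (ex i) (F.c H K) z) := fun i => (hU i).continuous.mul
    ((((sa i).continuous_pd et).add (continuous_finsetSum _ fun j _ => (sb i j).continuous_pd _)).add
      (sc.continuous_pd _))
  have e4 : ∀ i, ∫ z, (F.a i z * pd et (fun z => F.U i z * φ z) z +
      ∑ j, F.b i j z * pd (ex j) (fun z => F.U i z * φ z) z +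
      F.c H K z * pd (ex i) (fun z => F.U i z * φ z) z) =
      -∫ z, F.U i z * (pd et (F.a i) z + ∑ j, pd (ex j) (F.b i j) z + pd (ex i) (F.c H K) z) *
        φ z := by
    intro i
    have J : ∀ {f : SpaceTime d → ℝ}, Continuous f → Integrable fun z => f z * (F.U i z * φ z) :=
      fun hf => (hf.mul (hUφ i).continuous).integrable_of_hasCompactSupport (hUφc i).mul_left
    have Jb : Integrable fun z => ∑ j, pd (ex j) (F.b i j) z * (F.U i z * φ z) :=
      integrable_finsetSum _ fun j _ => J ((sb i j).continuous_pd _)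
    have Jab : Integrable fun z => pd et (F.a i) z * (F.U i z * φ z) +
        ∑ j, pd (ex j) (F.b i j) z * (F.U i z * φ z) := (J ((sa i).continuous_pd et)).add Jb
    have r : ∀ z, F.U i z * (pd et (F.a i) z + ∑ j, pd (ex j) (F.b i j) z +
        pd (ex i) (F.c H K) z) * φ z = pd et (F.a i) z * (F.U i z * φ z) +
        ∑ j, pd (ex j) (F.b i j) z * (F.U i z * φ z) +
        pd (ex i) (F.c H K) z * (F.U i z * φ z) := fun z => by
      rw [← Finset.sum_mul]; ring
    simp only [r]
    rw [integral_add (Iab i) (Ic i), integral_add (I2 _ i (sa i).continuous) (Ib i),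
      integral_finsetSum _ fun j _ => I2 _ i (sb i j).continuous,
      integral_add Jab (J (sc.continuous_pd _)), integral_add (J ((sa i).continuous_pd et)) Jb,
      integral_finsetSum _ fun j _ => J ((sb i j).continuous_pd _),
      integral_mul_pd (sa i) (hUφ i) (hUφc i), integral_mul_pd sc (hUφ i) (hUφc i),
      Finset.sum_congr rfl fun j _ => integral_mul_pd (sb i j) (hUφ i) (hUφc i) (ex j),
      Finset.sum_neg_distrib]
    ring
  have chard : Integrable (F.hard H K φ) := by
    refine Continuous.integrable_of_hasCompactSupport ?_ ?_
    · exact continuous_finsetSum _ fun i _ => hφ.continuous.mul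
        (((((sa i).continuous.mul ((hU i).continuous_pd _)).add (continuous_finsetSum _ fun j _ =>
          (sb i j).continuous.mul ((hU i).continuous_pd _))).add
          (sc.continuous.mul ((hU i).continuous_pd _))).add
          ((sa i).continuous.mul (hmu.continuous_pd _)))
    · refine hc.mono' fun z hz => subset_tsupport φ ?_
      contrapose! hz
      have : φ z = 0 := by simpa using hz
      simp [hard, this]
  have csoft : Integrable (F.soft H K φ) := by
    refine Continuous.integrable_of_hasCompactSupport ?_ ?_
    · exact continuous_finsetSum _ fun i _ => (hU i).continuous.mul
        (((((sa i).continuous.mul (hφ.continuous_pd _)).add (continuous_finsetSum _ fun j _ =>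
          (sb i j).continuous.mul (hφ.continuous_pd _))).add
          (sc.continuous.mul (hφ.continuous_pd _))).add
          ((se i).mul hφ.continuous))
    · refine hc.mono' fun z hz => ?_
      contrapose! hz
      have h1 : ∀ v, pd v φ z = 0 := fun v => pd_eq_zero_of_notMem_tsupport v hz
      simp [soft, h1, image_eq_zero_of_notMem_tsupport hz]
  -- The Leibniz rule for the test functions U φ, read backwards.
  have e5 : ∀ z, F.hard H K φ z + F.soft H K φ z =
      ∑ i, (F.a i z * pd et (fun z => F.U i z * φ z) z +
      ∑ j, F.b i j z * pd (ex j) (fun z => F.U i z * φ z) z +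
      F.c H K z * pd (ex i) (fun z => F.U i z * φ z) z) +
      (∑ i, (F.U i z * F.e H K i z + F.a i z * pd (ex i) (F.mu H K) z)) * φ z := by
    intro z
    rw [hard, soft, Finset.sum_mul, ← Finset.sum_add_distrib, ← Finset.sum_add_distrib]
    refine Finset.sum_congr rfl fun i _ => ?_
    simp only [pd_mul (hU i) hφ, mul_add, Finset.sum_add_distrib]
    have r1 : ∑ j, F.b i j z * (pd (ex j) (F.U i) z * φ z) =
        φ z * ∑ j, F.b i j z * pd (ex j) (F.U i) z := by
      rw [Finset.mul_sum]; exact Finset.sum_congr rfl fun j _ => by ring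
    have r2 : ∑ j, F.b i j z * (F.U i z * pd (ex j) φ z) =
        F.U i z * ∑ j, F.b i j z * pd (ex j) φ z := by
      rw [Finset.mul_sum]; exact Finset.sum_congr rfl fun j _ => by ring
    rw [r1, r2]
    ring
  have cX : Continuous fun z => ∑ i, (F.U i z * F.e H K i z + F.a i z * pd (ex i) (F.mu H K) z) :=
    continuous_finsetSum _ fun i _ => ((hU i).continuous.mul (se i)).add
      ((sa i).continuous.mul (hmu.continuous_pd _))
  have e6 : (∫ z, F.hard H K φ z) + (∫ z, F.soft H K φ z) =
      -(∫ z, (∑ i, F.U i z * (pd et (F.a i) z + ∑ j, pd (ex j) (F.b i j) z +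
        pd (ex i) (F.c H K) z)) * φ z) +
      ∫ z, (∑ i, (F.U i z * F.e H K i z + F.a i z * pd (ex i) (F.mu H K) z)) * φ z := by
    rw [← integral_add chard csoft]
    simp only [e5]
    have Iabc : ∀ i, Integrable fun z => F.a i z * pd et (fun z => F.U i z * φ z) z +
        ∑ j, F.b i j z * pd (ex j) (fun z => F.U i z * φ z) z +
        F.c H K z * pd (ex i) (fun z => F.U i z * φ z) z := fun i => (Iab i).add (Ic i)
    rw [integral_add (integrable_finsetSum _ fun i _ => Iabc i) (I0 cX),
      integral_finsetSum _ fun i _ => Iabc i]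
    congr 1
    simp only [Finset.sum_mul]
    rw [integral_finsetSum _ fun i _ => I0 (cdiv i), ← Finset.sum_neg_distrib]
    exact Finset.sum_congr rfl fun i _ => e4 i
  have cfl : Continuous fun z => ∑ j, pd (ex j) (F.fl H K j) z :=
    continuous_finsetSum _ fun j _ => (sfl j).continuous_pd _
  have cwk : Continuous fun z => ∑ j, pd (ex j) (F.work K j) z :=
    continuous_finsetSum _ fun j _ => (swk j).continuous_pd _
  have cD : Continuous fun z => ∑ i, F.U i z * (pd et (F.a i) z + ∑ j, pd (ex j) (F.b i j) z +
        pd (ex i) (F.c H K) z) := continuous_finsetSum _ fun i _ => cdiv i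
  have e7 : ∫ z, (pd et (F.en H K) z * φ z + (∑ j, pd (ex j) (F.fl H K j) z) * φ z -
      (∑ j, pd (ex j) (F.work K j) z) * φ z + (∑ i, F.U i z * (pd et (F.a i) z +
        ∑ j, pd (ex j) (F.b i j) z + pd (ex i) (F.c H K) z)) * φ z -
      (∑ i, (F.U i z * F.e H K i z + F.a i z * pd (ex i) (F.mu H K) z)) * φ z) = 0 := by
    rw [← integral_zero (SpaceTime d) ℝ (μ := volume)]
    congr 1; ext z
    by_cases hz : φ z = 0
    · simp [hz]
    have h := hbal z hz
    simp only [Finset.sum_sub_distrib, mul_sub] at h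
    simp only [Finset.sum_add_distrib]
    linear_combination φ z * h
  have A1 := I0 (sen.continuous_pd et)
  have A2 := I0 cfl
  have A3 := I0 cwk
  have A4 := I0 cD
  have A5 := I0 cX
  have A12 : Integrable fun z => pd et (F.en H K) z * φ z +
    (∑ j, pd (ex j) (F.fl H K j) z) * φ z := A1.add A2
  have A123 : Integrable fun z => pd et (F.en H K) z * φ z +
    (∑ j, pd (ex j) (F.fl H K j) z) * φ z - (∑ j, pd (ex j) (F.work K j) z) * φ z := A12.sub A3
  have A1234 : Integrable fun z => pd et (F.en H K) z * φ z +
    (∑ j, pd (ex j) (F.fl H K j) z) * φ z - (∑ j, pd (ex j) (F.work K j) z) * φ z +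
    (∑ i, F.U i z * (pd et (F.a i) z +
        ∑ j, pd (ex j) (F.b i j) z + pd (ex i) (F.c H K) z)) * φ z := A123.add A4
  rw [integral_sub A1234 A5, integral_add A123 A4, integral_sub A12 A3, integral_add A1 A2] at e7
  rw [e1, e2, e3, add_assoc _ (∫ z, F.hard H K φ z), e6]
  linarith

end Fields

end EulerKorteweg

/-! ### Nonlinear regularizations and trilinear bounds. -/

namespace EulerKorteweg

set_option linter.unusedSectionVars false

variable {d : ℕ} {T : ℝ}
variable {F₁ F₂ : Type*} [NormedAddCommGroup F₁] [MeasurableSpace F₁] [BorelSpace F₁]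
  [SecondCountableTopology F₁] [NormedAddCommGroup F₂] [MeasurableSpace F₂] [BorelSpace F₂]
  [SecondCountableTopology F₂]
variable {u : SpaceTime d → F₁} {w : SpaceTime d → F₂}

theorem Dom.add {f g : SpaceTime d → ℝ} {a b a' b' : ℝ} (hf : Dom u w a b f)
    (hg : Dom u w a' b' g) : Dom u w (a + a') (b + b') (fun z => f z + g z) := by
  refine ⟨hf.1, hf.2, hf.bm.add hg.bm, add_nonneg hf.4 hg.4, add_nonneg hf.5 hg.5,
    fun z z' => ?_⟩
  have h1 : f z' + g z' - (f z + g z) = (f z' - f z) + (g z' - g z) := by ring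
  rw [h1]
  refine (abs_add_le _ _).trans ?_
  linarith [hf.le z z', hg.le z z']

theorem Dom.const (hu : BMV u) (hw : BMV w) (c : ℝ) : Dom u w 0 0 (fun _ => c) :=
  ⟨hu, hw, BM.const c, le_rfl, le_rfl, fun _ _ => by simp⟩

/-- The smooth functions `f ε` regularize `g`, up to an error that is quadratic in the increments
of `w`. -/
structure Regularizes (u : SpaceTime d → F₁) (w : SpaceTime d → F₂) (g : SpaceTime d → ℝ)
    (f : ℝ → SpaceTime d → ℝ) : Prop where
  dom : ∃ b, Dom u w 0 b g
  bdd : ∃ C, ∀ ε z, |f ε z| ≤ C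
  sm : ∀ ε > 0, Sm 1 (f ε)
  close : ∃ K, 0 ≤ K ∧ ∀ ε z, |mol ε g z - f ε z| ≤ K * (osc w ε z * osc w ε z)
  pd : ∀ v, ∃ K, 0 ≤ K ∧ ∀ ε > 0, ∀ z, |pd v (f ε) z| ≤ ε⁻¹ * (K * osc w ε z)

theorem osc₂_zero_left (u : SpaceTime d → F₁) (w : SpaceTime d → F₂) (b ε : ℝ) (z : SpaceTime d) :
    osc₂ u w 0 b ε z = b * osc w ε z := by
  simp [osc₂]

theorem Dom.regularizes {g : SpaceTime d → ℝ} {b : ℝ} (hg : Dom u w 0 b g) :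
    Regularizes u w g fun ε => mol ε g := by
  obtain ⟨C, hC⟩ := hg.bm.bdd
  refine ⟨⟨b, hg⟩, ⟨C, fun ε => abs_mol_le ε hC⟩, fun ε hε => sm_mol hε hg.bm (n := 1),
    ⟨0, le_rfl, by simp⟩, fun v => ?_⟩
  obtain ⟨K, hK0, hK⟩ := exists_abs_pd_mol_le (F₁ := F₁) (F₂ := F₂) v
  refine ⟨K * b, mul_nonneg hK0 hg.5, fun ε hε z => ?_⟩
  have := hK u w g 0 b hg ε hε z
  rwa [osc₂_zero_left, ← mul_assoc K] at this

/-- The energy identity forces the potential to be computed from the mollified density, so the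
composition stands outside the mollifier. -/
theorem Dom.regularizes_comp {g : SpaceTime d → ℝ} {b : ℝ} (hg : Dom u w 0 b g) {Φ : ℝ → ℝ}
    (hΦ : ContDiff ℝ 2 Φ) :
    Regularizes u w (fun z => Φ (g z)) fun ε z => Φ (mol ε g z) := by
  have hΦ1 : ContDiff ℝ 1 Φ := hΦ.of_le (by norm_num)
  obtain ⟨C, hC⟩ := hg.bm.bdd
  have hmC : ∀ ε z, |mol ε g z| ≤ C := fun ε => abs_mol_le ε hC
  obtain ⟨D, hD⟩ := (isCompact_Icc (a := -C) (b := C)).exists_bound_of_continuousOn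
    hΦ.continuous.continuousOn
  obtain ⟨D', hD'⟩ := (isCompact_Icc (a := -C) (b := C)).exists_bound_of_continuousOn
    (hΦ1.continuous_deriv le_rfl).continuousOn
  refine ⟨?_, ⟨D, fun ε z => hD _ (abs_le.1 (hmC ε z))⟩,
    fun ε hε => Sm.comp hΦ1 (sm_mol hε hg.bm (n := 1)), ?_, fun v => ?_⟩
  · obtain ⟨L, -, hL⟩ := hg.exists_comp hΦ1
    rw [mul_zero] at hL
    exact ⟨_, hL⟩
  · obtain ⟨K, hK0, hK⟩ := hg.exists_abs_mol_comp_sub_le hΦ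
    refine ⟨K * (b * b), mul_nonneg hK0 (mul_nonneg hg.5 hg.5), fun ε z => (hK ε z).trans_eq ?_⟩
    rw [osc₂_zero_left]; ring
  · obtain ⟨K, hK0, hK⟩ := hg.regularizes.pd v
    have hD0 : 0 ≤ D' := (norm_nonneg _).trans (hD' _ (abs_le.1 (hmC 0 0)))
    refine ⟨D' * K, mul_nonneg hD0 hK0, fun ε hε z => ?_⟩
    rw [pd_comp hΦ1 (sm_mol hε hg.bm (n := 1)), abs_mul]
    refine (mul_le_mul (hD' _ (abs_le.1 (hmC ε z))) (hK ε hε z) (abs_nonneg _) hD0).trans_eq ?_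
    ring

namespace Regularizes

variable {g g' : SpaceTime d → ℝ} {f f' : ℝ → SpaceTime d → ℝ}

theorem const (hu : BMV u) (hw : BMV w) (c : ℝ) : Regularizes u w (fun _ => c) fun _ _ => c := by
  have h := (Dom.const hu hw c).regularizes
  have e : (fun ε => mol ε (fun _ : SpaceTime d => c)) = fun _ _ => c :=
    funext fun ε => funext fun z => mol_const ε c z
  rwa [e] at h

/-- Closure under sums and products lets the potential, a polynomial in ∇ρ, Δρ and functions of ρ,
inherit all bounds from its ingredients. -/
theorem mul (h : Regularizes u w g f) (h' : Regularizes u w g' f') :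
    Regularizes u w (fun z => g z * g' z) fun ε z => f ε z * f' ε z := by
  obtain ⟨b, hb⟩ := h.dom
  obtain ⟨b', hb'⟩ := h'.dom
  obtain ⟨C, hC⟩ := h.bdd
  obtain ⟨C', hC'⟩ := h'.bdd
  obtain ⟨D, hD⟩ := hb.bm.bdd
  obtain ⟨D', hD'⟩ := hb'.bm.bdd
  have hC0 : 0 ≤ C := (abs_nonneg _).trans (hC 0 0)
  have hC0' : 0 ≤ C' := (abs_nonneg _).trans (hC' 0 0)
  have hD0' : 0 ≤ D' := (abs_nonneg _).trans (hD' 0)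
  refine ⟨?_, ⟨C * C', fun ε z => ?_⟩, fun ε hε => (h.sm ε hε).mul (h'.sm ε hε), ?_, fun v => ?_⟩
  · have := hb.mul hb' (C := max D D') (fun z => (hD z).trans (le_max_left _ _))
      (fun z => (hD' z).trans (le_max_right _ _))
    rw [add_zero, mul_zero] at this
    exact ⟨_, this⟩
  · rw [abs_mul]; exact mul_le_mul (hC ε z) (hC' ε z) (abs_nonneg _) hC0
  · obtain ⟨K, hK0, hK⟩ := exists_abs_mol_mul_sub_le (F₁ := F₁) (F₂ := F₂) d
    obtain ⟨A, hA0, hA⟩ := h.close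
    obtain ⟨A', hA0', hA'⟩ := h'.close
    refine ⟨K * (b * b') + A * D' + C * A', by have := hb.5; have := hb'.5; positivity,
      fun ε z => ?_⟩
    -- One genuine product commutator, plus the two closeness errors multiplied by bounded factors.
    have e : mol ε (fun z => g z * g' z) z - f ε z * f' ε z =
        (mol ε (fun z => g z * g' z) z - mol ε g z * mol ε g' z) +
        (mol ε g z - f ε z) * mol ε g' z + f ε z * (mol ε g' z - f' ε z) := by ring
    rw [e]
    refine (abs_add_le _ _).trans ?_
    refine (add_le_add_left (abs_add_le _ _) _).trans ?_
    rw [abs_mul, abs_mul]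
    have h1 := hK u w g g' 0 b 0 b' hb hb' ε z
    rw [osc₂_zero_left, osc₂_zero_left] at h1
    have h2 := mul_le_mul (hA ε z) (abs_mol_le ε hD' z) (abs_nonneg _)
      (mul_nonneg hA0 (mul_self_nonneg _))
    have h3 := mul_le_mul (hC ε z) (hA' ε z) (abs_nonneg _) hC0
    linarith
  · obtain ⟨K, hK0, hK⟩ := h.pd v
    obtain ⟨K', hK0', hK'⟩ := h'.pd v
    refine ⟨K * C' + C * K', by positivity, fun ε hε z => ?_⟩
    rw [pd_mul (h.sm ε hε) (h'.sm ε hε)]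
    refine (abs_add_le _ _).trans ?_
    rw [abs_mul, abs_mul]
    have h1 := mul_le_mul (hK ε hε z) (hC' ε z) (abs_nonneg _)
      ((abs_nonneg _).trans (hK ε hε z))
    have h2 := mul_le_mul (hC ε z) (hK' ε hε z) (abs_nonneg _) hC0
    linarith

theorem add (h : Regularizes u w g f) (h' : Regularizes u w g' f') :
    Regularizes u w (fun z => g z + g' z) fun ε z => f ε z + f' ε z := by
  obtain ⟨b, hb⟩ := h.dom
  obtain ⟨b', hb'⟩ := h'.dom
  obtain ⟨C, hC⟩ := h.bdd
  obtain ⟨C', hC'⟩ := h'.bdd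
  refine ⟨?_, ⟨C + C', fun ε z => (abs_add_le _ _).trans (add_le_add (hC ε z) (hC' ε z))⟩,
    fun ε hε => (h.sm ε hε).add (h'.sm ε hε), ?_, fun v => ?_⟩
  · have := hb.add hb'
    rw [add_zero] at this
    exact ⟨_, this⟩
  · obtain ⟨A, hA0, hA⟩ := h.close
    obtain ⟨A', hA0', hA'⟩ := h'.close
    refine ⟨A + A', by positivity, fun ε z => ?_⟩
    have e0 : mol ε (fun z => g z + g' z) z = mol ε g z + mol ε g' z := by
      have := mol_sub ε hb.bm hb'.bm.neg z
      simp only [sub_neg_eq_add] at this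
      rw [this, mol, mol, mol, kav, kav, kav]
      simp only [mul_neg, integral_neg, sub_neg_eq_add]
    have e : mol ε (fun z => g z + g' z) z - (f ε z + f' ε z) =
        (mol ε g z - f ε z) + (mol ε g' z - f' ε z) := by rw [e0]; ring
    rw [e]
    refine (abs_add_le _ _).trans ((add_le_add (hA ε z) (hA' ε z)).trans_eq ?_)
    ring
  · obtain ⟨K, hK0, hK⟩ := h.pd v
    obtain ⟨K', hK0', hK'⟩ := h'.pd v
    refine ⟨K + K', by positivity, fun ε hε z => ?_⟩
    rw [pd_add (h.sm ε hε) (h'.sm ε hε)]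
    refine (abs_add_le _ _).trans ((add_le_add (hK ε hε z) (hK' ε hε z)).trans_eq ?_)
    ring

theorem sub (h : Regularizes u w g f) (h' : Regularizes u w g' f') :
    Regularizes u w (fun z => g z - g' z) fun ε z => f ε z - f' ε z := by
  obtain ⟨b, hb⟩ := h.dom
  simpa only [neg_one_mul, ← sub_eq_add_neg] using
    h.add ((const (u := u) hb.bmv_u hb.bmv_w (-1)).mul h')

theorem sum (hu : BMV u) (hw : BMV w) {ι : Type*} {s : Finset ι} {g : ι → SpaceTime d → ℝ}
    {f : ι → ℝ → SpaceTime d → ℝ} (h : ∀ i, Regularizes u w (g i) (f i)) :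
    Regularizes u w (fun z => ∑ i ∈ s, g i z) fun ε z => ∑ i ∈ s, f i ε z := by
  classical
  induction s using Finset.induction_on with
  | empty => simpa using const (u := u) hu hw 0
  | insert i s hi ih => simpa only [Finset.sum_insert hi] using (h i).add ih

end Regularizes

/-- The trilinear expression in the oscillations of `u` and `w` which controls the errors. -/
noncomputable def trilinear (u : SpaceTime d → F₁) (w : SpaceTime d → F₂) (ε : ℝ)
    (z : SpaceTime d) : ℝ :=
  ε⁻¹ * (osc u ε z ^ 3 + osc u ε z ^ 2 * osc w ε z + osc u ε z * osc w ε z ^ 2)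

/-- `f ε` is controlled by the trilinear expression. -/
def TrilinearBound (u : SpaceTime d → F₁) (w : SpaceTime d → F₂) (f : ℝ → SpaceTime d → ℝ) :
    Prop :=
  ∃ K, 0 ≤ K ∧ ∀ ε > 0, ∀ z, |f ε z| ≤ K * trilinear u w ε z

namespace TrilinearBound

variable {f g : ℝ → SpaceTime d → ℝ}

theorem add (hf : TrilinearBound u w f) (hg : TrilinearBound u w g) :
    TrilinearBound u w fun ε z => f ε z + g ε z := by
  obtain ⟨K, hK0, hK⟩ := hf
  obtain ⟨K', hK0', hK'⟩ := hg
  refine ⟨K + K', by positivity, fun ε hε z => (abs_add_le _ _).trans ?_⟩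
  rw [add_mul]
  exact add_le_add (hK ε hε z) (hK' ε hε z)

theorem sum {ι : Type*} {s : Finset ι} {f : ι → ℝ → SpaceTime d → ℝ}
    (h : ∀ i, TrilinearBound u w (f i)) : TrilinearBound u w fun ε z => ∑ i ∈ s, f i ε z := by
  classical
  induction s using Finset.induction_on with
  | empty => exact ⟨0, le_rfl, by simp⟩
  | insert i s hi ih => simpa only [Finset.sum_insert hi] using (h i).add ih

theorem bm_mul {φ : SpaceTime d → ℝ} (hφ : BM φ) (hf : TrilinearBound u w f) :
    TrilinearBound u w fun ε z => φ z * f ε z := by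
  obtain ⟨K, hK0, hK⟩ := hf
  obtain ⟨C, hC⟩ := hφ.bdd
  have hC0 : 0 ≤ C := (abs_nonneg _).trans (hC 0)
  refine ⟨C * K, by positivity, fun ε hε z => ?_⟩
  rw [abs_mul, mul_assoc]
  exact mul_le_mul (hC z) (hK ε hε z) (abs_nonneg _) hC0

/-- Expand the product of three linear forms in the oscillations x of u and y of w. The hypothesis
`hzero` removes exactly the coefficient of y³, the monomial that `trilinear` does not contain; all
other coefficients are bounded by (a + b)(a' + b')(c + c'). -/
theorem of_mul {p q : ℝ → SpaceTime d → ℝ} {a a' b' c c' b K L : ℝ} (ha : 0 ≤ a) (hb : 0 ≤ b)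
    (ha' : 0 ≤ a') (hb' : 0 ≤ b') (hc : 0 ≤ c) (hc' : 0 ≤ c') (hK : 0 ≤ K) (hL : 0 ≤ L)
    (hzero : b * b' * c' = 0)
    (hp : ∀ ε > 0, ∀ z, |p ε z| ≤ K * (osc₂ u w a b ε z * osc₂ u w a' b' ε z))
    (hq : ∀ ε > 0, ∀ z, |q ε z| ≤ ε⁻¹ * (L * osc₂ u w c c' ε z)) :
    TrilinearBound u w fun ε z => p ε z * q ε z := by
  refine ⟨K * L * ((a + b) * (a' + b') * (c + c')), by positivity, fun ε hε z => ?_⟩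
  have hx := osc_nonneg u ε z
  have hy := osc_nonneg w ε z
  set x := osc u ε z
  set y := osc w ε z
  rw [abs_mul]
  have hq0 := (abs_nonneg _).trans (hp ε hε z)
  refine (mul_le_mul (hp ε hε z) (hq ε hε z) (abs_nonneg _) hq0).trans ?_
  have e : K * (osc₂ u w a b ε z * osc₂ u w a' b' ε z) * (ε⁻¹ * (L * osc₂ u w c c' ε z)) =
      K * L * (ε⁻¹ * (osc₂ u w a b ε z * osc₂ u w a' b' ε z * osc₂ u w c c' ε z)) := by ring
  rw [e, mul_assoc (K * L)]
  refine mul_le_mul_of_nonneg_left ?_ (by positivity)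
  have e2 : (a + b) * (a' + b') * (c + c') * trilinear u w ε z =
    ε⁻¹ * ((a + b) * (a' + b') * (c + c') * (x ^ 3 + x ^ 2 * y + x * y ^ 2)) := by
    unfold trilinear; ring
  rw [e2]
  refine mul_le_mul_of_nonneg_left ?_ (inv_nonneg.2 hε.le)
  have h3 : osc₂ u w a b ε z * osc₂ u w a' b' ε z * osc₂ u w c c' ε z =
    a * a' * c * x ^ 3 + (a * a' * c' + a * b' * c + b * a' * c) * (x ^ 2 * y) +
    (a * b' * c' + b * a' * c' + b * b' * c) * (x * y ^ 2) + b * b' * c' * y ^ 3 := by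
    unfold osc₂; ring
  rw [h3, hzero]
  have t1 : 0 ≤ x ^ 3 := by positivity
  have t2 : 0 ≤ x ^ 2 * y := by positivity
  have t3 : 0 ≤ x * y ^ 2 := by positivity
  have s1 : a * a' * c ≤ (a + b) * (a' + b') * (c + c') := by
    gcongr <;> linarith
  have s2 : a * a' * c' + a * b' * c + b * a' * c ≤ (a + b) * (a' + b') * (c + c') := by
    have : 0 ≤ a * a' * c + a * b' * c' + b * a' * c' + b * b' * c + b * b' * c' := by positivity
    nlinarith
  have s3 : a * b' * c' + b * a' * c' + b * b' * c ≤ (a + b) * (a' + b') * (c + c') := by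
    have : 0 ≤ a * a' * c + a * a' * c' + a * b' * c + b * a' * c + b * b' * c' := by positivity
    nlinarith
  nlinarith [mul_le_mul_of_nonneg_right s1 t1, mul_le_mul_of_nonneg_right s2 t2,
    mul_le_mul_of_nonneg_right s3 t3]

end TrilinearBound

end EulerKorteweg

/-! ### Mollified solutions and their derivative-carrying errors. -/

namespace EulerKorteweg

set_option linter.unusedSectionVars false

variable {d : ℕ} {T : ℝ}

/-- The potential, for `H` and `K` given on the whole line. -/
noncomputable def pot (H K : ℝ → ℝ) (ρ : SpaceTime d → ℝ) (q : SpaceTime d → Vec d)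
    (r : SpaceTime d → ℝ) (z : SpaceTime d) : ℝ :=
  deriv H (ρ z) - 1 / 2 * deriv K (ρ z) * ∑ i, q z i ^ 2 - K (ρ z) * r z

/-- Bounded measurable solutions of the Euler-Korteweg system, extended by zero, for `H` and `K`
given on the whole line. -/
structure Solution (T : ℝ) (H K : ℝ → ℝ) (ρ : SpaceTime d → ℝ) (u q : SpaceTime d → Vec d)
    (r : SpaceTime d → ℝ) : Prop where
  contDiff_H : ContDiff ℝ 3 H
  contDiff_K : ContDiff ℝ 3 K
  bmv_u : BMV u
  bmv_q : BMV q
  density : DensityData T ρ (fun j z => q z j) r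
  supp_u : ∀ i, TimeSupp 0 T fun z => u z i
  continuity : ∀ φ : SpaceTime d → ℝ, IsTest T ⊤ φ →
    ∫ z, (ρ z * pd et φ z + ∑ j, ρ z * u z j * pd (ex j) φ z) ∂(domainMeasure d T) = 0
  momentum : ∀ i : Fin d, ∀ φ : SpaceTime d → ℝ, IsTest T ⊤ φ →
    ∫ z, (ρ z * u z i * pd et φ z + ∑ j, ρ z * u z i * u z j * pd (ex j) φ z
      + pot H K ρ q r z * (φ z * q z i + ρ z * pd (ex i) φ z)) ∂(domainMeasure d T) = 0

/-- The regularization of the fields at scale `ε`. -/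
noncomputable def molFields (H K : ℝ → ℝ) (ρ : SpaceTime d → ℝ) (u q : SpaceTime d → Vec d)
    (r : SpaceTime d → ℝ) (ε : ℝ) : Fields d where
  P := mol ε ρ
  U i := mol ε fun z => u z i
  Q i := mol ε fun z => q z i
  R := mol ε r
  m i := mol ε fun z => ρ z * u z i
  B i j := mol ε fun z => ρ z * u z i * u z j
  Pi := mol ε fun z => pot H K ρ q r z * ρ z
  S i := mol ε fun z => pot H K ρ q r z * q z i

/-- The increments of `ρ`, `∇ρ` and `Δρ` are measured together. -/
def densityTriple (ρ : SpaceTime d → ℝ) (q : SpaceTime d → Vec d) (r : SpaceTime d → ℝ)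
    (z : SpaceTime d) : ℝ × Vec d × ℝ := (ρ z, q z, r z)

theorem BM.bmv {f : SpaceTime d → ℝ} (hf : BM f) : BMV f := ⟨hf.1, hf.2⟩

theorem BMV.bm {w : SpaceTime d → Vec d} (hw : BMV w) (i : Fin d) : BM fun z => w z i := by
  obtain ⟨C, hC⟩ := hw.bdd
  exact ⟨(measurable_pi_apply i).comp ((MeasurableEquiv.toLp 2 (Fin d → ℝ)).symm.measurable.comp hw.1),
    C, fun z => (PiLp.norm_apply_le (w z) i).trans (hC z)⟩

namespace Solution

variable {H K : ℝ → ℝ} {ρ r : SpaceTime d → ℝ} {u q : SpaceTime d → Vec d}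
variable (s : Solution T H K ρ u q r)
include s

theorem bmv_w : BMV (densityTriple ρ q r) :=
  s.density.bm_ρ.bmv.prodMk (s.bmv_q.prodMk s.density.bm_r.bmv)

theorem contDiff_dH : ContDiff ℝ 2 (deriv H) := Fields.contDiff_deriv_of_three s.contDiff_H

theorem contDiff_dK : ContDiff ℝ 2 (deriv K) := Fields.contDiff_deriv_of_three s.contDiff_K

theorem bm_pot : BM (pot H K ρ q r) :=
  ((s.density.bm_ρ.comp s.contDiff_dH.continuous).sub (((BM.const _).mul
    (s.density.bm_ρ.comp s.contDiff_dK.continuous)).mul (BM.sum fun i => by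
      simpa only [sq] using (s.bmv_q.bm i).mul (s.bmv_q.bm i)))).sub
    ((s.density.bm_ρ.comp s.contDiff_K.continuous).mul s.density.bm_r)

theorem bm_mom (i : Fin d) : BM fun z => ρ z * u z i := s.density.bm_ρ.mul (s.bmv_u.bm i)

theorem bm_flux (i j : Fin d) : BM fun z => ρ z * u z i * u z j := (s.bm_mom i).mul (s.bmv_u.bm j)

theorem supp_mom (i : Fin d) : TimeSupp 0 T fun z => ρ z * u z i := s.density.supp_ρ.mul_right _

theorem smooth {ε : ℝ} (hε : 0 < ε) : (molFields H K ρ u q r ε).Smooth where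
  P := sm_mol hε s.density.bm_ρ (n := 3)
  U i := sm_mol hε (s.bmv_u.bm i) (n := 3)
  Q i := sm_mol hε (s.bmv_q.bm i) (n := 3)
  R := sm_mol hε s.density.bm_r (n := 3)
  m i := sm_mol hε (s.bm_mom i) (n := 3)
  B i j := sm_mol hε (s.bm_flux i j) (n := 3)
  Pi := sm_mol hε (s.bm_pot.mul s.density.bm_ρ) (n := 3)

theorem pd_et_mol {δ ε : ℝ} (hε : 0 < ε) (hδ : ε < δ) {z : SpaceTime d}
    (hz : z.1 ∈ Set.Ioo δ (T - δ)) :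
    pd et (mol ε ρ) z + ∑ j, pd (ex j) (mol ε fun z => ρ z * u z j) z = 0 := by
  -- Mass conservation is a vanishing space-time divergence: `none` indexes the time direction and
  -- `some j` the flux in direction j.
  have h := sum_pd_mol_eq (ι := Option (Fin d)) (T := T)
    (v := fun k => k.elim et ex) (f := fun k => k.elim ρ fun j z => ρ z * u z j) (g := fun _ => 0)
    (by rintro (_ | j); exacts [s.density.bm_ρ, s.bm_mom j])
    (by rintro (_ | j); exacts [s.density.supp_ρ, s.supp_mom j]) (BM.const 0) (fun _ _ => rfl)
    (fun φ hφ => by simpa [Fintype.sum_option] using s.continuity φ hφ) hε hδ hz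
  simpa [Fintype.sum_option, mol_const] using h

theorem pd_et_mol_mom (i : Fin d) {δ ε : ℝ} (hε : 0 < ε) (hδ : ε < δ) {z : SpaceTime d}
    (hz : z.1 ∈ Set.Ioo δ (T - δ)) :
    pd et (mol ε fun z => ρ z * u z i) z +
      ∑ j, pd (ex j) (mol ε fun z => ρ z * u z i * u z j) z +
      pd (ex i) (mol ε fun z => pot H K ρ q r z * ρ z) z =
      mol ε (fun z => pot H K ρ q r z * q z i) z := by
  have hφi : ∀ {φ : SpaceTime d → ℝ}, IsTest T ⊤ φ → ∀ v, BM (pd v φ) := fun hφ v =>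
    BM.of_continuous ((hφ.sm.of_le (by simp)).continuous_pd v)
      (hasCompactSupport_pd hφ.hasCompactSupport v)
  -- With -ρ∂ᵢμ = -∂ᵢ(μρ) + μ∂ᵢρ, the function μρ becomes one more flux, in direction i, and μ∂ᵢρ is
  -- the right-hand side. The index `some none` stands for this extra flux.
  have h := sum_pd_mol_eq (ι := Option (Option (Fin d))) (T := T)
    (v := fun k => k.elim et fun k => k.elim (ex i) ex)
    (f := fun k => k.elim (fun z => ρ z * u z i) fun k => k.elim (fun z => pot H K ρ q r z * ρ z)
      fun j z => ρ z * u z i * u z j) (g := fun z => pot H K ρ q r z * q z i)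
    (by rintro (_ | _ | j); exacts [s.bm_mom i, s.bm_pot.mul s.density.bm_ρ, s.bm_flux i j])
    (by rintro (_ | _ | j)
        exacts [s.supp_mom i, s.density.supp_ρ.mul_left _, (s.supp_mom i).mul_right _])
    (s.bm_pot.mul (s.bmv_q.bm i)) ((s.density.supp_q i).mul_left _)
    (fun φ hφ => by
      have h := s.momentum i φ hφ
      rw [← add_eq_zero_iff_eq_neg, ← integral_add, ← h]
      · congr 1; ext z
        simp only [Fintype.sum_option, Option.elim]
        ring
      · exact BM.integrable_domain (BM.sum fun k => by
          rcases k with (_ | _ | j)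
          exacts [(s.bm_mom i).mul (hφi hφ _), (s.bm_pot.mul s.density.bm_ρ).mul (hφi hφ _),
            (s.bm_flux i j).mul (hφi hφ _)])
      · exact ((s.bm_pot.mul (s.bmv_q.bm i)).mul hφ.bm).integrable_domain) hε hδ hz
  simp only [Fintype.sum_option, Option.elim] at h
  rw [← h]; ring

theorem balance {δ ε : ℝ} (hε : 0 < ε) (hδ : ε < δ) {z : SpaceTime d}
    (hz : z.1 ∈ Set.Ioo δ (T - δ)) {F : Fields d} (hF : F = molFields H K ρ u q r ε) :
    pd et (F.en H K) z + ∑ j, (pd (ex j) (F.fl H K j) z - pd (ex j) (F.work K j) z) +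
      ∑ i, F.U i z * (pd et (F.a i) z + ∑ j, pd (ex j) (F.b i j) z + pd (ex i) (F.c H K) z -
        F.e H K i z) - ∑ i, F.a i z * pd (ex i) (F.mu H K) z = 0 := by
  subst hF
  refine (s.smooth hε).balance s.contDiff_H s.contDiff_K (fun j => s.density.pd_mol_ρ hε hδ hz j)
    (fun j => ?_) (s.density.sum_pd_mol_q hε hδ hz) (s.pd_et_mol hε hδ hz)
    (fun i => s.pd_et_mol_mom i hε hδ hz)
  -- The identity ∂ⱼP = Qⱼ holds on an open time strip, hence may be differentiated in time there.
  exact (pd_comm (sm_mol hε s.density.bm_ρ (n := 2)) (ex j) et z).trans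
    (pd_congr (isOpen_timeStrip δ (T - δ)) (fun w hw => s.density.pd_mol_ρ hε hδ hw j) et hz)

/-! ### The errors with derivatives -/

theorem dom_ρ : Dom u (densityTriple ρ q r) 0 1 ρ :=
  ⟨s.bmv_u, s.bmv_w, s.density.bm_ρ, le_rfl, zero_le_one, fun z z' => by
    rw [zero_mul, zero_add, one_mul]
    exact norm_fst_le (densityTriple ρ q r z' - densityTriple ρ q r z)⟩

theorem dom_q (i : Fin d) : Dom u (densityTriple ρ q r) 0 1 fun z => q z i :=
  ⟨s.bmv_u, s.bmv_w, s.bmv_q.bm i, le_rfl, zero_le_one, fun z z' => by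
    rw [zero_mul, zero_add, one_mul]
    exact (PiLp.norm_apply_le (q z' - q z) i).trans ((norm_fst_le _).trans
      (norm_snd_le (densityTriple ρ q r z' - densityTriple ρ q r z)))⟩

theorem dom_r : Dom u (densityTriple ρ q r) 0 1 r :=
  ⟨s.bmv_u, s.bmv_w, s.density.bm_r, le_rfl, zero_le_one, fun z z' => by
    rw [zero_mul, zero_add, one_mul]
    exact (norm_snd_le _).trans
      (norm_snd_le (densityTriple ρ q r z' - densityTriple ρ q r z))⟩

theorem dom_u (i : Fin d) : Dom u (densityTriple ρ q r) 1 0 fun z => u z i :=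
  ⟨s.bmv_u, s.bmv_w, s.bmv_u.bm i, zero_le_one, le_rfl, fun z z' => by
    rw [zero_mul, add_zero, one_mul]
    exact PiLp.norm_apply_le (u z' - u z) i⟩

theorem exists_dom_mom (i : Fin d) :
    ∃ C, 0 ≤ C ∧ Dom u (densityTriple ρ q r) C C fun z => ρ z * u z i := by
  obtain ⟨C, hC⟩ := s.density.bm_ρ.bdd
  obtain ⟨D, hD⟩ := (s.bmv_u.bm i).bdd
  have h := s.dom_ρ.mul (s.dom_u i) (C := max C D) (fun z => (hC z).trans (le_max_left _ _))
    fun z => (hD z).trans (le_max_right _ _)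
  rw [zero_add, add_zero, mul_one] at h
  exact ⟨_, h.4, h⟩

theorem regularizes_pot : Regularizes u (densityTriple ρ q r) (pot H K ρ q r)
    fun ε => (molFields H K ρ u q r ε).mu H K := by
  have hc := Regularizes.const s.bmv_u s.bmv_w (1 / 2)
  have hq := Regularizes.sum (s := Finset.univ) s.bmv_u s.bmv_w
    fun i => (s.dom_q i).regularizes.mul (s.dom_q i).regularizes
  have h := ((s.dom_ρ.regularizes_comp s.contDiff_dH).sub
    ((hc.mul (s.dom_ρ.regularizes_comp s.contDiff_dK)).mul hq)).sub
    ((s.dom_ρ.regularizes_comp (s.contDiff_K.of_le (by norm_num))).mul s.dom_r.regularizes)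
  simp only [← sq] at h
  exact h

/-- Count the increments: a is wu, b is (u+w)u, c is ww; derivatives of U give u, those of mu give
w. The four products are wu·u, (u+w)u·u, ww·u and wu·w, and none is www. The bound for c needs mu
and not merely the mollified potential, which is why `Regularizes` tracks its distance. -/
theorem trilinearBound_hard {φ : SpaceTime d → ℝ} (hφ : BM φ) :
    TrilinearBound u (densityTriple ρ q r) fun ε => (molFields H K ρ u q r ε).hard H K φ := by
  set w := densityTriple ρ q r with hw
  obtain ⟨A, hA0, hA⟩ := exists_abs_mol_mul_sub_le (F₁ := Vec d) (F₂ := ℝ × Vec d × ℝ) d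
  have ha : ∀ i, ∀ ε > 0, ∀ z, |(molFields H K ρ u q r ε).a i z| ≤
      A * (osc₂ u w 0 1 ε z * osc₂ u w 1 0 ε z) := fun i ε _ z =>
    hA u w _ _ _ _ _ _ s.dom_ρ (s.dom_u i) ε z
  have hU : ∀ v, ∃ L, 0 ≤ L ∧ ∀ i, ∀ ε > 0, ∀ z, |pd v ((molFields H K ρ u q r ε).U i) z| ≤
      ε⁻¹ * (L * osc₂ u w 1 0 ε z) := fun v => by
    obtain ⟨L, hL0, hL⟩ := exists_abs_pd_mol_le (F₁ := Vec d) (F₂ := ℝ × Vec d × ℝ) v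
    exact ⟨L, hL0, fun i ε hε z => hL u w _ _ _ (s.dom_u i) ε hε z⟩
  have hb : ∀ i j, ∃ C, 0 ≤ C ∧ ∀ ε > 0, ∀ z, |(molFields H K ρ u q r ε).b i j z| ≤
      A * (osc₂ u w C C ε z * osc₂ u w 1 0 ε z) := fun i j => by
    obtain ⟨C, hC0, hC⟩ := s.exists_dom_mom j
    refine ⟨C, hC0, fun ε _ z => ?_⟩
    have h := hA u w _ _ _ _ _ _ hC (s.dom_u i) ε z
    -- The flux ρuᵢuⱼ is grouped as (ρuⱼ)uᵢ to match the product mⱼUᵢ.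
    simp only [Fields.b, molFields]
    simpa only [mul_right_comm] using h
  have hc : ∃ C, 0 ≤ C ∧ ∀ ε > 0, ∀ z, |(molFields H K ρ u q r ε).c H K z| ≤
      C * (osc₂ u w 0 1 ε z * osc₂ u w 0 1 ε z) := by
    obtain ⟨C, hC0, hC⟩ := (s.regularizes_pot.mul s.dom_ρ.regularizes).close
    refine ⟨C, hC0, fun ε _ z => ?_⟩
    rw [osc₂_zero_left, one_mul]
    exact hC ε z
  have hmu : ∀ v, ∃ L, 0 ≤ L ∧ ∀ ε > 0, ∀ z, |pd v ((molFields H K ρ u q r ε).mu H K) z| ≤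
      ε⁻¹ * (L * osc₂ u w 0 1 ε z) := fun v => by
    obtain ⟨L, hL0, hL⟩ := s.regularizes_pot.pd v
    refine ⟨L, hL0, fun ε hε z => ?_⟩
    rw [osc₂_zero_left, one_mul]
    exact hL ε hε z
  obtain ⟨Cc, hCc0, hCc⟩ := hc
  refine TrilinearBound.sum fun i => TrilinearBound.bm_mul hφ ?_
  refine TrilinearBound.add (TrilinearBound.add (TrilinearBound.add ?_ ?_) ?_) ?_
  · obtain ⟨L, hL0, hL⟩ := hU et
    exact TrilinearBound.of_mul le_rfl zero_le_one zero_le_one le_rfl zero_le_one le_rfl hA0 hL0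
      (by simp) (ha i) (hL i)
  · refine TrilinearBound.sum fun j => ?_
    obtain ⟨L, hL0, hL⟩ := hU (ex j)
    obtain ⟨C, hC0, hC⟩ := hb i j
    exact TrilinearBound.of_mul hC0 hC0 zero_le_one le_rfl zero_le_one le_rfl hA0 hL0
      (by simp) hC (hL i)
  · obtain ⟨L, hL0, hL⟩ := hU (ex i)
    exact TrilinearBound.of_mul le_rfl zero_le_one le_rfl zero_le_one zero_le_one le_rfl hCc0 hL0
      (by simp) hCc (hL i)
  · obtain ⟨L, hL0, hL⟩ := hmu (ex i)
    exact TrilinearBound.of_mul le_rfl zero_le_one zero_le_one le_rfl le_rfl zero_le_one hA0 hL0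
      (by simp) (ha i) hL

end Solution

end EulerKorteweg

/-! ### The limit of the mollified energy balance. -/

namespace EulerKorteweg

set_option linter.unusedSectionVars false

variable {d : ℕ} {T : ℝ}

/-- The energy density, for `H` and `K` given on the whole line. -/
noncomputable def lineEnergy (H K : ℝ → ℝ) (ρ : SpaceTime d → ℝ) (u q : SpaceTime d → Vec d)
    (z : SpaceTime d) : ℝ :=
  1 / 2 * ρ z * ∑ i, u z i ^ 2 + H (ρ z) + 1 / 2 * K (ρ z) * ∑ i, q z i ^ 2

/-- The transport part of the energy flux, for `H` and `K` given on the whole line. -/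
noncomputable def lineFlux (H K : ℝ → ℝ) (ρ : SpaceTime d → ℝ) (u q : SpaceTime d → Vec d)
    (r : SpaceTime d → ℝ) (i : Fin d) (z : SpaceTime d) : ℝ :=
  (1 / 2 * ∑ i, u z i ^ 2 + pot H K ρ q r z) * (ρ z * u z i)

/-- The regular terms of the energy balance, for `H` and `K` given on the whole line. -/
noncomputable def lineTerms (T : ℝ) (H K : ℝ → ℝ) (ρ : SpaceTime d → ℝ) (u q : SpaceTime d → Vec d)
    (r : SpaceTime d → ℝ) (φ : SpaceTime d → ℝ) : ℝ :=
  (∫ z, lineEnergy H K ρ u q z * pd et φ z ∂(domainMeasure d T)) +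
    ∫ z, ∑ i, lineFlux H K ρ u q r i z * pd (ex i) φ z ∂(domainMeasure d T)

theorem IsTest.bm_pd {n : ℕ∞} {φ : SpaceTime d → ℝ} (hφ : IsTest T n φ) (hn : 1 ≤ n)
    (v : ℝ × Vec d) : BM (EulerKorteweg.pd v φ) :=
  BM.of_continuous ((hφ.sm.of_le (by exact_mod_cast hn)).continuous_pd v)
    (hasCompactSupport_pd hφ.hasCompactSupport v)

namespace Solution

variable {H K : ℝ → ℝ} {ρ r : SpaceTime d → ℝ} {u q : SpaceTime d → Vec d}
variable (s : Solution T H K ρ u q r) {ε : ℕ → ℝ} (hε : ∀ n, 0 < ε n)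
  (hε0 : Tendsto ε atTop (𝓝 0))
include s hε hε0

theorem l1Conv_ρ : L1Conv T (fun n => mol (ε n) ρ) ρ :=
  l1Conv_mol s.density.bm_ρ s.density.supp_ρ hε hε0

theorem l1Conv_q (i : Fin d) : L1Conv T (fun n => mol (ε n) fun z => q z i) (fun z => q z i) :=
  l1Conv_mol (s.bmv_q.bm i) (s.density.supp_q i) hε hε0

theorem l1Conv_u (i : Fin d) : L1Conv T (fun n => mol (ε n) fun z => u z i) (fun z => u z i) :=
  l1Conv_mol (s.bmv_u.bm i) (s.supp_u i) hε hε0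

theorem l1Conv_mom (i : Fin d) :
    L1Conv T (fun n => mol (ε n) fun z => ρ z * u z i) (fun z => ρ z * u z i) :=
  l1Conv_mol (s.bm_mom i) (s.supp_mom i) hε hε0

theorem l1Conv_mu :
    L1Conv T (fun n => (molFields H K ρ u q r (ε n)).mu H K) (pot H K ρ q r) := by
  have hρ := s.l1Conv_ρ hε hε0
  have hq := fun i => s.l1Conv_q hε hε0 i
  have hqq := L1Conv.sum (s := Finset.univ) fun i => (hq i).mul (hq i)
  have hr : L1Conv T (fun n => mol (ε n) r) r :=
    l1Conv_mol s.density.bm_r s.density.supp_r hε hε0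
  have h := ((hρ.comp (s.contDiff_dH.of_le (by norm_num))).sub
    (((hρ.comp (s.contDiff_dK.of_le (by norm_num))).const_mul (1 / 2)).mul hqq)).sub
    ((hρ.comp (s.contDiff_K.of_le (by norm_num))).mul hr)
  simp only [← sq] at h
  exact h

theorem l1Conv_uu : L1Conv T (fun n z => ∑ i, mol (ε n) (fun z => u z i) z ^ 2)
    fun z => ∑ i, u z i ^ 2 := by
  have hu := fun i => s.l1Conv_u hε hε0 i
  have h := L1Conv.sum (s := Finset.univ) fun i => (hu i).mul (hu i)
  simpa only [← sq] using h

theorem l1Conv_en : L1Conv T (fun n => (molFields H K ρ u q r (ε n)).en H K)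
    (lineEnergy H K ρ u q) := by
  have hρ := s.l1Conv_ρ hε hε0
  have hq := fun i => s.l1Conv_q hε hε0 i
  have hqq := L1Conv.sum (s := Finset.univ) fun i => (hq i).mul (hq i)
  simp only [← sq] at hqq
  exact (((hρ.const_mul (1 / 2)).mul (s.l1Conv_uu hε hε0)).add
    (hρ.comp (s.contDiff_H.of_le (by norm_num)))).add
    (((hρ.comp (s.contDiff_K.of_le (by norm_num))).const_mul (1 / 2)).mul hqq)

theorem l1Conv_fl (j : Fin d) : L1Conv T (fun n => (molFields H K ρ u q r (ε n)).fl H K j)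
    (lineFlux H K ρ u q r j) :=
  (((s.l1Conv_uu hε hε0).const_mul (1 / 2)).add (s.l1Conv_mu hε hε0)).mul (s.l1Conv_mom hε hε0 j)

/-- No derivative falls on the fields, so all factors converge boundedly in L¹, and each commutator
has limit zero. -/
theorem tendsto_soft {φ : SpaceTime d → ℝ} (hφ : IsTest T 1 φ) :
    Tendsto (fun n => ∫ z, (molFields H K ρ u q r (ε n)).soft H K φ z) atTop (𝓝 0) := by
  have hρ := s.l1Conv_ρ hε hε0
  have hu := fun i => s.l1Conv_u hε hε0 i
  have hq := fun i => s.l1Conv_q hε hε0 i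
  have hm := fun i => s.l1Conv_mom hε hε0 i
  have hmu := s.l1Conv_mu hε hε0
  have hB : ∀ i j, L1Conv T (fun n => mol (ε n) fun z => ρ z * u z i * u z j)
      fun z => ρ z * u z i * u z j := fun i j =>
    l1Conv_mol (s.bm_flux i j) ((s.supp_mom i).mul_right _) hε hε0
  have hPi : L1Conv T (fun n => mol (ε n) fun z => pot H K ρ q r z * ρ z)
      fun z => pot H K ρ q r z * ρ z :=
    l1Conv_mol (s.bm_pot.mul s.density.bm_ρ) (s.density.supp_ρ.mul_left _) hε hε0
  have hS : ∀ i, L1Conv T (fun n => mol (ε n) fun z => pot H K ρ q r z * q z i)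
      fun z => pot H K ρ q r z * q z i := fun i =>
    l1Conv_mol (s.bm_pot.mul (s.bmv_q.bm i)) ((s.density.supp_q i).mul_left _) hε hε0
  have hd := fun v => (hφ.bm_pd le_rfl v).l1Conv (T := T)
  have h : L1Conv T (fun n => (molFields H K ρ u q r (ε n)).soft H K φ) _ :=
    L1Conv.sum (s := Finset.univ) fun i => (hu i).mul
      (((((hm i).sub (hρ.mul (hu i))).mul (hd et)).add (L1Conv.sum (s := Finset.univ) fun j =>
        ((hB i j).sub ((hm j).mul (hu i))).mul (hd (ex j)))).add
        ((hPi.sub (hmu.mul hρ)).mul (hd (ex i))) |>.add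
        (((hS i).sub (hmu.mul (hq i))).mul hφ.bm.l1Conv))
  have h0 := h.tendsto_integral
  have e : (fun z => ∑ i, u z i * ((ρ z * u z i - ρ z * u z i) * pd et φ z +
      ∑ j, (ρ z * u z i * u z j - ρ z * u z j * u z i) * pd (ex j) φ z +
      (pot H K ρ q r z * ρ z - pot H K ρ q r z * ρ z) * pd (ex i) φ z +
      (pot H K ρ q r z * q z i - pot H K ρ q r z * q z i) * φ z)) = fun _ => 0 := by
    ext z
    refine Finset.sum_eq_zero fun i _ => ?_
    rw [Finset.sum_eq_zero fun j _ => by ring]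
    ring
  simp only [e, integral_zero] at h0
  refine h0.congr fun n => integral_domain_eq ?_
  obtain ⟨δ, hδ, hs⟩ := hφ.exists_timeSupp
  have hs0 : TimeSupp 0 T φ := hs.mono hδ.le (by linarith)
  intro z hz
  have h1 : ∀ v, pd v φ z = 0 := fun v => hs0.pd v z hz
  simp [Fields.soft, h1, hs0 z hz]

/-- The work of the interstitial stress balances the regular terms, in the limit. -/
theorem tendsto_work {α β : ℝ} (hβα : β ≤ α) (hαβ : 1 < α + 2 * β) (hub : OscBound T α u)
    (hwb : OscBound T β (densityTriple ρ q r)) {φ : SpaceTime d → ℝ} (hφ : IsTest T 1 φ)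
    {δ : ℝ} (hδ : 0 < δ) (hs : TimeSupp δ (T - δ) φ) (hεδ : ∀ n, ε n < min (δ / 2) 1) :
    Tendsto (fun n => ∫ z, ∑ j, (molFields H K ρ u q r (ε n)).work K j z * pd (ex j) φ z) atTop
      (𝓝 (lineTerms T H K ρ u q r φ)) := by
  have hs0 : TimeSupp 0 T φ := hs.mono hδ.le (by linarith)
  have hsm : Sm 1 φ := hφ.sm
  have h1 : Tendsto (fun n => ∫ z, (molFields H K ρ u q r (ε n)).en H K z * pd et φ z) atTop
      (𝓝 (∫ z, lineEnergy H K ρ u q z * pd et φ z ∂(domainMeasure d T))) := by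
    have h := ((s.l1Conv_en hε hε0).mul (hφ.bm_pd le_rfl et).l1Conv).tendsto_integral
    exact h.congr fun n => integral_domain_eq ((hs0.pd et).mul_left _)
  have h2 : Tendsto (fun n => ∫ z, ∑ j, (molFields H K ρ u q r (ε n)).fl H K j z * pd (ex j) φ z)
      atTop (𝓝 (∫ z, ∑ i, lineFlux H K ρ u q r i z * pd (ex i) φ z ∂(domainMeasure d T))) := by
    have h := (L1Conv.sum (s := Finset.univ) fun j => (s.l1Conv_fl hε hε0 j).mul
      (hφ.bm_pd le_rfl (ex j)).l1Conv).tendsto_integral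
    refine h.congr fun n => integral_domain_eq fun z hz => Finset.sum_eq_zero fun j _ => ?_
    rw [hs0.pd (ex j) z hz, mul_zero]
  have h3 : Tendsto (fun n => ∫ z, (molFields H K ρ u q r (ε n)).hard H K φ z) atTop (𝓝 0) := by
    obtain ⟨C, hC0, hC⟩ := s.trilinearBound_hard hφ.bm
    refine tendsto_integral_of_trilinear_bound hβα hαβ s.bmv_u s.bmv_w hub hwb hε
      (fun n => (hεδ n).trans_le (min_le_min_right 1 (by linarith : δ / 2 ≤ δ))) hε0
      (fun n z hz => ?_) hC0 fun n z => hC (ε n) (hε n) z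
    simp [Fields.hard, hs z hz]
  have h4 := s.tendsto_soft hε hε0 hφ
  have h5 := ((h1.add h2).add h3).add h4
  rw [add_zero, add_zero] at h5
  refine h5.congr fun n => ?_
  -- The scales stay below δ/2, so the pointwise balance holds wherever φ does not vanish. It
  -- expresses the work through the four terms whose limits are known.
  have hb := (s.smooth (hε n)).integral_balance
    (fun i => (sm_mol (hε n) (s.bm_pot.mul (s.bmv_q.bm i)) (n := 0)).continuous)
    s.contDiff_H s.contDiff_K hsm hφ.hasCompactSupport (fun z hz =>
      s.balance (hε n) ((hεδ n).trans_le (min_le_left _ _)) (z := z) (by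
        have : z.1 ∈ Set.Icc δ (T - δ) := by_contra fun h => hz (hs z h)
        exact ⟨by linarith [this.1], by linarith [this.2]⟩) rfl)
  linarith

/-- The same, with the divergence of the mollified momentum. -/
theorem tendsto_div {α β : ℝ} (hβα : β ≤ α) (hαβ : 1 < α + 2 * β) (hub : OscBound T α u)
    (hwb : OscBound T β (densityTriple ρ q r)) {φ : SpaceTime d → ℝ} (hφ : IsTest T 1 φ)
    {δ : ℝ} (hδ : 0 < δ) (hs : TimeSupp δ (T - δ) φ) (hεδ : ∀ n, ε n < min (δ / 2) 1) :
    Tendsto (fun n => ∫ z, (∑ k, pd (ex k) (mol (ε n) fun z => ρ z * u z k) z) *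
      ∑ j, K (mol (ε n) ρ z) * mol (ε n) (fun z => q z j) z * pd (ex j) φ z) atTop
      (𝓝 (-lineTerms T H K ρ u q r φ)) := by
  refine (s.tendsto_work hε hε0 hβα hαβ hub hwb hφ hδ hs hεδ).neg.congr fun n => ?_
  rw [← integral_neg]
  congr 1; ext z
  by_cases hz : z.1 ∈ Set.Icc δ (T - δ)
  · have h := s.pd_et_mol (hε n) ((hεδ n).trans_le (min_le_left _ _)) (z := z)
      ⟨by linarith [hz.1], by linarith [hz.2]⟩
    rw [← neg_eq_iff_add_eq_zero] at h
    rw [← h, Finset.mul_sum, ← Finset.sum_neg_distrib]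
    refine Finset.sum_congr rfl fun j _ => ?_
    simp only [Fields.work, molFields]
    ring
  · simp [hs.pd (ex _) z hz]

end Solution

end EulerKorteweg

/-! ### The interstitial work in the limit and the local energy balance. -/

namespace EulerKorteweg

set_option linter.unusedSectionVars false

variable {d : ℕ} {T : ℝ}

theorem BM.mul_integrable {μ : Measure (SpaceTime d)} {f N : SpaceTime d → ℝ} (hf : BM f)
    (hN : Integrable N μ) : Integrable (fun z => f z * N z) μ := by
  obtain ⟨C, hC⟩ := hf.bdd
  exact hN.bdd_mul (c := C) hf.1.aestronglyMeasurable (Eventually.of_forall hC)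

/-- `N i j` is the weak derivative `∂ⱼqᵢ`, and is square integrable. -/
def IsWeakJacobian (T : ℝ) (q : SpaceTime d → Vec d) (N : Fin d → Fin d → SpaceTime d → ℝ) : Prop :=
  ∀ i j, MemLp (N i j) 2 (domainMeasure d T) ∧ ∀ φ : SpaceTime d → ℝ, IsTest T ⊤ φ →
    ∫ z, q z i * pd (ex j) φ z ∂(domainMeasure d T) = -∫ z, N i j z * φ z ∂(domainMeasure d T)

theorem IsWeakJacobian.integrable {q : SpaceTime d → Vec d} {N : Fin d → Fin d → SpaceTime d → ℝ}
    (hN : IsWeakJacobian T q N) (i j : Fin d) : Integrable (N i j) (domainMeasure d T) :=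
  (hN i j).1.integrable (by norm_num)

/-- The Jacobian of `K(ρ)q`, in terms of the Jacobian of `q = ∇ρ`. -/
noncomputable def stressJac (K : ℝ → ℝ) (ρ : SpaceTime d → ℝ) (q : SpaceTime d → Vec d)
    (N : Fin d → Fin d → SpaceTime d → ℝ) (i j : Fin d) (z : SpaceTime d) : ℝ :=
  deriv K (ρ z) * q z j * q z i + K (ρ z) * N i j z

/-- The pairing of `K(ρ)∇ρ div(ρu)` with `∇φ`, for `K` given on the whole line. -/
noncomputable def linePairing (T : ℝ) (K : ℝ → ℝ) (ρ : SpaceTime d → ℝ)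
    (u q : SpaceTime d → Vec d) (N : Fin d → Fin d → SpaceTime d → ℝ) (φ : SpaceTime d → ℝ) : ℝ :=
  -∫ z, ∑ i, ∑ j, ρ z * u z j * (stressJac K ρ q N i j z * pd (ex i) φ z +
    K (ρ z) * q z i * pd (ex j) (pd (ex i) φ) z) ∂(domainMeasure d T)

namespace Solution

variable {H K : ℝ → ℝ} {ρ r : SpaceTime d → ℝ} {u q : SpaceTime d → Vec d}
variable (s : Solution T H K ρ u q r)
include s

theorem exists_isWeakJacobian : ∃ N, IsWeakJacobian T q N := by
  choose N hN using fun i j => s.density.exists_hessian i j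
  exact ⟨N, hN⟩

/-- The trace of the weak Hessian and Δρ have the same pairing with every test function. This
identifies the trace of the Jacobian of κ(ρ)∇ρ. -/
theorem sum_jacobian_ae {N : Fin d → Fin d → SpaceTime d → ℝ} (hN : IsWeakJacobian T q N) :
    ∀ᵐ z ∂(domainMeasure d T), ∑ i, N i i z = r z := by
  have hi : Integrable (fun z => ∑ i, N i i z) (domainMeasure d T) :=
    integrable_finsetSum _ fun i _ => hN.integrable i i
  have h := ae_eq_zero_of_integral_mul_test (F := fun z => ∑ i, N i i z - r z)
    (hi.sub s.density.bm_r.integrable_domain) fun φ hφ => ?_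
  · filter_upwards [h] with z hz
    exact sub_eq_zero.1 hz
  have hNφ : ∀ i, Integrable (fun z => N i i z * φ z) (domainMeasure d T) := fun i => by
    simpa only [mul_comm] using hφ.bm.mul_integrable (hN.integrable i i)
  simp only [sub_mul, Finset.sum_mul]
  rw [integral_sub (integrable_finsetSum _ fun i _ => hNφ i)
    (s.density.bm_r.mul hφ.bm).integrable_domain, integral_finsetSum _ fun i _ => hNφ i]
  have h1 := s.density.lap φ hφ
  rw [integral_finsetSum _ fun i _ => ((s.bmv_q.bm i).mul (hφ.bm_pd le_top _)).integrable_domain,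
    Finset.sum_congr rfl fun i _ => (hN i i).2 φ hφ, Finset.sum_neg_distrib] at h1
  linarith

theorem stressJac_integrable {N : Fin d → Fin d → SpaceTime d → ℝ} (hN : IsWeakJacobian T q N)
    (i j : Fin d) : Integrable (stressJac K ρ q N i j) (domainMeasure d T) :=
  (((s.density.bm_ρ.comp s.contDiff_dK.continuous).mul (s.bmv_q.bm j)).mul
    (s.bmv_q.bm i)).integrable_domain.add
    ((s.density.bm_ρ.comp s.contDiff_K.continuous).mul_integrable (hN.integrable i j))

variable {ε : ℕ → ℝ} (hε : ∀ n, 0 < ε n) (hε0 : Tendsto ε atTop (𝓝 0))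
include hε hε0

/-- The product rule gives K'(P) Qⱼ Qᵢ, which converges boundedly in L¹, and K(P) ∂ⱼQᵢ. In the
second, the mollifier is moved from the Hessian to K(P)χ: the fixed function N is then paired with a
boundedly convergent sequence. -/
theorem tendsto_integral_stressJac {N : Fin d → Fin d → SpaceTime d → ℝ}
    (hN : IsWeakJacobian T q N) (i j : Fin d) {δ : ℝ} (hδ : 0 < δ) (hεδ : ∀ n, ε n < δ / 2)
    {χ : ℕ → SpaceTime d → ℝ} {χ₀ : SpaceTime d → ℝ} (hχ : L1Conv T χ χ₀)
    (hs : ∀ n, TimeSupp δ (T - δ) (χ n)) (hs₀ : TimeSupp δ (T - δ) χ₀) :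
    Tendsto (fun n => ∫ z, pd (ex j) (fun z => K (mol (ε n) ρ z) * mol (ε n) (fun z => q z i) z) z *
      χ n z) atTop (𝓝 (∫ z, stressJac K ρ q N i j z * χ₀ z ∂(domainMeasure d T))) := by
  have hρ := s.l1Conv_ρ hε hε0
  have hq := fun i => s.l1Conv_q hε hε0 i
  have hK1 : ContDiff ℝ 1 K := s.contDiff_K.of_le (by norm_num)
  have hχ0 : ∀ n, TimeSupp 0 T (χ n) := fun n => (hs n).mono hδ.le (by linarith)
  have hχ₀0 : TimeSupp 0 T χ₀ := hs₀.mono hδ.le (by linarith)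
  have hA := (((hρ.comp (s.contDiff_dK.of_le (by norm_num : (1 : WithTop ℕ∞) ≤ 2))).mul
    (hq j)).mul (hq i)).mul hχ
  have hB := (hρ.comp hK1).mul hχ
  have t1 := hA.tendsto_integral
  have t2 := (hB.mol (fun n => (hχ0 n).mul_left _) (hχ₀0.mul_left _) hε hε0).tendsto_integral_mul
    (hN.integrable i j)
  have hBM : BM fun z => K (ρ z) * χ₀ z := hB.bm_lim
  have e : ∫ z, stressJac K ρ q N i j z * χ₀ z ∂(domainMeasure d T) =
      (∫ z, deriv K (ρ z) * q z j * q z i * χ₀ z ∂(domainMeasure d T)) +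
      ∫ z, N i j z * (K (ρ z) * χ₀ z) ∂(domainMeasure d T) := by
    rw [← integral_add hA.bm_lim.integrable_domain]
    · congr 1; ext z
      unfold stressJac; ring
    · simpa only [mul_comm] using hBM.mul_integrable (hN.integrable i j)
  rw [e]
  refine (t1.add t2).congr fun n => ?_
  have hw : ∀ φ : SpaceTime d → ℝ, IsTest T ⊤ φ →
      ∫ z, ∑ _k : Unit, q z i * pd (ex j) φ z ∂(domainMeasure d T) =
      -∫ z, N i j z * φ z ∂(domainMeasure d T) := by simpa using (hN i j).2
  have h2 := integral_pd_mol_mul (ι := Unit) (v := fun _ => ex j) (f := fun _ z => q z i)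
    (fun _ => s.bmv_q.bm i) (fun _ => s.density.supp_q i) hw (hε n)
    (show ε n < δ by linarith [hεδ n]) (hB.bm n) ((hs n).mul_left _)
  simp only [Finset.univ_unique, Finset.sum_singleton] at h2
  rw [← h2, integral_domain_eq ((hχ0 n).mul_left _), ← integral_add
    ((hA.bm n).integrable ((hχ0 n).mul_left _))
    ((((s.bmv_q.bm i).pd_mol (hε n) (s.density.supp_q i) (ex j)).mul (hB.bm n)).integrable
      (((hχ0 n).mul_left _).mul_left _))]
  congr 1; ext z
  have smρ : Sm 1 (mol (ε n) ρ) := sm_mol (hε n) s.density.bm_ρ (n := 1)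
  rw [pd_mul (Sm.comp hK1 smρ) (sm_mol (hε n) (s.bmv_q.bm i) (n := 1)), pd_comp hK1 smρ]
  by_cases hz : z.1 ∈ Set.Icc δ (T - δ)
  · rw [s.density.pd_mol_ρ (hε n) (hεδ n) ⟨by linarith [hz.1], by linarith [hz.2]⟩ j]
    ring
  · simp [hs n z hz]

-- The weak product rule for K(ρ)∇ρ, as the limit of the classical one for K(P)Q.
omit hε hε0 in
theorem integral_stress_mul_pd {N : Fin d → Fin d → SpaceTime d → ℝ}
    (hN : IsWeakJacobian T q N) (i j : Fin d) {φ : SpaceTime d → ℝ} (hφ : IsTest T 1 φ) :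
    ∫ z, K (ρ z) * q z i * pd (ex j) φ z ∂(domainMeasure d T) =
      -∫ z, stressJac K ρ q N i j z * φ z ∂(domainMeasure d T) := by
  obtain ⟨δ, hδ, hs⟩ := hφ.exists_timeSupp
  have hs0 : TimeSupp 0 T φ := hs.mono hδ.le (by linarith)
  obtain ⟨ε, hε, hεδ, hε0⟩ := exists_scales (half_pos hδ)
  have hK1 : ContDiff ℝ 1 K := s.contDiff_K.of_le (by norm_num)
  have t1 := s.tendsto_integral_stressJac hε hε0 hN i j hδ hεδ hφ.bm.l1Conv (fun _ => hs) hs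
  have t2 := ((((s.l1Conv_ρ hε hε0).comp hK1).mul (s.l1Conv_q hε hε0 i)).mul
    (hφ.bm_pd le_rfl (ex j)).l1Conv).tendsto_integral
  refine tendsto_nhds_unique t2 (t1.neg.congr fun n => ?_)
  rw [integral_domain_eq ((hs0.pd _).mul_left _), integral_pd_mul
    ((Sm.comp hK1 (sm_mol (hε n) s.density.bm_ρ (n := 1))).mul
      (sm_mol (hε n) (s.bmv_q.bm i) (n := 1))) hφ.sm hφ.hasCompactSupport, neg_neg]

omit hε hε0 in
/-- The local energy balance for test functions of class `C²`. -/
theorem lineTerms_add_linePairing {α β : ℝ} (hβα : β ≤ α) (hαβ : 1 < α + 2 * β)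
    (hub : OscBound T α u) (hwb : OscBound T β (densityTriple ρ q r))
    {N : Fin d → Fin d → SpaceTime d → ℝ} (hN : IsWeakJacobian T q N) {φ : SpaceTime d → ℝ}
    (hφ : IsTest T 2 φ) :
    lineTerms T H K ρ u q r φ + linePairing T K ρ u q N φ = 0 := by
  obtain ⟨δ, hδ, hs⟩ := hφ.exists_timeSupp
  have hs0 : TimeSupp 0 T φ := hs.mono hδ.le (by linarith)
  obtain ⟨ε, hε, hεδ, hε0⟩ := exists_scales (lt_min (half_pos hδ) one_pos)
  have hεδ' : ∀ n, ε n < δ / 2 := fun n => (hεδ n).trans_le (min_le_left _ _)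
  have hK1 : ContDiff ℝ 1 K := s.contDiff_K.of_le (by norm_num)
  have sm2 : Sm (1 + 1) φ := by rw [one_add_one_eq_two]; exact hφ.sm
  have hφ1 : IsTest T 1 φ := isTest_of_sm (sm2.of_le le_self_add) hδ hs
  have sm1 : ∀ i, Sm 1 (pd (ex i) φ) := fun i => sm2.pd _
  have hφi : ∀ i, IsTest T 1 (pd (ex i) φ) := fun i => isTest_of_sm (sm1 i) hδ (hs.pd _)
  have key := s.tendsto_div hε hε0 hβα hαβ hub hwb hφ1 hδ hs hεδ
  have hm := fun j => s.l1Conv_mom hε hε0 j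
  have t1 := fun i j => s.tendsto_integral_stressJac hε hε0 hN i j hδ hεδ'
    ((hm j).mul (hφ1.bm_pd le_rfl (ex i)).l1Conv) (fun _ => (hs.pd _).mul_left _)
    ((hs.pd _).mul_left _)
  have hL := fun i j => (hm j).mul ((((s.l1Conv_ρ hε hε0).comp hK1).mul (s.l1Conv_q hε hε0 i)).mul
    ((hφi i).bm_pd le_rfl (ex j)).l1Conv)
  have t2 := fun i j => (hL i j).tendsto_integral
  have t3 := (tendsto_finsetSum Finset.univ fun i _ => tendsto_finsetSum Finset.univ fun j _ =>
    (t1 i j).add (t2 i j)).neg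
  have hbs : ∀ i j, BM fun z => ρ z * u z j * pd (ex i) φ z := fun i j =>
    (s.bm_mom j).mul (hφ1.bm_pd le_rfl (ex i))
  have i1 : ∀ i j, Integrable (fun z => stressJac K ρ q N i j z * (ρ z * u z j * pd (ex i) φ z))
      (domainMeasure d T) := fun i j => by
    simpa only [mul_comm] using (hbs i j).mul_integrable (s.stressJac_integrable hN i j)
  have i2 : ∀ i j, Integrable (fun z => ρ z * u z j *
      (K (ρ z) * q z i * pd (ex j) (pd (ex i) φ) z)) (domainMeasure d T) := fun i j =>
    (hL i j).bm_lim.integrable_domain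
  have e : linePairing T K ρ u q N φ = -∑ i, ∑ j,
      ((∫ z, stressJac K ρ q N i j z * (ρ z * u z j * pd (ex i) φ z) ∂(domainMeasure d T)) +
      ∫ z, ρ z * u z j * (K (ρ z) * q z i * pd (ex j) (pd (ex i) φ) z) ∂(domainMeasure d T)) := by
    have i3 : ∀ i j, Integrable (fun z => ρ z * u z j * (stressJac K ρ q N i j z * pd (ex i) φ z +
        K (ρ z) * q z i * pd (ex j) (pd (ex i) φ) z)) (domainMeasure d T) := fun i j => by
      refine ((i1 i j).add (i2 i j)).congr (Eventually.of_forall fun z => ?_)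
      simp only [Pi.add_apply]; ring
    rw [linePairing, integral_finsetSum _ fun i _ => integrable_finsetSum _ fun j _ => i3 i j]
    refine congrArg _ (Finset.sum_congr rfl fun i _ => ?_)
    rw [integral_finsetSum _ fun j _ => i3 i j]
    refine Finset.sum_congr rfl fun j _ => ?_
    rw [← integral_add (i1 i j) (i2 i j)]
    congr 1; ext z; ring
  rw [← e] at t3
  -- The integral of div m against K(P) Q·∇φ has two limits: minus the regular terms, by the energy
  -- balance, and the pairing, once the divergence is integrated by parts.
  have h0 := tendsto_nhds_unique key (t3.congr fun n => ?_)
  · linarith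
  have smm : ∀ j, Sm 1 (mol (ε n) fun z => ρ z * u z j) := fun j =>
    sm_mol (hε n) (s.bm_mom j) (n := 1)
  have smS : ∀ i, Sm 1 fun z => K (mol (ε n) ρ z) * mol (ε n) (fun z => q z i) z := fun i =>
    (Sm.comp hK1 (sm_mol (hε n) s.density.bm_ρ (n := 1))).mul
      (sm_mol (hε n) (s.bmv_q.bm i) (n := 1))
  have smψ : Sm 1 fun z => ∑ j, K (mol (ε n) ρ z) * mol (ε n) (fun z => q z j) z * pd (ex j) φ z :=
    Sm.sum fun j _ => (smS j).mul (sm1 j)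
  have hψs : TimeSupp δ (T - δ) fun z =>
      ∑ j, K (mol (ε n) ρ z) * mol (ε n) (fun z => q z j) z * pd (ex j) φ z := fun z hz =>
    Finset.sum_eq_zero fun j _ => by rw [hs.pd (ex j) z hz, mul_zero]
  have ic : ∀ {f : SpaceTime d → ℝ}, Continuous f → TimeSupp δ (T - δ) f → Integrable f :=
    fun hf hs => hf.integrable_of_hasCompactSupport hs.hasCompactSupport
  have j0 : ∀ k, Integrable fun z => pd (ex k) (mol (ε n) fun z => ρ z * u z k) z *
      ∑ j, K (mol (ε n) ρ z) * mol (ε n) (fun z => q z j) z * pd (ex j) φ z := fun k =>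
    ic (((smm k).continuous_pd _).mul smψ.continuous) (hψs.mul_left _)
  simp only [Finset.sum_mul]
  rw [integral_finsetSum _ fun k _ => j0 k]
  simp only [integral_pd_mul (smm _) smψ hψs.hasCompactSupport,
    pd_sum fun j _ => (smS j).mul (sm1 j), pd_mul (smS _) (sm1 _)]
  rw [Finset.sum_neg_distrib, Finset.sum_comm]
  refine congrArg _ (Finset.sum_congr rfl fun j _ => ?_)
  have j1 : ∀ i, Integrable fun z => pd (ex j)
      (fun z => K (mol (ε n) ρ z) * mol (ε n) (fun z => q z i) z) z *
      (mol (ε n) (fun z => ρ z * u z j) z * pd (ex i) φ z) := fun i =>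
    ic (((smS i).continuous_pd _).mul ((smm j).continuous.mul (sm1 i).continuous))
      (((hs.pd _).mul_left _).mul_left _)
  have j2 : ∀ i, Integrable fun z => mol (ε n) (fun z => ρ z * u z j) z *
      (K (mol (ε n) ρ z) * mol (ε n) (fun z => q z i) z * pd (ex j) (pd (ex i) φ) z) := fun i =>
    ic ((smm j).continuous.mul ((smS i).continuous.mul ((sm1 i).continuous_pd _)))
      ((((hs.pd _).pd _).mul_left _).mul_left _)
  have e1 : ∀ i, ∫ z, mol (ε n) (fun z => ρ z * u z j) z *
      (K (mol (ε n) ρ z) * mol (ε n) (fun z => q z i) z * pd (ex j) (pd (ex i) φ) z)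
        ∂(domainMeasure d T) = ∫ z, mol (ε n) (fun z => ρ z * u z j) z *
      (K (mol (ε n) ρ z) * mol (ε n) (fun z => q z i) z * pd (ex j) (pd (ex i) φ) z) := fun i =>
    integral_domain_eq ((((hs0.pd _).pd _).mul_left _).mul_left _)
  simp only [e1, ← integral_add (j1 _) (j2 _)]
  have j12 : ∀ i, Integrable fun z => pd (ex j)
      (fun z => K (mol (ε n) ρ z) * mol (ε n) (fun z => q z i) z) z *
      (mol (ε n) (fun z => ρ z * u z j) z * pd (ex i) φ z) + mol (ε n) (fun z => ρ z * u z j) z *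
      (K (mol (ε n) ρ z) * mol (ε n) (fun z => q z i) z * pd (ex j) (pd (ex i) φ) z) :=
    fun i => (j1 i).add (j2 i)
  rw [← integral_finsetSum _ fun i _ => j12 i]
  congr 1; ext z
  rw [Finset.mul_sum]
  exact Finset.sum_congr rfl fun i _ => by ring

omit hε hε0 in
/-- The local energy balance if `div(ρu)` is a locally integrable function. -/
theorem lineTerms_add_integral {α β : ℝ} (hβα : β ≤ α) (hαβ : 1 < α + 2 * β)
    (hub : OscBound T α u) (hwb : OscBound T β (densityTriple ρ q r)) {D : SpaceTime d → ℝ}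
    (hD : LocallyIntegrableOn D (domain d T))
    (hdiv : ∀ φ : SpaceTime d → ℝ, IsTest T ⊤ φ →
      ∫ z, ∑ j, ρ z * u z j * pd (ex j) φ z ∂(domainMeasure d T) =
        -∫ z, D z * φ z ∂(domainMeasure d T))
    {φ : SpaceTime d → ℝ} (hφ : IsTest T 1 φ) :
    lineTerms T H K ρ u q r φ +
      ∫ z, ∑ i, K (ρ z) * q z i * D z * pd (ex i) φ z ∂(domainMeasure d T) = 0 := by
  obtain ⟨δ, hδ, hs⟩ := hφ.exists_timeSupp
  have hs0 : TimeSupp 0 T φ := hs.mono hδ.le (by linarith)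
  obtain ⟨ε, hε, hεδ, hε0⟩ := exists_scales (lt_min (half_pos hδ) one_pos)
  have hεδ' : ∀ n, ε n < δ / 2 := fun n => (hεδ n).trans_le (min_le_left _ _)
  have hK1 : ContDiff ℝ 1 K := s.contDiff_K.of_le (by norm_num)
  have key := s.tendsto_div hε hε0 hβα hαβ hub hwb hφ hδ hs hεδ
  have hψ := L1Conv.sum (s := Finset.univ) fun j => (((s.l1Conv_ρ hε hε0).comp hK1).mul
    (s.l1Conv_q hε hε0 j)).mul (hφ.bm_pd le_rfl (ex j)).l1Conv
  have hψs : ∀ n, TimeSupp δ (T - δ) fun z =>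
      ∑ j, K (mol (ε n) ρ z) * mol (ε n) (fun z => q z j) z * pd (ex j) φ z := fun n z hz =>
    Finset.sum_eq_zero fun j _ => by rw [hs.pd (ex j) z hz, mul_zero]
  have hψ0 : ∀ n, TimeSupp 0 T fun z =>
      ∑ j, K (mol (ε n) ρ z) * mol (ε n) (fun z => q z j) z * pd (ex j) φ z := fun n =>
    (hψs n).mono hδ.le (by linarith)
  have hψ₀ : TimeSupp δ (T - δ) fun z => ∑ j, K (ρ z) * q z j * pd (ex j) φ z := fun z hz =>
    Finset.sum_eq_zero fun j _ => by rw [hs.pd (ex j) z hz, mul_zero]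
  have hSm : MeasurableSet (strip d T (δ / 2)) := measurableSet_Icc.prod MeasurableSet.univ
  -- D is only locally integrable, so it is cut off to a compact strip containing the supports of
  -- all mollified test functions.
  have hD' : Integrable ((strip d T (δ / 2)).indicator D) (domainMeasure d T) := by
    refine Integrable.mono_measure ?_ Measure.restrict_le_self
    rw [integrable_indicator_iff hSm]
    refine hD.integrableOn_compact_subset ?_ (isCompact_Icc.prod isCompact_univ)
    exact fun z hz => ⟨⟨by linarith [hz.1.1], by linarith [hz.1.2]⟩, trivial⟩
  have hind : ∀ {f : SpaceTime d → ℝ}, TimeSupp (δ / 2) (T - δ / 2) f →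
      ∀ z, (strip d T (δ / 2)).indicator D z * f z = D z * f z := fun {f} hf z => by
    by_cases hz : z ∈ strip d T (δ / 2)
    · rw [Set.indicator_of_mem hz]
    · rw [hf z fun h => hz ⟨h, trivial⟩, mul_zero, mul_zero]
  -- The function K(P) Q·∇φ tested against div m becomes its mollification tested against D. It
  -- varies with n itself, so convergence under a simultaneous mollification is required.
  have t := (hψ.mol hψ0 (hψ₀.mono hδ.le (by linarith)) hε hε0).tendsto_integral_mul hD'
  have hm : ∀ n, TimeSupp (δ / 2) (T - δ / 2) (mol (ε n) fun z =>
      ∑ j, K (mol (ε n) ρ z) * mol (ε n) (fun z => q z j) z * pd (ex j) φ z) := fun n =>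
    ((hψs n).mol (hε n).le).mono (by linarith [hεδ' n]) (by linarith [hεδ' n])
  have hm₀ : TimeSupp (δ / 2) (T - δ / 2) fun z => ∑ j, K (ρ z) * q z j * pd (ex j) φ z :=
    hψ₀.mono (by linarith) (by linarith)
  simp only [hind hm₀, hind (hm _)] at t
  have h0 := tendsto_nhds_unique key (t.congr fun n => ?_)
  · have e : ∫ z, ∑ i, K (ρ z) * q z i * D z * pd (ex i) φ z ∂(domainMeasure d T) =
        ∫ z, D z * ∑ j, K (ρ z) * q z j * pd (ex j) φ z ∂(domainMeasure d T) := by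
      congr 1; ext z
      rw [Finset.mul_sum]
      exact Finset.sum_congr rfl fun j _ => by ring
    rw [e, ← h0]
    ring
  · exact (integral_pd_mol_mul (fun k => s.bm_mom k) s.supp_mom hdiv (hε n)
      (show ε n < δ by linarith [hεδ' n]) (hψ.bm n) (hψs n)).symm

end Solution

end EulerKorteweg

/-! ### Extension to test functions of class C¹. -/

namespace EulerKorteweg

set_option linter.unusedSectionVars false

variable {d : ℕ} {T : ℝ}

theorem tendsto_integral_mul_of_unif {e : SpaceTime d → ℝ} (he : BM e) {f : ℕ → SpaceTime d → ℝ}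
    {g : SpaceTime d → ℝ} (hf : ∀ n, BM (f n)) (hg : BM g) (h : TendstoUniformly f g atTop) :
    Tendsto (fun n => ∫ z, e z * f n z ∂(domainMeasure d T)) atTop
      (𝓝 (∫ z, e z * g z ∂(domainMeasure d T))) := by
  obtain ⟨C, hC⟩ := he.bdd
  obtain ⟨D, hD⟩ := hg.bdd
  have hC0 : 0 ≤ C := (abs_nonneg _).trans (hC 0)
  refine tendsto_integral_filter_of_dominated_convergence (fun _ => C * (D + 1))
    (Eventually.of_forall fun n => (he.1.mul (hf n).1).aestronglyMeasurable) ?_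
    (integrable_const _) (Eventually.of_forall fun z => (h.tendsto_at z).const_mul _)
  filter_upwards [Metric.tendstoUniformly_iff.1 h 1 one_pos] with n hn
  refine Eventually.of_forall fun z => ?_
  rw [norm_mul]
  refine mul_le_mul (hC z) ?_ (norm_nonneg _) hC0
  have h1 := hn z
  rw [dist_comm, Real.dist_eq] at h1
  have h2 := abs_sub_abs_le_abs_sub (f n z) (g z)
  rw [Real.norm_eq_abs]
  linarith [hD z]

/-- Only first derivatives of φ occur, against bounded functions. Through the balance for C² this
continuity provides the extension of the pairing to C¹. -/
theorem Solution.tendsto_lineTerms {H K : ℝ → ℝ} {ρ r : SpaceTime d → ℝ} {u q : SpaceTime d → Vec d}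
    (s : Solution T H K ρ u q r) {ψ : ℕ → SpaceTime d → ℝ} {φ : SpaceTime d → ℝ}
    (hφ : IsTest T 1 φ) (h : ApproxC1 T ψ φ) :
    Tendsto (fun n => lineTerms T H K ρ u q r (ψ n)) atTop (𝓝 (lineTerms T H K ρ u q r φ)) := by
  have huu : BM fun z => ∑ i, u z i ^ 2 := BM.sum fun i => by
    simpa only [sq] using (s.bmv_u.bm i).mul (s.bmv_u.bm i)
  have hqq : BM fun z => ∑ i, q z i ^ 2 := BM.sum fun i => by
    simpa only [sq] using (s.bmv_q.bm i).mul (s.bmv_q.bm i)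
  have he : BM (lineEnergy H K ρ u q) := ((((BM.const _).mul s.density.bm_ρ).mul huu).add
    (s.density.bm_ρ.comp s.contDiff_H.continuous)).add
    (((BM.const _).mul (s.density.bm_ρ.comp s.contDiff_K.continuous)).mul hqq)
  have hf : ∀ i, BM (lineFlux H K ρ u q r i) := fun i =>
    (((BM.const _).mul huu).add s.bm_pot).mul (s.bm_mom i)
  have hψ := fun n v => (h.isTest n).bm_pd one_le_two v
  have hφ' := fun v => hφ.bm_pd le_rfl v
  have hsum : ∀ {φ : SpaceTime d → ℝ}, (∀ v, BM (pd v φ)) →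
      ∫ z, ∑ i, lineFlux H K ρ u q r i z * pd (ex i) φ z ∂(domainMeasure d T) =
      ∑ i, ∫ z, lineFlux H K ρ u q r i z * pd (ex i) φ z ∂(domainMeasure d T) := fun hφ =>
    integral_finsetSum _ fun i _ => ((hf i).mul (hφ _)).integrable_domain
  simp only [lineTerms, hsum hφ', hsum (hψ _)]
  have h1 := h.unif_dt
  have h2 := h.unif_dx
  simp only [dt_eq_pd, dx_eq_pd] at h1 h2
  exact (tendsto_integral_mul_of_unif he (fun n => hψ n et) (hφ' et) h1).add
    (tendsto_finsetSum _ fun i _ =>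
      tendsto_integral_mul_of_unif (hf i) (fun n => hψ n _) (hφ' _) (h2 i))

theorem tendstoUniformly_mol {f : SpaceTime d → ℝ} (hf : Continuous f) (hc : HasCompactSupport f)
    {ε : ℕ → ℝ} (hε : ∀ n, 0 < ε n) (hε0 : Tendsto ε atTop (𝓝 0)) :
    TendstoUniformly (fun n => mol (ε n) f) f atTop := by
  have hbm := BM.of_continuous hf hc
  have hu := Metric.uniformContinuous_iff.1 (hc.uniformContinuous_of_continuous hf)
  rw [Metric.tendstoUniformly_iff]
  intro κ hκ
  obtain ⟨η, hη, h⟩ := hu (κ / 2) (half_pos hκ)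
  have hcov : Tendsto (fun ξ : ℝ × Vec d => (cover ξ : SpaceTime d)) (𝓝 0) (𝓝 0) := by
    have := continuous_cover (d := d).tendsto 0
    rwa [cover_zero] at this
  obtain ⟨γ, hγ, hγ'⟩ := Metric.mem_nhds_iff.1 (hcov (Metric.ball_mem_nhds 0 hη))
  filter_upwards [hε0.eventually (gt_mem_nhds hγ)] with n hn z
  rw [dist_comm, Real.dist_eq, mol_sub_eq (ε n) hbm]
  have hk : ∀ ξ : ℝ × Vec d, |eta ξ * (f (z - cover (ε n • ξ)) - f z)| ≤ eta ξ * (κ / 2) := by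
    intro ξ
    rw [abs_mul, abs_of_nonneg (eta_nonneg ξ)]
    by_cases hξ : ξ ∈ Metric.closedBall (0 : ℝ × Vec d) 1
    · refine mul_le_mul_of_nonneg_left ?_ (eta_nonneg ξ)
      have h1 : ε n • ξ ∈ Metric.ball (0 : ℝ × Vec d) γ := by
        rw [mem_ball_zero_iff, norm_smul, Real.norm_of_nonneg (hε n).le]
        have : ‖ξ‖ ≤ 1 := by simpa using hξ
        exact (mul_le_of_le_one_right (hε n).le this).trans_lt hn
      have h2 : dist (cover (ε n • ξ) : SpaceTime d) 0 < η := hγ' h1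
      have h3 : dist (z - cover (ε n • ξ)) z < η := by
        rw [dist_eq_norm, sub_sub_cancel_left, norm_neg]
        rwa [dist_zero_right] at h2
      exact (h h3).le
    · rw [isKernel_eta.eq_zero ξ hξ, zero_mul, zero_mul]
  have h1 := norm_integral_le_of_norm_le
    (f := fun ξ : ℝ × Vec d => eta ξ * (f (z - cover (ε n • ξ)) - f z))
    (isKernel_eta.integrable.mul_const (κ / 2))
    (Eventually.of_forall hk)
  rw [integral_mul_const, integral_eta, one_mul] at h1
  exact h1.trans_lt (half_lt_self hκ)

theorem pd_mol_eq_mol_pd {φ : SpaceTime d → ℝ} (hφ : IsTest T 1 φ) {δ ε : ℝ} (hε : 0 < ε)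
    (hδ : ε < δ / 2) (hs : TimeSupp δ (T - δ) φ) (v : ℝ × Vec d) :
    pd v (mol ε φ) = mol ε (pd v φ) := by
  have hδ0 : 0 < δ := by linarith
  have hs0 : TimeSupp 0 T φ := hs.mono hδ0.le (by linarith)
  ext z
  by_cases hz : z.1 ∈ Set.Ioo (δ / 2) (T - δ / 2)
  · have h := sum_pd_mol_eq (ι := Unit) (v := fun _ => v) (f := fun _ => φ) (fun _ => hφ.bm)
      (fun _ => hs0) (hφ.bm_pd le_rfl v) (hs0.pd v) (fun χ hχ => by
        simp only [Finset.univ_unique, Finset.sum_singleton]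
        rw [integral_domain_eq (hs0.mul_right _), integral_domain_eq ((hs0.pd v).mul_right _),
          integral_pd_mul hφ.sm (hχ.sm.of_le (by simp)) hχ.hasCompactSupport, neg_neg]) hε hδ hz
    simpa using h
  -- Near the initial and final times both sides vanish, since φ does so on a neighbourhood larger
  -- than the mollification scale.
  · have h1 : z.1 ∉ Set.Icc (δ - ε) (T - δ + ε) := fun h =>
      hz ⟨by linarith [h.1], by linarith [h.2]⟩
    rw [(hs.mol hε.le).pd v z h1, (hs.pd v).mol hε.le z h1]

/-- Test functions of class `C¹` are limits of smooth ones. -/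
theorem IsTest.exists_approxC1 {φ : SpaceTime d → ℝ} (hφ : IsTest T 1 φ) :
    ∃ ψ : ℕ → SpaceTime d → ℝ, ApproxC1 T ψ φ := by
  obtain ⟨δ, hδ, hs⟩ := hφ.exists_timeSupp
  obtain ⟨ε, hε, hεδ, hε0⟩ := exists_scales (half_pos hδ)
  have hc := hφ.hasCompactSupport
  have hpd : ∀ v, TendstoUniformly (fun n => pd v (mol (ε n) φ)) (pd v φ) atTop := fun v => by
    simp only [fun n => pd_mol_eq_mol_pd hφ (hε n) (hεδ n) hs v]
    exact tendstoUniformly_mol (hφ.sm.continuous_pd v) (hasCompactSupport_pd hc v) hε hε0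
  have hs' : ∀ n, TimeSupp (δ / 2) (T - δ / 2) (mol (ε n) φ) := fun n =>
    (hs.mol (hε n).le).mono (by linarith [hεδ n]) (by linarith [hεδ n])
  refine ⟨fun n => mol (ε n) φ, fun n => isTest_of_sm (sm_mol (hε n) hφ.bm) (half_pos hδ) (hs' n),
    ⟨strip d T (δ / 2), isCompact_Icc.prod isCompact_univ, fun z hz => ?_,
      fun n => (hs' n).tsupport_subset⟩, tendstoUniformly_mol hφ.sm.continuous hc hε hε0, ?_,
    fun j => ?_⟩
  · exact ⟨⟨by linarith [hz.1.1], by linarith [hz.1.2]⟩, trivial⟩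
  · simpa only [dt_eq_pd] using hpd et
  · simpa only [dx_eq_pd] using hpd (ex j)

end EulerKorteweg

/-! ### Reduction to bounded Borel fields and to functions on the whole line. -/

namespace EulerKorteweg

set_option linter.unusedSectionVars false

variable {d : ℕ} {T : ℝ}

/-! ### Extension of functions of one variable -/

/-- Extend the derivative instead, and integrate it from a; the fundamental theorem of calculus
recovers g on [a, b]. Repeated, this gives extension of any finite order. -/
theorem exists_primitive_extension {I : Set ℝ} {a b : ℝ}
    (hab : Set.Icc a b ⊆ I) (hIo : Set.Ioo a b ⊆ interior I) {n : ℕ} {g : ℝ → ℝ}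
    (hg : ContDiffOn ℝ (n + 1) g I) {G' : ℝ → ℝ} (hG' : ContDiff ℝ n G')
    (he : Set.EqOn G' (derivWithin g I) (Set.Icc a b)) :
    ∃ G : ℝ → ℝ, ContDiff ℝ (n + 1) G ∧ Set.EqOn G g (Set.Icc a b) ∧ deriv G = G' := by
  have hd : ∀ x, HasDerivAt (fun x => g a + ∫ t in a..x, G' t) (G' x) x := fun x =>
    (intervalIntegral.integral_hasDerivAt_right (hG'.continuous.intervalIntegrable _ _)
      hG'.continuous.aestronglyMeasurable.stronglyMeasurableAtFilter
      hG'.continuous.continuousAt).const_add _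
  have hderiv : deriv (fun x => g a + ∫ t in a..x, G' t) = G' := funext fun x => (hd x).deriv
  refine ⟨fun x => g a + ∫ t in a..x, G' t, contDiff_succ_iff_deriv.2
    ⟨fun x => (hd x).differentiableAt, by simp, by rw [hderiv]; exact hG'⟩, fun x hx => ?_, hderiv⟩
  have hdg : DifferentiableOn ℝ g I := hg.differentiableOn (by simp)
  have h1 : ∫ t in a..x, G' t = g x - g a := by
    refine intervalIntegral.integral_eq_sub_of_hasDerivAt_of_le hx.1
      (hg.continuousOn.mono fun t ht => hab ⟨ht.1, ht.2.trans hx.2⟩) (fun t ht => ?_)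
      (hG'.continuous.intervalIntegrable _ _)
    have ht' : t ∈ Set.Icc a b := ⟨ht.1.le, ht.2.le.trans hx.2⟩
    rw [he ht']
    exact (hdg t (hab ht')).hasDerivWithinAt.hasDerivAt
      (mem_interior_iff_mem_nhds.1 (hIo ⟨ht.1, ht.2.trans_le hx.2⟩))
  simp only [h1]
  ring

theorem exists_contDiff_extension {I : Set ℝ} (hI : UniqueDiffOn ℝ I) {a b : ℝ} (h0 : a ≤ b)
    (hab : Set.Icc a b ⊆ I) (hIo : Set.Ioo a b ⊆ interior I) (n : ℕ) :
    ∀ g : ℝ → ℝ, ContDiffOn ℝ n g I →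
      ∃ G : ℝ → ℝ, ContDiff ℝ n G ∧ Set.EqOn G g (Set.Icc a b) := by
  induction n with
  | zero =>
    intro g hg
    refine ⟨Set.IccExtend h0 ((Set.Icc a b).domRestrict g), ?_, fun x hx => ?_⟩
    · rw [Nat.cast_zero, contDiff_zero]
      exact (hg.continuousOn.mono hab).domRestrict.Icc_extend'
    · rw [Set.IccExtend_of_mem h0 _ hx]; rfl
  | succ n ih =>
    intro g hg
    push_cast at hg ⊢
    obtain ⟨G', hG', he⟩ := ih _ ((contDiffOn_succ_iff_derivWithin hI).1 hg).2.2
    obtain ⟨G, h1, h2, -⟩ := exists_primitive_extension hab hIo hg hG' he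
    exact ⟨G, h1, h2⟩

/-- The derivative is extended first, so that `deriv G` is known on all of [a, b]. Agreement of G
with g would say nothing about it if a = b, the case of a constant density. -/
theorem exists_contDiff_three_extension {I : Set ℝ} (hI : UniqueDiffOn ℝ I) {a b : ℝ} (h0 : a ≤ b)
    (hab : Set.Icc a b ⊆ I) (hIo : Set.Ioo a b ⊆ interior I) {g : ℝ → ℝ}
    (hg : ContDiffOn ℝ 3 g I) :
    ∃ G : ℝ → ℝ, ContDiff ℝ 3 G ∧ ∀ x ∈ Set.Icc a b, G x = g x ∧ deriv G x = derivWithin g I x := by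
  have hg' : ContDiffOn ℝ ((2 : ℕ) + 1) g I := by norm_num; exact hg
  obtain ⟨G', hG', he⟩ := exists_contDiff_extension hI h0 hab hIo 2 _
    ((contDiffOn_succ_iff_derivWithin hI).1 hg').2.2
  obtain ⟨G, h1, h2, h3⟩ := exists_primitive_extension hab hIo hg' hG' he
  refine ⟨G, ?_, fun x hx => ⟨h2 hx, by rw [h3, he hx]⟩⟩
  norm_num at h1
  exact h1

/-! ### Bounded representatives -/

variable {F : Type*} [NormedAddCommGroup F] [MeasurableSpace F] [BorelSpace F]
  [SecondCountableTopology F]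

theorem measurableSet_domain : MeasurableSet (domain d T) := measurableSet_Ioo.prod .univ

theorem ae_norm_le_of_memLp_top {w : SpaceTime d → F} (hw : MemLp w ∞ (domainMeasure d T)) :
    ∀ᵐ z ∂(domainMeasure d T), ‖w z‖ ≤ (eLpNorm w ∞ (domainMeasure d T)).toReal := by
  filter_upwards [ae_le_eLpNormEssSup (f := w) (μ := domainMeasure d T)] with z hz
  rw [← toReal_enorm]
  exact ENNReal.toReal_mono hw.2.ne (by rwa [eLpNorm_exponent_top])

/-- With bounds at every point, increments can be estimated without exceptional sets, and the
extension by zero makes mollification meaningful at all times. -/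
theorem exists_bmv_representative {w : SpaceTime d → F} (hw : MemLp w ∞ (domainMeasure d T)) :
    ∃ w' : SpaceTime d → F, BMV w' ∧ (∀ z, z.1 ∉ Set.Icc 0 T → w' z = 0) ∧
      w' =ᵐ[domainMeasure d T] w := by
  set C := (eLpNorm w ∞ (domainMeasure d T)).toReal
  set g := hw.1.mk w
  have hg : Measurable g := hw.1.stronglyMeasurable_mk.measurable
  have hS : MeasurableSet (domain d T ∩ {z | ‖g z‖ ≤ C}) :=
    measurableSet_domain.inter (measurableSet_le hg.norm measurable_const)
  refine ⟨(domain d T ∩ {z | ‖g z‖ ≤ C}).indicator g, ⟨hg.indicator hS, C, fun z => ?_⟩,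
    fun z hz => Set.indicator_of_notMem (fun h => hz ⟨h.1.1.1.le, h.1.1.2.le⟩) _, ?_⟩
  · by_cases hz : z ∈ domain d T ∩ {z | ‖g z‖ ≤ C}
    · rw [Set.indicator_of_mem hz]; exact hz.2
    · rw [Set.indicator_of_notMem hz, norm_zero]; exact ENNReal.toReal_nonneg
  · filter_upwards [hw.1.ae_eq_mk, ae_norm_le_of_memLp_top hw,
      ae_restrict_mem (μ := volume) measurableSet_domain] with z h1 h2 h3
    rw [h1] at h2
    rw [Set.indicator_of_mem (show z ∈ domain d T ∩ {z | ‖g z‖ ≤ C} from ⟨h3, h2⟩)]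
    exact h1.symm

theorem MemBesov.congr {α : ℝ} {p : ℝ≥0∞} {w w' : SpaceTime d → F} (hw : MemBesov T α p w)
    (h : w' =ᵐ[domainMeasure d T] w) : MemBesov T α p w' := by
  have e : besovSeminorm T α p w' = besovSeminorm T α p w := by
    unfold besovSeminorm
    refine iSup_congr fun t => iSup_congr fun _ => ?_
    congr 1
    refine iSup_congr fun ξ => iSup_congr fun _ => eLpNorm_congr_ae ?_
    have h1 := (ae_restrict_iff' (μ := volume) measurableSet_domain).1 h
    -- A translate of a null set is null, so the shifted functions agree almost everywhere as well.
    have h2 := (measurePreserving_add_right (volume : Measure (SpaceTime d))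
      (cover ξ)).quasiMeasurePreserving.ae h1
    have hm : MeasurableSet (domain d T ∩ {z | z + cover ξ ∈ domain d T}) :=
      measurableSet_domain.inter ((measurable_add_const (cover ξ)) measurableSet_domain)
    refine (ae_restrict_iff' hm).2 ?_
    filter_upwards [h1, h2] with z hz1 hz2 hz
    rw [hz1 hz.1, hz2 hz.2]
  exact ⟨(memLp_congr_ae h).2 hw.1, by rw [e]; exact hw.2⟩

theorem IsTest.of_le {m n : ℕ∞} {φ : SpaceTime d → ℝ} (hφ : IsTest T n φ) (h : m ≤ n) :
    IsTest T m φ :=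
  ⟨hφ.contDiff.of_le (by exact_mod_cast h), hφ.2, hφ.3⟩

/-- A solution agrees almost everywhere with a bounded measurable one, which solves the system for
extensions of `h` and `κ` to the whole line. -/
theorem exists_solution {α β : ℝ} {I : Set ℝ} {h κ : ℝ → ℝ} (hh : ContDiffOn ℝ 3 h I)
    (hκ : ContDiffOn ℝ 3 κ I) {ρ : SpaceTime d → ℝ} {u : SpaceTime d → Vec d}
    (hI : (I = Set.Ici 0 ∧ ∀ᵐ z ∂(domainMeasure d T), 0 ≤ ρ z) ∨
      (I = Set.Ioi 0 ∧ ∃ c : ℝ, 0 < c ∧ ∀ᵐ z ∂(domainMeasure d T), c ≤ ρ z))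
    {q : SpaceTime d → Vec d} {r : SpaceTime d → ℝ}
    (hq : ∀ j, HasWeakDeriv T j ρ (fun z => q z j)) (hr : HasWeakDiv T q r)
    (hu_mem : MemBesovLinfty T α u) (hρ_mem : MemBesovLinfty T β ρ)
    (hq_mem : MemBesovLinfty T β q) (hr_mem : MemBesovLinfty T β r)
    (hsol : IsDistribSolution T I h κ ρ u q r) :
    ∃ (H K : ℝ → ℝ) (ρ' r' : SpaceTime d → ℝ) (u' q' : SpaceTime d → Vec d),
      Solution T H K ρ' u' q' r' ∧ OscBound T α u' ∧ OscBound T β (densityTriple ρ' q' r') ∧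
      ∀ᵐ z ∂(domainMeasure d T), ρ' z = ρ z ∧ u' z = u z ∧ q' z = q z ∧ r' z = r z ∧
        H (ρ z) = h (ρ z) ∧ deriv H (ρ z) = derivWithin h I (ρ z) ∧
        K (ρ z) = κ (ρ z) ∧ deriv K (ρ z) = derivWithin κ I (ρ z) := by
  -- The essential bound of ρ and its lower bound, 0 or c, confine its values to a compact interval
  -- in I. On (0, ∞) the constant c keeps this interval away from a possible singularity of κ at 0.
  obtain ⟨a, b, h0, hab, hIo, hIu, hρab⟩ : ∃ a b : ℝ, a ≤ b ∧ Set.Icc a b ⊆ I ∧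
      Set.Ioo a b ⊆ interior I ∧ UniqueDiffOn ℝ I ∧
      ∀ᵐ z ∂(domainMeasure d T), ρ z ∈ Set.Icc a b := by
    have hC := ae_norm_le_of_memLp_top hρ_mem.2
    set C := (eLpNorm ρ ∞ (domainMeasure d T)).toReal
    rcases hI with ⟨rfl, hI⟩ | ⟨rfl, c, hc, hI⟩
    · refine ⟨0, max C 0, le_max_right _ _, fun x hx => hx.1, fun x hx => ?_,
        uniqueDiffOn_Ici 0, ?_⟩
      · rw [interior_Ici]; exact hx.1
      · filter_upwards [hC, hI] with z h1 h2
        exact ⟨h2, ((le_abs_self _).trans h1).trans (le_max_left _ _)⟩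
    · refine ⟨c, max C c, le_max_right _ _, fun x hx => hc.trans_le hx.1, fun x hx => ?_,
        uniqueDiffOn_Ioi 0, ?_⟩
      · rw [interior_Ioi]; exact hc.trans hx.1
      · filter_upwards [hC, hI] with z h1 h2
        exact ⟨h2, ((le_abs_self _).trans h1).trans (le_max_left _ _)⟩
  obtain ⟨H, hH, hHe⟩ := exists_contDiff_three_extension hIu h0 hab hIo hh
  obtain ⟨K, hK, hKe⟩ := exists_contDiff_three_extension hIu h0 hab hIo hκ
  obtain ⟨ρ', bρ, sρ, eρ⟩ := exists_bmv_representative hρ_mem.2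
  obtain ⟨r', br, sr, er⟩ := exists_bmv_representative hr_mem.2
  obtain ⟨u', bu, su, eu⟩ := exists_bmv_representative hu_mem.2
  obtain ⟨q', bq, sq, eq⟩ := exists_bmv_representative hq_mem.2
  have hall : ∀ᵐ z ∂(domainMeasure d T), ρ' z = ρ z ∧ u' z = u z ∧ q' z = q z ∧ r' z = r z ∧
      H (ρ z) = h (ρ z) ∧ deriv H (ρ z) = derivWithin h I (ρ z) ∧
      K (ρ z) = κ (ρ z) ∧ deriv K (ρ z) = derivWithin κ I (ρ z) := by
    filter_upwards [eρ, er, eu, eq, hρab] with z h1 h2 h3 h4 h5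
    exact ⟨h1, h3, h4, h2, (hHe _ h5).1, (hHe _ h5).2, (hKe _ h5).1, (hKe _ h5).2⟩
  refine ⟨H, K, ρ', r', u', q', ⟨hH, hK, bu, bq, ⟨⟨bρ.1, bρ.2⟩, fun j => bq.bm j, ⟨br.1, br.2⟩, sρ,
    fun j z hz => by simp [sq z hz], sr, fun j φ hφ => ?_, fun φ hφ => ?_⟩,
    fun i z hz => by simp [su z hz], fun φ hφ => ?_, fun i φ hφ => ?_⟩,
    (hu_mem.1.congr eu).oscBound bu, ?_, hall⟩
  · have h1 := (hq j).integral_eq φ hφ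
    rw [dx_eq_pd] at h1
    refine Eq.trans (integral_congr_ae ?_) (h1.trans (congrArg _ (integral_congr_ae ?_)))
    · filter_upwards [eρ] with z hz
      rw [hz]
    · filter_upwards [eq] with z hz
      rw [hz]
  · have h1 := hr.integral_eq φ hφ
    simp only [dx_eq_pd] at h1
    refine Eq.trans (integral_congr_ae ?_) (h1.trans (congrArg _ (integral_congr_ae ?_)))
    · filter_upwards [eq] with z hz
      rw [hz]
    · filter_upwards [er] with z hz
      rw [hz]
  · have h1 := hsol.continuity φ hφ
    simp only [dx_eq_pd, dt_eq_pd] at h1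
    refine Eq.trans (integral_congr_ae ?_) h1
    filter_upwards [eρ, eu] with z h2 h3
    rw [h2, h3]
  · have h1 := hsol.momentum i φ hφ
    simp only [dx_eq_pd, dt_eq_pd] at h1
    refine Eq.trans (integral_congr_ae ?_) h1
    filter_upwards [hall] with z ⟨h1, h2, h3, h4, h5, h6, h7, h8⟩
    rw [pot, h1, h2, h3, h4, h6, h7, h8, potential, capillaryDiv, EuclideanSpace.real_norm_sq_eq]
    ring
  · exact (MemBesov.oscBound bρ (hρ_mem.1.congr eρ)).prodMk bρ (bq.prodMk br)
      ((MemBesov.oscBound bq (hq_mem.1.congr eq)).prodMk bq br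
        (MemBesov.oscBound br (hr_mem.1.congr er)))

end EulerKorteweg

/-! ### Transfer of the balance to the original data. -/

theorem theorem1 (d : ℕ) (T : ℝ) (hT : 0 < T)
    (α β : ℝ) (hα : α < 1) (hβα : β ≤ α) (hβ : 0 < β)
    (hαβ : 1 < min (2 * α + β) (α + 2 * β))
    (I : Set ℝ) (h κ : ℝ → ℝ) (hh : ContDiffOn ℝ 3 h I) (hκ : ContDiffOn ℝ 3 κ I)
    (ρ : SpaceTime d → ℝ) (u : SpaceTime d → Vec d)
    -- the density takes its values in `I`, and stays away from vacuum if `I = (0,∞)`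
    (hI : (I = Set.Ici 0 ∧ ∀ᵐ z ∂(domainMeasure d T), 0 ≤ ρ z) ∨
      (I = Set.Ioi 0 ∧ ∃ c : ℝ, 0 < c ∧ ∀ᵐ z ∂(domainMeasure d T), c ≤ ρ z))
    -- `q = ∇ρ` and `r = Δρ` in the sense of distributions
    (q : SpaceTime d → Vec d) (r : SpaceTime d → ℝ)
    (hq : ∀ j, HasWeakDeriv T j ρ (fun z => q z j)) (hr : HasWeakDiv T q r)
    (hu_mem : MemBesovLinfty T α u) (hρ_mem : MemBesovLinfty T β ρ)
    (hq_mem : MemBesovLinfty T β q) (hr_mem : MemBesovLinfty T β r)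
    (hsol : IsDistribSolution T I h κ ρ u q r) :
    ∃ M : SpaceTime d → Matrix (Fin d) (Fin d) ℝ,
      -- `M` is the weak Jacobian of `κ(ρ)∇ρ`, and its trace is `div(κ(ρ)∇ρ)`
      (∀ i j, HasWeakDeriv T j (fun z => κ (ρ z) * q z i) (fun z => M z i j)) ∧
      (∀ᵐ z ∂(domainMeasure d T), (M z).trace = capillaryDiv I κ ρ q r z) ∧
      -- the local energy balance as an identity of distributions
      (∀ φ : SpaceTime d → ℝ, IsTest T 2 φ →
        regularTerms T I h κ ρ u q r φ + kortewegPairing T κ ρ u q M φ = 0) ∧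
      -- the same for test functions of class `C¹`, by continuous extension
      (∀ φ : SpaceTime d → ℝ, IsTest T 1 φ → ∃ c : ℝ, IsKortewegPairing T κ ρ u q M φ c ∧
        regularTerms T I h κ ρ u q r φ + c = 0) ∧
      -- the same with an integral as the last term, if `div(ρu)` is a locally integrable function
      (∀ δ : SpaceTime d → ℝ, HasWeakDiv T (fun z => ρ z • u z) δ →
        ∀ φ : SpaceTime d → ℝ, IsTest T 1 φ →
          regularTerms T I h κ ρ u q r φ
            + ∫ z, ∑ i, κ (ρ z) * q z i * δ z * dx i φ z ∂(domainMeasure d T) = 0) := by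
  obtain ⟨H, K, ρ', r', u', q', s, hub, hwb, hall⟩ :=
    exists_solution hh hκ hI hq hr hu_mem hρ_mem hq_mem hr_mem hsol
  -- As β ≤ α, this is the smaller of the two exponents, so nothing is lost.
  have hαβ' : 1 < α + 2 * β := hαβ.trans_le (min_le_right _ _)
  obtain ⟨N, hN⟩ := s.exists_isWeakJacobian
  have hterms : ∀ φ, regularTerms T I h κ ρ u q r φ = lineTerms T H K ρ' u' q' r' φ := by
    intro φ
    unfold regularTerms lineTerms
    simp only [dt_eq_pd, dx_eq_pd]
    congr 1
    · refine integral_congr_ae ?_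
      filter_upwards [hall] with z ⟨h1, h2, h3, h4, h5, h6, h7, h8⟩
      rw [energy, lineEnergy, h1, h2, h3, h5, h7, EuclideanSpace.real_norm_sq_eq,
        EuclideanSpace.real_norm_sq_eq]
    · refine integral_congr_ae ?_
      filter_upwards [hall] with z ⟨h1, h2, h3, h4, h5, h6, h7, h8⟩
      refine Finset.sum_congr rfl fun i _ => ?_
      rw [transportFlux, lineFlux, pot, h1, h2, h3, h4, h6, h7, h8, capillaryDiv,
        EuclideanSpace.real_norm_sq_eq, EuclideanSpace.real_norm_sq_eq]
      ring
  have hpair : ∀ φ, kortewegPairing T κ ρ u q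
      (fun z => Matrix.of fun i j => stressJac K ρ' q' N i j z) φ =
      linePairing T K ρ' u' q' N φ := by
    intro φ
    unfold kortewegPairing linePairing
    simp only [dx_eq_pd]
    refine congrArg _ (integral_congr_ae ?_)
    filter_upwards [hall] with z ⟨h1, h2, h3, h4, h5, h6, h7, h8⟩
    simp only [h1, h2, h3, h7, Matrix.of_apply]
  have hstress : ∀ i, (fun z => K (ρ' z) * q' z i) =ᵐ[domainMeasure d T]
      fun z => κ (ρ z) * q z i := fun i => by
    filter_upwards [hall] with z ⟨h1, h2, h3, h4, h5, h6, h7, h8⟩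
    rw [h1, h3, h7]
  have hbalance : ∀ φ : SpaceTime d → ℝ, IsTest T 2 φ → regularTerms T I h κ ρ u q r φ +
      kortewegPairing T κ ρ u q (fun z => Matrix.of fun i j => stressJac K ρ' q' N i j z) φ = 0 :=
    fun φ hφ => by
      rw [hterms, hpair]
      exact s.lineTerms_add_linePairing hβα hαβ' hub hwb hN hφ
  refine ⟨fun z => Matrix.of fun i j => stressJac K ρ' q' N i j z, fun i j => ⟨?_, ?_, ?_⟩, ?_,
    hbalance, fun φ hφ => ?_, fun δ hδ φ hφ => ?_⟩
  · have hb := ((s.density.bm_ρ.comp s.contDiff_K.continuous).mul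
      (s.bmv_q.bm i)).integrable_domain (T := T)
    exact IntegrableOn.locallyIntegrableOn (hb.congr (hstress i))
  · exact IntegrableOn.locallyIntegrableOn (s.stressJac_integrable hN i j)
  · intro φ hφ
    rw [dx_eq_pd]
    refine Eq.trans (integral_congr_ae ?_)
      (s.integral_stress_mul_pd hN i j (hφ.of_le (m := 1) le_top))
    filter_upwards [hstress i] with z hz
    rw [← hz]
  · filter_upwards [hall, s.sum_jacobian_ae hN] with z ⟨h1, h2, h3, h4, h5, h6, h7, h8⟩ hz
    simp only [Matrix.trace, Matrix.diag, Matrix.of_apply, stressJac, Finset.sum_add_distrib,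
      ← Finset.mul_sum, hz, mul_assoc]
    rw [h1, h3, h4, h7, h8, capillaryDiv, EuclideanSpace.real_norm_sq_eq]
    simp only [sq]
  -- The balance for C² test functions forces this value. The pairing along an approximating
  -- sequence is minus the regular terms, which converge because they are continuous for C¹
  -- convergence.
  · refine ⟨-regularTerms T I h κ ρ u q r φ, ⟨hφ.exists_approxC1, fun ψ hψ => ?_⟩, by ring⟩
    rw [hterms]
    refine (s.tendsto_lineTerms hφ hψ).neg.congr fun n => ?_
    have h1 := hbalance _ (hψ.isTest n)
    rw [hterms] at h1
    linarith
  · have hdiv : ∀ φ : SpaceTime d → ℝ, IsTest T ⊤ φ →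
        ∫ z, ∑ j, ρ' z * u' z j * pd (ex j) φ z ∂(domainMeasure d T) =
          -∫ z, δ z * φ z ∂(domainMeasure d T) := fun φ hφ => by
      have h1 := hδ.integral_eq φ hφ
      simp only [dx_eq_pd] at h1
      refine Eq.trans (integral_congr_ae ?_) h1
      filter_upwards [hall] with z ⟨h1, h2, h3, h4, h5, h6, h7, h8⟩
      simp only [h1, h2, PiLp.smul_apply, smul_eq_mul]
    rw [hterms, ← s.lineTerms_add_integral hβα hαβ' hub hwb hδ.locallyIntegrable_right hdiv hφ]
    congr 1
    refine integral_congr_ae ?_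
    filter_upwards [hall] with z ⟨h1, h2, h3, h4, h5, h6, h7, h8⟩
    simp only [h1, h3, h7, dx_eq_pd]
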